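/- **Setting.** Let $\Gamma$ be a finite group, $\Gamma_*$ its set of conjugacy classes and $c^0$ the identity class. For $c\in\Gamma_*$ let $\zeta_c$ be the order of the centralizer of an element of $c$, and let $\bar c=\{x : x^{-1}\in c\}$. For a partition $\mu=(1^{m_1(\mu)}2^{m_2(\mu)}\cdots)$ write $\ell(\mu)$ for its length and $\|\mu\|=|\mu|$ for its size. Let $\mathcal P(\Gamma_*)$ be the set of partition-valued functions $\lambda=(\lambda(c))_{c\in\Gamma_*}$, with $\|\lambda\|=\sum_c|\lambda(c)|$; the notations $\cup$ (union of parts), $\subset$ (inclusion of parts with multiplicity) and $-$ (removal of parts) apply pointwise. Let $(k)_c\in\mathcal P(\Gamma_*)$ be the function whose value at $c$ is the one-part partition $(k)$ and whose other values are empty; by convention $(0)_c=\emptyset$. A partition $\mu$ is identified, where needed, with the function having value $\mu$ at $c^0$ and $\emptyset$ elsewhere. Let $\Gamma_n=\Gamma^n\rtimes S_n$ be the wreath product, with $(g,\sigma)(h,\tau)=(g\,\sigma(h),\sigma\tau)$ and $\sigma(g_1,\dots,g_n)=(g_{\sigma^{-1}(1)},\dots,g_{\sigma^{-1}(n)})$.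 The cycle-product of $x=(g,\sigma)$ at a cycle $(i_1\cdots i_k)$ of $\sigma$ is $g_{i_k}\cdots g_{i_1}$, which is defined up to conjugacy. The type of $x$ is the function $\rho$ such that the parts of $\rho(c)$ are the lengths of the cycles of $\sigma$ (including fixed points) with cycle-product in $c$. The modified type of $x$ is obtained from $\rho$ by decreasing each part of $\rho(c^0)$ by $1$ and dropping zeros. Let $K_\nu(n)\in\mathbb Z[\Gamma_n]$ be the sum of all elements of $\Gamma_n$ of modified type $\nu$, and let $a_{\lambda\mu}^\nu(n)$ be the coefficient in $K_\lambda(n)K_\mu(n)$ of any element of modified type $\nu$. If $\|\nu\|=\|\lambda\|+\|\mu\|$, then for $n\ge\|\nu\|+\ell(\nu(c^0))$ (that is, when $K_\nu(n)\ne0$) this is a number $a_{\lambda\mu}^\nu$ independent of $n$. The Farahat–Higman ring $\mathcal G_\Gamma$ is the free $\mathbb Z$-module with basis $(K_\lambda)_{\lambda\in\mathcal P(\Gamma_*)}$ and bilinear multiplication $K_\lambda K_\mu=\sum_{\|\nu\|=\|\lambda\|+\|\mu\|}a_{\lambda\mu}^\nu K_\nu$. For a partition $\mu=(\mu_1,\dots,\mu_k)$,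 $r\ge k=\ell(\mu)$ and $s>0$, let $\tilde\mu=(\mu_1+1,\dots,\mu_k+1,1,\dots,1)$ with $r$ parts, and let $p(\mu,r,s)$ be the number of distinct rearrangements $(t_1,\dots,t_r)$ of the parts of $\tilde\mu$ such that $s\neq t_1+\cdots+t_a$ for all $a=1,\dots,r$. **Theorem.** Let $\lambda\in\mathcal P(\Gamma_*)$ and $r\ge0$. The structure constants $a_{\lambda\,(r)_{c^0}}^\nu(n)$ with $\|\nu\|=\|\lambda\|+r$ are the same for all $n$ for which $\Gamma_n$ contains an element of modified type $\nu$. If $r=0$, then $K_\lambda K_{(0)_{c^0}}=K_\lambda$. If $r\ge1$, then in $\mathcal G_\Gamma$ (viewed inside $\mathbb Q\otimes_{\mathbb Z}\mathcal G_\Gamma$) $$\begin{aligned} K_\lambda K_{(r)_{c^0}} &=\sum_{I_1}\frac{\left(m_{\|\mu\|+r}(\lambda(c^0))+1\right)(\|\mu\|+r+1)\,r!}{(r+1-\ell(\mu))!\prod_{i\ge1}m_i(\mu)!}\,K_{\lambda\cup(\|\mu\|+r)_{c^0}-\mu}\\ &+\sum_{I_2}\frac{\left(m_{\|\mu\|+r+k}(\lambda(c))+1\right)(\|\mu\|+r+k)\,r!}{(r-\ell(\mu))!\prod_{i\ge1}m_i(\mu)!}\,K_{\lambda\cup(\|\mu\|+r+k)_c-(\mu\cup(k)_c)}\\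 &+\sum_{I_3}s_1s_2\,\zeta_c\,p(\mu,r,s_1)\,(m_{s_1}(\lambda(c))+1)(m_{s_2}(\lambda(\bar c))+1)\,K_{\lambda\cup(s_1)_c\cup(s_2)_{\bar c}-\mu}\\ &+\sum_{I_4}s^2\,\zeta_c\,p(\mu,r,s)\,(m_s(\lambda(c))+1)(m_s(\lambda(\bar c))+1)\,K_{\lambda\cup(s)_c\cup(s)_{\bar c}-\mu}\\ &+\sum_{I_5}s^2\,\zeta_c\,p(\mu,r,s)\binom{m_s(\lambda(c))+2}{2}\,K_{\lambda\cup(s)_c\cup(s)_c-\mu}, \end{aligned}$$ where $\mu$ always runs over partitions with $\mu\subset\lambda(c^0)$ (each partition taken once), and - $I_1=\{\mu : \ell(\mu)\le r+1\}$; - $I_2=\{(c,\mu,k) : c\ne c^0,\ \ell(\mu)\le r,\ k\ge1,\ (k)_c\subset\lambda\}$ (each part size $k$ of $\lambda(c)$ taken once); - $I_3=\{(c,\mu,s_1,s_2) : c\neq c^0,\ \ell(\mu)\le r,\ 0<s_1<s_2,\ s_1+s_2=\|\mu\|+r\}$; - $I_4=\{(\{c,\bar c\},\mu,s) : c\ne\bar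 c,\ \ell(\mu)\le r,\ 2s=\|\mu\|+r\}$, with $\{c,\bar c\}$ an unordered pair; - $I_5=\{(c,\mu,s) : c=\bar c\ne c^0,\ \ell(\mu)\le r,\ 2s=\|\mu\|+r\}$. -/

import Mathlib

open scoped TensorProduct

namespace FarahatHigman

/-! ### Conjugacy classes of the finite group `Γ` -/

noncomputable instance instFintypeConjClasses (Γ : Type*) [Group Γ] [Finite Γ] :
    Fintype (ConjClasses Γ) := Fintype.ofFinite _

/-- `ζ_c`: the order of the centralizer in `Γ` of an element of the conjugacy class `c`. -/
noncomputable def zeta {Γ : Type*} [Group Γ] (c : ConjClasses Γ) : ℕ :=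
  Nat.card (Subgroup.centralizer ({Quotient.out c} : Set Γ))

/-- The opposite class `c̄ = {x | x⁻¹ ∈ c}`. -/
def bar {Γ : Type*} [Group Γ] : ConjClasses Γ → ConjClasses Γ :=
  Quotient.map' (fun g => g⁻¹) (by
    intro a b h
    obtain ⟨u, hu⟩ := isConj_iff.1 (show IsConj a b from h)
    exact isConj_iff.2 ⟨u, by rw [← hu]; group⟩)

theorem bar_mk {Γ : Type*} [Group Γ] (g : Γ) :
    bar (ConjClasses.mk g) = ConjClasses.mk g⁻¹ := rfl

/-- The non-identity conjugacy classes `Γ_* \ {c⁰}`; here `c⁰ = (1 : ConjClasses Γ)`. -/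
noncomputable def nonIdClasses (Γ : Type*) [Group Γ] [Finite Γ] : Finset (ConjClasses Γ) :=
  (Set.toFinite {c : ConjClasses Γ | c ≠ 1}).toFinset

/-- The real classes `c = c̄` other than `c⁰`. -/
noncomputable def realClasses (Γ : Type*) [Group Γ] [Finite Γ] : Finset (ConjClasses Γ) :=
  (Set.toFinite {c : ConjClasses Γ | bar c = c ∧ c ≠ 1}).toFinset

/-- The unordered pairs `{c, c̄}` with `c ≠ c̄`. -/
noncomputable def complexPairs (Γ : Type*) [Group Γ] [Finite Γ] :
    Finset (Sym2 (ConjClasses Γ)) :=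
  (Set.toFinite {e : Sym2 (ConjClasses Γ) | ∃ c, c ≠ bar c ∧ e = s(c, bar c)}).toFinset

/-! ### Partitions and partition-valued functions

A partition is a finite multiset of positive integers: `μ ⊂ λ` is `μ ≤ λ`, `λ ∪ μ` is `λ + μ`,
`λ - μ` is `λ - μ`, the length is `Multiset.card`, and the empty partition is `0`.
The same operations are applied pointwise to partition-valued functions. -/

/-- The size `|μ|` (also written `‖μ‖`) of a partition. -/
def size (μ : Multiset ℕ+) : ℕ := (μ.map PNat.val).sum

/-- `m_i(μ)`: the number of parts of `μ` equal to `i`. -/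
def mult (μ : Multiset ℕ+) (i : ℕ) : ℕ := (μ.map PNat.val).count i

/-- `∏_{i ≥ 1} m_i(μ)!`. -/
def multFact (μ : Multiset ℕ+) : ℕ := ∏ i ∈ μ.toFinset, (mult μ i).factorial

/-- The partition `μ̃ = (μ₁ + 1, …, μ_k + 1, 1, …, 1)` with `r` parts (for `r ≥ ℓ(μ)`). -/
def tildePart (μ : Multiset ℕ+) (r : ℕ) : Multiset ℕ :=
  μ.map (fun k : ℕ+ => (k : ℕ) + 1) + Multiset.replicate (r - Multiset.card μ) 1

/-- `p(μ, r, s)`: the number of distinct rearrangements of the `r` parts of `μ̃`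
such that `s` is not the sum of the first `a` parts for any `a = 1, …, r`. -/
def p (μ : Multiset ℕ+) (r s : ℕ) : ℕ :=
  ((tildePart μ r).lists.toFinset.filter
    fun l : List ℕ => s ∉ (Finset.Icc 1 r).image fun a => (l.take a).sum).card

/-- Partition-valued functions on the set of conjugacy classes of `Γ`. -/
abbrev PType (Γ : Type*) [Group Γ] : Type _ := ConjClasses Γ → Multiset ℕ+

/-- The degree `‖ρ‖ = ∑_c |ρ(c)|`. -/
noncomputable def deg {Γ : Type*} [Group Γ] [Finite Γ] (ρ : PType Γ) : ℕ :=
  ∑ c, size (ρ c)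

open Classical in
/-- The partition-valued function with value `μ` at `c` and `∅` elsewhere. -/
noncomputable def singleAt {Γ : Type*} [Group Γ] (c : ConjClasses Γ) (μ : Multiset ℕ+) : PType Γ :=
  Pi.single c μ

/-- The single cycle `(k)_c`, which is the empty function for `k = 0`. -/
noncomputable def cyc {Γ : Type*} [Group Γ] (k : ℕ) (c : ConjClasses Γ) : PType Γ :=
  if h : 0 < k then singleAt c {⟨k, h⟩} else 0

/-- The partitions `μ ⊂ α` with `ℓ(μ) ≤ r`. -/
def subParts (α : Multiset ℕ+) (r : ℕ) : Finset (Multiset ℕ+) :=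
  (Finset.Iic α).filter fun μ => Multiset.card μ ≤ r

theorem finite_deg_eq (Γ : Type*) [Group Γ] [Finite Γ] (d : ℕ) :
    {ν : PType Γ | deg ν = d}.Finite := by
  classical
  have key : {μ : Multiset ℕ+ | size μ ≤ d}.Finite := by
    have hI : {k : ℕ+ | (k : ℕ) ≤ d}.Finite :=
      (Set.finite_Iic d).preimage (PNat.coe_injective.injOn)
    refine (Set.finite_Iic (d • hI.toFinset.val)).subset fun μ hμ => ?_
    have hμ' : size μ ≤ d := hμ
    rw [Set.mem_Iic, Multiset.le_iff_count]
    intro k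
    rw [Multiset.count_nsmul]
    by_cases hk : k ∈ μ
    · have h1 : (k : ℕ) ≤ size μ :=
        Multiset.single_le_sum (fun _ _ => Nat.zero_le _) _ (Multiset.mem_map_of_mem _ hk)
      have h2 : k ∈ hI.toFinset.val := by
        simpa using h1.trans hμ'
      have h3 : Multiset.card μ ≤ size μ := by
        have := Multiset.card_nsmul_le_sum (s := μ.map PNat.val) (a := 1)
          (by intro x hx; obtain ⟨y, _, rfl⟩ := Multiset.mem_map.1 hx; exact y.pos)
        simpa [size] using this
      have h4 := Multiset.count_le_card k μ
      have h5 : 1 ≤ hI.toFinset.val.count k := Multiset.one_le_count_iff_mem.2 h2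
      calc μ.count k ≤ d := h4.trans (h3.trans hμ')
        _ ≤ d * hI.toFinset.val.count k := Nat.le_mul_of_pos_right _ h5
    · rw [Multiset.count_eq_zero_of_notMem hk]
      exact Nat.zero_le _
  refine (Set.Finite.pi' fun _ : ConjClasses Γ => key).subset fun ν hν c => ?_
  have hν' : deg ν = d := hν
  rw [Set.mem_ofPred_eq, ← hν']
  exact Finset.single_le_sum (f := fun c => size (ν c)) (fun _ _ => Nat.zero_le _)
    (Finset.mem_univ c)

/-- The finite set of all `ν` of degree `d`. -/
noncomputable def ofDeg (Γ : Type*) [Group Γ] [Finite Γ] (d : ℕ) : Finset (PType Γ) :=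
  (finite_deg_eq Γ d).toFinset

/-! ### The wreath product `Γ_n` -/

/-- The action of `S_n` on `Γⁿ`: `σ(g₁, …, g_n) = (g_{σ⁻¹(1)}, …, g_{σ⁻¹(n)})`. -/
def permAct (Γ : Type*) [Group Γ] (n : ℕ) :
    Equiv.Perm (Fin n) →* MulAut (Fin n → Γ) where
  toFun σ :=
    { toFun := fun g i => g (σ⁻¹ i)
      invFun := fun g i => g (σ i)
      left_inv := fun g => by ext i; simp
      right_inv := fun g => by ext i; simp
      map_mul' := fun _ _ => rfl }
  map_one' := rfl
  map_mul' σ τ := by ext g i; simp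

/-- The wreath product `Γ_n = Γⁿ ⋊ S_n`, with `(g, σ)(h, τ) = (g σ(h), σ τ)`. -/
abbrev Wreath (Γ : Type*) [Group Γ] (n : ℕ) : Type _ :=
  (Fin n → Γ) ⋊[permAct Γ n] Equiv.Perm (Fin n)

instance instFiniteWreath (Γ : Type*) [Group Γ] [Finite Γ] (n : ℕ) : Finite (Wreath Γ n) :=
  Finite.of_equiv _ SemidirectProduct.equivProd.symm

noncomputable instance instFintypeWreath (Γ : Type*) [Group Γ] [Finite Γ] (n : ℕ) :
    Fintype (Wreath Γ n) := Fintype.ofFinite _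

/-- The length of the cycle of `σ` through `i` (it is `1` if `i` is fixed). -/
noncomputable def cycleLen {n : ℕ} (σ : Equiv.Perm (Fin n)) (i : Fin n) : ℕ+ :=
  ⟨Function.minimalPeriod σ i,
    Function.minimalPeriod_pos_of_mem_periodicPts (σ.injective.mem_periodicPts i)⟩

/-- The cycle-product `g_{i_k} ⋯ g_{i_2} g_{i_1}` of `x = (g, σ)` for the cycle
`(i₁ i₂ … i_k)` of `σ` that starts at `i₁ = i`. -/
noncomputable def cycleProd {Γ : Type*} [Group Γ] {n : ℕ} (x : Wreath Γ n) (i : Fin n) : Γ :=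
  ((List.range (cycleLen x.right i)).map fun j => x.left ((x.right ^ j) i)).reverse.prod

open Classical in
/-- The type of `x = (g, σ)`: its value at `c` is the multiset of the lengths of the cycles of `σ`
(fixed points included) whose cycle-product lies in `c`. The cycles are the classes of
`Equiv.Perm.SameCycle σ`; the conjugacy class of the cycle-product does not depend on
the point of the cycle at which one starts. -/
noncomputable def wtype {Γ : Type*} [Group Γ] {n : ℕ} (x : Wreath Γ n) : PType Γ := fun c =>
  ((Finset.univ : Finset (Quotient (Equiv.Perm.SameCycle.setoid x.right))).filter
      fun q => ConjClasses.mk (cycleProd x q.out) = c).val.map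
    fun q => cycleLen x.right q.out

/-- The partition `(ρ₁ - 1, …, ρ_r - 1)` obtained from `(ρ₁, …, ρ_r)`, zeros being dropped. -/
def decr (ρ : Multiset ℕ+) : Multiset ℕ+ :=
  ρ.filterMap fun k : ℕ+ => if h : 0 < (k : ℕ) - 1 then some ⟨(k : ℕ) - 1, h⟩ else none

open Classical in
/-- The modified type of `x`: in its type, the partition at `c⁰` is decreased by one part
by part. -/
noncomputable def mtype {Γ : Type*} [Group Γ] {n : ℕ} (x : Wreath Γ n) : PType Γ :=
  fun c => if c = 1 then decr (wtype x c) else wtype x c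

open Classical in
/-- `K_ν(n)`: the sum in `ℤ[Γ_n]` of all elements of `Γ_n` of modified type `ν`. -/
noncomputable def classSum {Γ : Type*} [Group Γ] [Finite Γ] (n : ℕ) (ν : PType Γ) :
    MonoidAlgebra ℤ (Wreath Γ n) :=
  ∑ x ∈ Finset.univ.filter (fun x : Wreath Γ n => mtype x = ν), MonoidAlgebra.of ℤ _ x

open Classical in
/-- The structure constant `a_{λμ}^ν(n) = [K_ν(n)] K_λ(n) K_μ(n)`: the coefficient in
`K_λ(n) K_μ(n)` of any element of `Γ_n` of modified type `ν`
(set to `0` if there is none, i.e. if `K_ν(n) = 0`). -/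
noncomputable def structConst {Γ : Type*} [Group Γ] [Finite Γ] (n : ℕ) (lam μ ν : PType Γ) : ℤ :=
  if h : ∃ z : Wreath Γ n, mtype z = ν then
    (classSum n lam * classSum n μ).coeff h.choose
  else 0

/-- The structure constant `a_{λμ}^ν`, for `‖ν‖ = ‖λ‖ + ‖μ‖`: the common value of `a_{λμ}^ν(n)`
for all `n ≥ ‖ν‖ + ℓ(ν(c⁰))`, read off at the smallest such `n`. -/
noncomputable def fhConst {Γ : Type*} [Group Γ] [Finite Γ] (lam μ ν : PType Γ) : ℤ :=
  structConst (deg ν + Multiset.card (ν 1)) lam μ ν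

/-! ### The Farahat-Higman ring `𝒢_Γ` -/

/-- The Farahat-Higman ring `𝒢_Γ`: the free `ℤ`-module with basis `K_ν`, `ν` a partition-valued
function on the conjugacy classes of `Γ`, with the multiplication `FHRing.mulHom` below. -/
def FHRing (Γ : Type*) [Group Γ] : Type _ := PType Γ →₀ ℤ

noncomputable instance instAddCommGroupFHRing (Γ : Type*) [Group Γ] : AddCommGroup (FHRing Γ) :=
  inferInstanceAs (AddCommGroup (PType Γ →₀ ℤ))

/-- The basis element `K_ν`. -/
noncomputable def K {Γ : Type*} [Group Γ] (ν : PType Γ) : FHRing Γ :=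
  (Finsupp.single ν 1 : PType Γ →₀ ℤ)

/-- The bilinear multiplication with `K_λ K_μ = ∑_{‖ν‖ = ‖λ‖ + ‖μ‖} a_{λμ}^ν K_ν`. -/
noncomputable def FHRing.mulHom (Γ : Type*) [Group Γ] [Finite Γ] :
    FHRing Γ →ₗ[ℤ] FHRing Γ →ₗ[ℤ] FHRing Γ :=
  Finsupp.linearCombination ℤ fun lam : PType Γ =>
    (Finsupp.linearCombination ℤ fun μ : PType Γ =>
      ∑ ν ∈ ofDeg Γ (deg lam + deg μ), fhConst lam μ ν • K ν : FHRing Γ →ₗ[ℤ] FHRing Γ)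

noncomputable instance instMulFHRing (Γ : Type*) [Group Γ] [Finite Γ] : Mul (FHRing Γ) :=
  ⟨fun x y => FHRing.mulHom Γ x y⟩

theorem K_mul_K {Γ : Type*} [Group Γ] [Finite Γ] (lam μ : PType Γ) :
    K lam * K μ = ∑ ν ∈ ofDeg Γ (deg lam + deg μ), fhConst lam μ ν • K ν := by
  change FHRing.mulHom Γ (K lam) (K μ) = _
  have h1 : FHRing.mulHom Γ (K lam) = (Finsupp.linearCombination ℤ fun μ : PType Γ =>
      ∑ ν ∈ ofDeg Γ (deg lam + deg μ), fhConst lam μ ν • K ν : FHRing Γ →ₗ[ℤ] FHRing Γ) := by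
    unfold FHRing.mulHom K
    exact (Finsupp.linearCombination_single ℤ (1 : ℤ) lam).trans (one_smul _ _)
  rw [h1]
  exact (Finsupp.linearCombination_single ℤ (1 : ℤ) μ).trans (one_smul _ _)

end FarahatHigman

open FarahatHigman

/-! The group `Γ_n` acts faithfully on the points of `Γ × {1, …, n}`, commuting with right
translation by `Γ`. If `P` lies over a cycle of length `k` of `x`, then `x ^ k • P` is a right
translate of `P` by an element `mon x P`, the monodromy, whose class is that of the cycle-product.
Products of elements can thus be studied by following orbits of points instead of multiplying
cycle-products.

The coefficient of `z` in the product counts the `y` of modified type `(r)` for which `x = z y⁻¹`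
has modified type `λ` (`coeff_classSum_mul`). For `r ≥ 1` such a `y` is an `(r + 1)`-cycle with
cycle-product `1`. The degree of a modified type is `n` minus the number of cycles with trivial
product (`deg_mtype`), so `‖ν‖ = ‖λ‖ + r` makes `y` meet at least `r` trivial cycles of `x`, while
it moves only `r + 1` positions. Hence (`trichotomy`) there are three possibilities. (a) The moved
positions lie in `r + 1` different trivial cycles of `x`, which `z` joins into one trivial cycle.
(b) The same, but exactly one of these cycles is nontrivial, and its class is that of the joined
cycle of `z`. (c) They lie in `r` trivial cycles, one of which is met twice, and `z` has in their
place two nontrivial cycles with inverse monodromies.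

Seen from `z`, in (a) and (b) `y` cuts a cycle of `z` into `r + 1` arcs, so it amounts to a starting
point and a composition of the cycle length (`card_split`). In (c) it amounts to points `P`, `Q` on
the two cycles and a composition of the sum of their lengths into `r` parts, with the first length
not a partial sum (`card_merge`). A given `y` arises from `(r + 1)|Γ|`, `|Γ|` or `2|Γ|` choices of
points respectively (`label_count`), and double counting gives `coeff_eq_sum`.

Lowering each part by `1` sorts the compositions by the partition `μ` removed from `λ(c⁰)`; those
over `μ` are the rearrangements of `μ̃`, all of them in (a), (b) and `p(μ, r, s)` of them in (c).
Positions of `z` in cycles of given class and length are counted by multiplicities, and `ζ_c` counts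
the points over a position with a prescribed monodromy in its class. In (c) the symmetry that
exchanges the two cycles, `(c, s₁, s₂) ↦ (c̄, s₂, s₁)`, absorbs the factor `1/2` and separates the
last three sums. The result depends only on the modified type of `z`, which also gives independence
of `n`. -/

namespace FarahatHigman

/-- A point of the free right `Γ`-set `Γ × {1, …, n}` on which `Γ_n` acts from the left. -/
@[ext]
structure Pt (Γ : Type*) (n : ℕ) where
  /-- the coordinate in `Γ` -/
  val : Γ
  /-- the position -/
  pos : Fin n

/-- Points are pairs. -/
def ptEquiv (Γ : Type*) (n : ℕ) : Pt Γ n ≃ Γ × Fin n where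
  toFun P := (P.val, P.pos)
  invFun q := ⟨q.1, q.2⟩
  left_inv _ := rfl
  right_inv _ := rfl

instance instFinitePt (Γ : Type*) [Finite Γ] (n : ℕ) : Finite (Pt Γ n) :=
  Finite.of_equiv _ (ptEquiv Γ n).symm

noncomputable instance instFintypePt (Γ : Type*) [Finite Γ] (n : ℕ) : Fintype (Pt Γ n) :=
  Fintype.ofFinite _

/-! ### The action on points, cycle lengths and monodromy -/

section Points

variable {Γ : Type*} [Group Γ] {n : ℕ}

instance instMulActionPt : MulAction (Wreath Γ n) (Pt Γ n) where
  smul x P := ⟨x.left (x.right P.pos) * P.val, x.right P.pos⟩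
  one_smul P := by
    change (⟨_, _⟩ : Pt Γ n) = P
    ext <;> simp
  mul_smul x y P := by
    change (⟨_, _⟩ : Pt Γ n) = ⟨x.left (x.right (y.right P.pos)) *
      (y.left (y.right P.pos) * P.val), x.right (y.right P.pos)⟩
    ext <;> simp [permAct, mul_assoc]

theorem smul_val (x : Wreath Γ n) (P : Pt Γ n) :
    (x • P).val = x.left (x.right P.pos) * P.val := rfl

theorem smul_pos (x : Wreath Γ n) (P : Pt Γ n) : (x • P).pos = x.right P.pos := rfl

theorem right_pow (x : Wreath Γ n) (k : ℕ) : (x ^ k).right = x.right ^ k :=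
  map_pow SemidirectProduct.rightHom x k

theorem pow_smul_pos (x : Wreath Γ n) (k : ℕ) (P : Pt Γ n) :
    (x ^ k • P).pos = (x.right ^ k) P.pos := by
  rw [smul_pos, right_pow]

/-- Right translation of a point by an element of `Γ`. -/
def Pt.tr (P : Pt Γ n) (g : Γ) : Pt Γ n := ⟨P.val * g, P.pos⟩

@[simp] theorem Pt.tr_pos (P : Pt Γ n) (g : Γ) : (P.tr g).pos = P.pos := rfl

@[simp] theorem Pt.tr_one (P : Pt Γ n) : P.tr 1 = P := by ext <;> simp [Pt.tr]

theorem Pt.tr_tr (P : Pt Γ n) (g h : Γ) : (P.tr g).tr h = P.tr (g * h) := by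
  ext <;> simp [Pt.tr, mul_assoc]

theorem Pt.tr_inj {P : Pt Γ n} {g h : Γ} : P.tr g = P.tr h ↔ g = h := by
  simp [Pt.tr]

theorem smul_tr (x : Wreath Γ n) (P : Pt Γ n) (g : Γ) : x • P.tr g = (x • P).tr g := by
  ext <;> simp [Pt.tr, smul_val, smul_pos, mul_assoc]

theorem Pt.exists_tr {P Q : Pt Γ n} (h : P.pos = Q.pos) : ∃ g, P = Q.tr g :=
  ⟨Q.val⁻¹ * P.val, by ext <;> simp [Pt.tr, h]⟩

/-- The points with `Γ`-coordinate `1` already determine both components of an element. -/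
theorem wreath_ext {x y : Wreath Γ n} (h : ∀ P : Pt Γ n, x • P = y • P) : x = y := by
  have h2 : x.right = y.right := by
    ext i
    exact congrArg (fun P : Pt Γ n => (P.pos : ℕ)) (h ⟨1, i⟩)
  ext i
  · have := congrArg Pt.val (h ⟨1, x.right⁻¹ i⟩)
    simpa [smul_val, ← h2] using this
  · rw [h2]

/-- The length of the cycle of `x` through `i`. -/
noncomputable def len (x : Wreath Γ n) (i : Fin n) : ℕ := Function.minimalPeriod x.right i

/-- The class of the cycle-product of `x` at the cycle through `i`. -/
noncomputable def cls (x : Wreath Γ n) (i : Fin n) : ConjClasses Γ :=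
  ConjClasses.mk (cycleProd x i)

theorem mem_periodicPts (x : Wreath Γ n) (i : Fin n) : i ∈ Function.periodicPts x.right :=
  x.right.injective.mem_periodicPts i

theorem len_pos (x : Wreath Γ n) (i : Fin n) : 0 < len x i :=
  Function.minimalPeriod_pos_of_mem_periodicPts (mem_periodicPts x i)

theorem right_pow_len (x : Wreath Γ n) (i : Fin n) : (x.right ^ len x i) i = i := by
  rw [← Equiv.Perm.iterate_eq_pow]
  exact Function.iterate_minimalPeriod

/-- Iterating the action uses the coordinates at the images `1, …, k` of the position under powers
of `x.right`, whereas the product defining `cycleProd` uses `0, …, k - 1`; the two extra factors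
correct this shift. -/
theorem pow_smul_val (x : Wreath Γ n) (P : Pt Γ n) (k : ℕ) :
    (x ^ k • P).val * P.val⁻¹ * x.left P.pos =
      x.left ((x.right ^ k) P.pos) *
        ((List.range k).map fun j => x.left ((x.right ^ j) P.pos)).reverse.prod := by
  induction k with
  | zero => simp
  | succ k ih =>
    rw [List.range_succ, List.map_append, List.reverse_append, List.prod_append]
    simp only [List.map_cons, List.map_nil, List.reverse_singleton, List.prod_singleton]
    rw [← ih, pow_succ', mul_smul, smul_val, pow_smul_pos, pow_succ', Equiv.Perm.mul_apply]
    simp only [mul_assoc]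

/-- Because of that shift, and because `P` has an arbitrary `Γ`-coordinate, the translation is
conjugate to `cycleProd` rather than equal to it. -/
theorem exists_pow_len_smul (x : Wreath Γ n) (P : Pt Γ n) :
    ∃ h, x ^ len x P.pos • P = P.tr h ∧ ConjClasses.mk h = cls x P.pos := by
  obtain ⟨h, hh⟩ := Pt.exists_tr (P := x ^ len x P.pos • P) (Q := P)
    (by rw [pow_smul_pos, right_pow_len])
  refine ⟨h, hh, ?_⟩
  have h1 := pow_smul_val x P (len x P.pos)
  rw [hh, right_pow_len] at h1
  have h2 : P.val * h * P.val⁻¹ * x.left P.pos = x.left P.pos * cycleProd x P.pos := h1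
  refine ConjClasses.mk_eq_mk_iff_isConj.2 (isConj_iff.2 ⟨(x.left P.pos)⁻¹ * P.val, ?_⟩)
  calc (x.left P.pos)⁻¹ * P.val * h * ((x.left P.pos)⁻¹ * P.val)⁻¹
      = (x.left P.pos)⁻¹ * (P.val * h * P.val⁻¹ * x.left P.pos) := by group
    _ = cycleProd x P.pos := by rw [h2]; group

/-- The monodromy of `x` at `P`. -/
noncomputable def mon (x : Wreath Γ n) (P : Pt Γ n) : Γ := P.val⁻¹ * (x ^ len x P.pos • P).val

theorem pow_len_smul (x : Wreath Γ n) (P : Pt Γ n) : x ^ len x P.pos • P = P.tr (mon x P) := by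
  obtain ⟨h, h1, -⟩ := exists_pow_len_smul x P
  rw [mon, h1]
  simp [Pt.tr]

theorem mk_mon (x : Wreath Γ n) (P : Pt Γ n) : ConjClasses.mk (mon x P) = cls x P.pos := by
  obtain ⟨h, h1, h2⟩ := exists_pow_len_smul x P
  rw [pow_len_smul, Pt.tr_inj] at h1
  rw [h1, h2]

theorem mon_tr (x : Wreath Γ n) (P : Pt Γ n) (g : Γ) :
    mon x (P.tr g) = g⁻¹ * mon x P * g := by
  have h1 := pow_len_smul x (P.tr g)
  rw [smul_tr, Pt.tr_pos, pow_len_smul, Pt.tr_tr, Pt.tr_tr, Pt.tr_inj] at h1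
  rw [mul_assoc, h1]
  group

theorem len_eq_of_return {x : Wreath Γ n} {P : Pt Γ n} {k : ℕ} (hk : 0 < k)
    (h : (x ^ k • P).pos = P.pos) (hm : ∀ m, 0 < m → m < k → (x ^ m • P).pos ≠ P.pos) :
    len x P.pos = k := by
  rw [pow_smul_pos, ← Equiv.Perm.iterate_eq_pow] at h
  refine le_antisymm (Function.IsPeriodicPt.minimalPeriod_le hk h) (not_lt.1 fun hlt => ?_)
  exact hm _ (len_pos x _) hlt (by rw [pow_smul_pos, right_pow_len])

theorem mon_eq_of_return {x : Wreath Γ n} {P : Pt Γ n} {h : Γ}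
    (hh : x ^ len x P.pos • P = P.tr h) : mon x P = h := by
  rw [pow_len_smul, Pt.tr_inj] at hh
  exact hh

theorem pow_smul_pos_ne {x : Wreath Γ n} {P : Pt Γ n} {m : ℕ} (h0 : 0 < m)
    (h1 : m < len x P.pos) : (x ^ m • P).pos ≠ P.pos := by
  rw [pow_smul_pos, ← Equiv.Perm.iterate_eq_pow]
  exact Function.not_isPeriodicPt_of_pos_of_lt_minimalPeriod h0.ne' h1

theorem pow_smul_pos_inj {x : Wreath Γ n} {P : Pt Γ n} {a b : ℕ}
    (ha : a < len x P.pos) (hb : b < len x P.pos) (h : (x ^ a • P).pos = (x ^ b • P).pos) :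
    a = b := by
  simp only [pow_smul_pos, ← Equiv.Perm.iterate_eq_pow] at h
  exact (Function.iterate_eq_iterate_iff_of_lt_minimalPeriod ha hb).1 h

theorem len_pow_smul (x : Wreath Γ n) (P : Pt Γ n) (k : ℕ) :
    len x (x ^ k • P).pos = len x P.pos := by
  rw [pow_smul_pos, ← Equiv.Perm.iterate_eq_pow]
  exact Function.minimalPeriod_apply_iterate (mem_periodicPts x _) k

theorem mon_pow_smul (x : Wreath Γ n) (P : Pt Γ n) (k : ℕ) :
    mon x (x ^ k • P) = mon x P := by
  apply mon_eq_of_return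
  rw [len_pow_smul, smul_smul, ← pow_add, add_comm, pow_add, mul_smul, pow_len_smul, smul_tr]

theorem cls_pow_smul (x : Wreath Γ n) (P : Pt Γ n) (k : ℕ) :
    cls x (x ^ k • P).pos = cls x P.pos := by
  rw [← mk_mon, mon_pow_smul, mk_mon]

theorem SameCycle.exists_pow_smul {x : Wreath Γ n} {P Q : Pt Γ n}
    (h : x.right.SameCycle P.pos Q.pos) :
    ∃ m, m < len x P.pos ∧ (x ^ m • P).pos = Q.pos := by
  obtain ⟨m, hm⟩ := h.exists_nat_pow_eq
  refine ⟨m % len x P.pos, Nat.mod_lt _ (len_pos x _), ?_⟩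
  rw [pow_smul_pos, ← hm, ← Equiv.Perm.iterate_eq_pow, ← Equiv.Perm.iterate_eq_pow]
  exact Function.iterate_mod_minimalPeriod_eq

theorem sameCycle_pow_smul (x : Wreath Γ n) (P : Pt Γ n) (m : ℕ) :
    x.right.SameCycle P.pos (x ^ m • P).pos :=
  ⟨m, by rw [pow_smul_pos, zpow_natCast]⟩

theorem len_eq_of_sameCycle {x : Wreath Γ n} {i j : Fin n} (h : x.right.SameCycle i j) :
    len x j = len x i := by
  obtain ⟨m, -, hm⟩ := SameCycle.exists_pow_smul (P := (⟨1, i⟩ : Pt Γ n)) (Q := ⟨1, j⟩) h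
  have := len_pow_smul x (⟨1, i⟩ : Pt Γ n) m
  rwa [hm] at this

theorem cls_eq_of_sameCycle {x : Wreath Γ n} {i j : Fin n} (h : x.right.SameCycle i j) :
    cls x j = cls x i := by
  obtain ⟨m, -, hm⟩ := SameCycle.exists_pow_smul (P := (⟨1, i⟩ : Pt Γ n)) (Q := ⟨1, j⟩) h
  have := cls_pow_smul x (⟨1, i⟩ : Pt Γ n) m
  rwa [hm] at this

open Classical in
theorem card_sameCycle (x : Wreath Γ n) (i : Fin n) :
    (Finset.univ.filter fun j => x.right.SameCycle i j).card = len x i := by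
  have : (Finset.univ.filter fun j => x.right.SameCycle i j) =
      (Finset.range (len x i)).image fun m => (x ^ m • (⟨1, i⟩ : Pt Γ n)).pos := by
    ext j
    simp only [Finset.mem_filter, Finset.mem_univ, true_and, Finset.mem_image, Finset.mem_range]
    constructor
    · intro h
      obtain ⟨m, h1, h2⟩ := SameCycle.exists_pow_smul (P := (⟨1, i⟩ : Pt Γ n)) (Q := ⟨1, j⟩) h
      exact ⟨m, h1, h2⟩
    · rintro ⟨m, -, rfl⟩
      exact sameCycle_pow_smul x (⟨1, i⟩ : Pt Γ n) m
  rw [this, Finset.card_image_of_injOn, Finset.card_range]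
  intro a ha b hb hab
  exact pow_smul_pos_inj (P := (⟨1, i⟩ : Pt Γ n)) (by simpa using ha) (by simpa using hb) hab

end Points

/-! ### Contribution of a single cycle to the modified type -/

theorem decr_add (ρ τ : Multiset ℕ+) : decr (ρ + τ) = decr ρ + decr τ :=
  Multiset.filterMap_add _ _ _

theorem decr_zero : decr 0 = 0 := rfl

/-- `decr` as an additive homomorphism. -/
def decrHom : Multiset ℕ+ →+ Multiset ℕ+ where
  toFun := decr
  map_zero' := decr_zero
  map_add' := decr_add

section Mcyc

variable {Γ : Type*} [Group Γ]

theorem cyc_zero (c : ConjClasses Γ) : cyc 0 c = 0 := rfl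

theorem cyc_pos {k : ℕ} (h : 0 < k) (c : ConjClasses Γ) : cyc k c = singleAt c {k.toPNat h} := by
  rw [cyc, dif_pos h]
  rfl

open Classical in
theorem singleAt_self (c : ConjClasses Γ) (μ : Multiset ℕ+) : singleAt c μ c = μ :=
  Pi.single_eq_same _ _

open Classical in
theorem singleAt_of_ne {c d : ConjClasses Γ} (h : d ≠ c) (μ : Multiset ℕ+) :
    singleAt c μ d = 0 :=
  Pi.single_eq_of_ne h _

open Classical in
theorem singleAt_add (c : ConjClasses Γ) (μ ν : Multiset ℕ+) :
    singleAt c (μ + ν) = singleAt c μ + singleAt c ν :=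
  Pi.single_add _ _ _

open Classical in
theorem singleAt_zero (c : ConjClasses Γ) : singleAt c 0 = (0 : PType Γ) :=
  Pi.single_zero _

theorem cyc_of_ne {c d : ConjClasses Γ} (h : d ≠ c) (k : ℕ) : cyc k c d = 0 := by
  rw [cyc]
  split_ifs
  · exact singleAt_of_ne h _
  · rfl

theorem cyc_self {k : ℕ} (h : 0 < k) (c : ConjClasses Γ) : cyc k c c = {k.toPNat h} := by
  rw [cyc_pos h, singleAt_self]

open Classical in
/-- The contribution to the modified type of a cycle of length `k` with cycle-product in `c`. -/
noncomputable def mcyc (k : ℕ) (c : ConjClasses Γ) : PType Γ :=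
  if c = 1 then cyc (k - 1) 1 else cyc k c

theorem mcyc_id (k : ℕ) : mcyc k (1 : ConjClasses Γ) = cyc (k - 1) 1 := if_pos rfl

theorem mcyc_of_ne {c : ConjClasses Γ} (h : c ≠ 1) (k : ℕ) : mcyc k c = cyc k c := if_neg h

theorem decr_singleton (k : ℕ+) : decr {k} = (cyc ((k : ℕ) - 1) 1 : PType Γ) 1 := by
  rw [decr]
  by_cases h : 0 < (k : ℕ) - 1
  · rw [cyc_self h]
    rw [← Multiset.cons_zero, Multiset.filterMap_cons_some _ _ _
      (b := Nat.toPNat ((k : ℕ) - 1) h) (dif_pos h)]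
    rfl
  · have : (k : ℕ) - 1 = 0 := by omega
    rw [this, cyc_zero, ← Multiset.cons_zero, Multiset.filterMap_cons_none _ _ (dif_neg h)]
    rfl

end Mcyc

/-! ### The modified type as a sum over cycles and over positions -/

section TypeSums

variable {Γ : Type*} [Group Γ] {n : ℕ}

/-- The cycles of `x`. -/
abbrev Cyc (x : Wreath Γ n) : Type := Quotient (Equiv.Perm.SameCycle.setoid x.right)

/-- The contribution to the modified type of the cycle of `x` through `i`. -/
noncomputable def mcycAt (x : Wreath Γ n) (i : Fin n) : PType Γ := mcyc (len x i) (cls x i)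

open Classical in
theorem wtype_eq_sum (x : Wreath Γ n) (c : ConjClasses Γ) :
    wtype x c = ∑ q : Cyc x with cls x q.out = c, {cycleLen x.right q.out} := by
  rw [wtype, Finset.sum]
  refine (Multiset.sum_map_singleton _).symm.trans ?_
  rw [Multiset.map_map]
  rfl

-- Since `decr` is additive, the decrease at the identity class can be made one cycle at a time.
open Classical in
theorem mtype_eq_sum (x : Wreath Γ n) : mtype x = ∑ q : Cyc x, mcycAt x q.out := by
  funext c
  rw [Finset.sum_apply, mtype]
  by_cases hc : c = 1
  · subst hc
    rw [if_pos rfl, wtype_eq_sum]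
    change decrHom _ = _
    rw [map_sum, Finset.sum_filter]
    refine Finset.sum_congr rfl fun q _ => ?_
    by_cases h : cls x q.out = 1
    · rw [if_pos h, mcycAt, h, mcyc_id]
      exact decr_singleton _
    · rw [if_neg h, mcycAt, mcyc_of_ne h, cyc_of_ne (Ne.symm h)]
  · rw [if_neg hc, wtype_eq_sum, Finset.sum_filter]
    refine Finset.sum_congr rfl fun q _ => ?_
    by_cases h : cls x q.out = c
    · rw [if_pos h, mcycAt, h, mcyc_of_ne hc, cyc_self (len_pos _ _)]
      rfl
    · rw [if_neg h, mcycAt, mcyc]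
      split_ifs
      · rw [cyc_of_ne hc]
      · rw [cyc_of_ne (Ne.symm h)]

theorem sameCycle_out (x : Wreath Γ n) (i : Fin n) :
    x.right.SameCycle (⟦i⟧ : Cyc x).out i :=
  Quotient.exact (Quotient.out_eq (⟦i⟧ : Cyc x))

-- Each cycle is spread evenly over its positions. Sums over the cycles of different elements
-- thereby become sums over the same set `Fin n` and can be compared position by position.
open Classical in
theorem sum_cycles (x : Wreath Γ n) (A : Finset (Cyc x)) (f : ℕ → ConjClasses Γ → ℚ) :
    ∑ q ∈ A, f (len x q.out) (cls x q.out) =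
      ∑ i with (⟦i⟧ : Cyc x) ∈ A, f (len x i) (cls x i) / len x i := by
  rw [← Finset.sum_fiberwise_of_maps_to (s := Finset.univ.filter fun i => (⟦i⟧ : Cyc x) ∈ A)
    (t := A) (g := fun i => (⟦i⟧ : Cyc x)) (by simp)]
  refine Finset.sum_congr rfl fun q hq => ?_
  have hfil : ((Finset.univ.filter fun i => (⟦i⟧ : Cyc x) ∈ A).filter fun i => ⟦i⟧ = q) =
      Finset.univ.filter fun j => x.right.SameCycle q.out j := by
    ext j
    simp only [Finset.mem_filter, Finset.mem_univ, true_and]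
    constructor
    · rintro ⟨-, rfl⟩
      exact sameCycle_out x j
    · intro h
      have : (⟦j⟧ : Cyc x) = q := by
        rw [← Quotient.out_eq q]
        exact (Quotient.sound h).symm
      exact ⟨this ▸ hq, this⟩
  rw [hfil, Finset.sum_congr rfl (g := fun _ => f (len x q.out) (cls x q.out) / len x q.out),
    Finset.sum_const, card_sameCycle, nsmul_eq_mul, mul_div_cancel₀]
  · exact Nat.cast_ne_zero.2 (len_pos x _).ne'
  · intro j hj
    have hj := (Finset.mem_filter.1 hj).2
    rw [len_eq_of_sameCycle hj, cls_eq_of_sameCycle hj]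

theorem map_mtype (x : Wreath Γ n) (φ : PType Γ →+ ℚ) :
    φ (mtype x) = ∑ i, φ (mcycAt x i) / len x i := by
  classical
  rw [mtype_eq_sum, map_sum]
  have := sum_cycles x Finset.univ (fun k c => φ (mcyc k c))
  simpa [mcycAt] using this

/-- The multiplicity of `k` in the value at `c`. -/
def countHom (c : ConjClasses Γ) (k : ℕ+) : PType Γ →+ ℚ where
  toFun ρ := ((ρ c).count k : ℚ)
  map_zero' := by simp
  map_add' ρ τ := by simp

/-- Multiplicities separate partition-valued functions. Testing equalities by rational functionals
permits subtraction and division by cycle lengths. -/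
theorem ptype_ext {ρ τ : PType Γ} (h : ∀ φ : PType Γ →+ ℚ, φ ρ = φ τ) : ρ = τ := by
  funext c
  refine Multiset.ext.2 fun k => ?_
  exact Nat.cast_injective (R := ℚ) (h (countHom c k))

theorem size_add (μ ν : Multiset ℕ+) : size (μ + ν) = size μ + size ν := by
  simp [size]

variable [Finite Γ]

theorem deg_add (ρ τ : PType Γ) : deg (ρ + τ) = deg ρ + deg τ := by
  simp [deg, size_add, Finset.sum_add_distrib]

theorem deg_zero : deg (0 : PType Γ) = 0 := by
  simp [deg, size]

theorem deg_singleAt (c : ConjClasses Γ) (μ : Multiset ℕ+) : deg (singleAt c μ) = size μ := by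
  classical
  rw [deg, Finset.sum_eq_single c]
  · rw [singleAt_self]
  · intro d _ hd
    rw [singleAt_of_ne hd]
    rfl
  · simp

theorem deg_cyc (k : ℕ) (c : ConjClasses Γ) : deg (cyc k c) = k := by
  rcases k.eq_zero_or_pos with rfl | h
  · exact deg_zero
  · rw [cyc_pos h, deg_singleAt, size, Multiset.map_singleton, Multiset.sum_singleton]
    rfl

/-- The degree as an additive homomorphism. -/
noncomputable def degHom : PType Γ →+ ℚ where
  toFun ρ := (deg ρ : ℚ)
  map_zero' := by simp [deg_zero]
  map_add' ρ τ := by simp [deg_add]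

open Classical in
theorem deg_mcycAt (x : Wreath Γ n) (i : Fin n) :
    (deg (mcycAt x i) : ℚ) = len x i - if cls x i = 1 then 1 else 0 := by
  rw [mcycAt, mcyc]
  split_ifs
  · rw [deg_cyc, Nat.cast_sub (len_pos x i)]
    simp
  · rw [deg_cyc]
    simp

-- The sum on the right is the number of cycles with trivial product. This is what turns the
-- condition of top degree into a count of cycles.
open Classical in
theorem deg_mtype (x : Wreath Γ n) :
    (deg (mtype x) : ℚ) = n - ∑ i, (if cls x i = 1 then 1 else 0) / (len x i : ℚ) := by
  have := map_mtype x degHom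
  change (deg (mtype x) : ℚ) = ∑ i, (deg (mcycAt x i) : ℚ) / len x i at this
  rw [this]
  have h : ∀ i, (deg (mcycAt x i) : ℚ) / len x i =
      1 - (if cls x i = 1 then 1 else 0) / (len x i : ℚ) := fun i => by
    have : (len x i : ℚ) ≠ 0 := Nat.cast_ne_zero.2 (len_pos x i).ne'
    rw [deg_mcycAt, sub_div, div_self this]
  simp [h]

end TypeSums

/-! ### Cycles with trivial cycle-product, the elements of modified type `(r)` -/

section IsCyc

variable {Γ : Type*} [Group Γ] {n : ℕ}

/-- `y` is the cycle of length `r + 1` with cycle-product `1` through `P, y P, …, y ^ r P`. -/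
structure IsCyc (y : Wreath Γ n) (r : ℕ) (P : Pt Γ n) : Prop where
  ret : y ^ (r + 1) • P = P
  inj : ∀ i ≤ r, ∀ j ≤ r, (y ^ i • P).pos = (y ^ j • P).pos → i = j
  fix : ∀ Q : Pt Γ n, (∀ i ≤ r, Q.pos ≠ (y ^ i • P).pos) → y • Q = Q

theorem mk_eq_one {g : Γ} : ConjClasses.mk g = 1 ↔ g = 1 := by
  rw [ConjClasses.one_eq_mk_one, ConjClasses.mk_eq_mk_iff_isConj, isConj_one_left]

theorem mon_eq_one {x : Wreath Γ n} {P : Pt Γ n} : mon x P = 1 ↔ cls x P.pos = 1 := by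
  rw [← mk_mon, mk_eq_one]

/-- The positions that `y` does not fix. -/
noncomputable def mov (y : Wreath Γ n) : Finset (Fin n) :=
  (Set.toFinite {i | y • (⟨1, i⟩ : Pt Γ n) ≠ ⟨1, i⟩}).toFinset

theorem smul_eq_of_notMem_mov {y : Wreath Γ n} {P : Pt Γ n} (h : P.pos ∉ mov y) : y • P = P := by
  obtain ⟨g, hg⟩ := Pt.exists_tr (P := P) (Q := ⟨1, P.pos⟩) rfl
  have : y • (⟨1, P.pos⟩ : Pt Γ n) = ⟨1, P.pos⟩ := by
    by_contra hne
    exact h (by simpa [mov] using hne)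
  rw [hg, smul_tr, this]

theorem smul_ne_of_mem_mov {y : Wreath Γ n} {P : Pt Γ n} (h : P.pos ∈ mov y) : y • P ≠ P := by
  obtain ⟨g, hg⟩ := Pt.exists_tr (P := ⟨1, P.pos⟩) (Q := P) rfl
  intro hP
  rw [mov, Set.Finite.mem_toFinset] at h
  exact h (by rw [hg, smul_tr, hP])

namespace IsCyc

variable {y : Wreath Γ n} {r : ℕ} {P : Pt Γ n}

theorem mem_mov (h : IsCyc y r P) (hr : 1 ≤ r) {i : Fin n} :
    i ∈ mov y ↔ ∃ j ≤ r, (y ^ j • P).pos = i := by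
  constructor
  · intro hi
    by_contra! hne
    exact smul_ne_of_mem_mov (P := (⟨1, i⟩ : Pt Γ n)) hi (h.fix _ fun j hj => (hne j hj).symm)
  · rintro ⟨j, hj, rfl⟩
    by_contra hn
    have h1 := smul_eq_of_notMem_mov hn
    rw [smul_smul, ← pow_succ'] at h1
    rcases hj.lt_or_eq with hlt | rfl
    · have := h.inj (j + 1) hlt j hj (by rw [h1])
      omega
    · rw [h.ret] at h1
      have := h.inj 0 (by omega) j le_rfl (by rw [pow_zero, one_smul, ← h1])
      omega

theorem tr (h : IsCyc y r P) (g : Γ) : IsCyc y r (P.tr g) where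
  ret := by rw [smul_tr, h.ret]
  inj i hi j hj hij := h.inj i hi j hj (by simpa [smul_tr] using hij)
  fix Q hQ := h.fix Q fun i hi => by simpa [smul_tr] using hQ i hi

theorem smul (h : IsCyc y r P) : IsCyc y r (y • P) where
  ret := by rw [smul_smul, ← pow_succ, pow_succ', mul_smul, h.ret]
  inj i hi j hj hij := by
    rw [smul_smul, smul_smul, ← pow_succ, ← pow_succ] at hij
    rcases hi.lt_or_eq with hi | rfl <;> rcases hj.lt_or_eq with hj | rfl
    · exact Nat.succ_injective (h.inj _ hi _ hj hij)
    · rw [h.ret] at hij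
      have := h.inj (i + 1) hi 0 (Nat.zero_le _) (by rw [hij, pow_zero, one_smul])
      omega
    · rw [h.ret] at hij
      have := h.inj (j + 1) hj 0 (Nat.zero_le _) (by rw [← hij, pow_zero, one_smul])
      omega
    · rfl
  fix Q hQ := by
    refine h.fix Q fun i hi => ?_
    rcases i with _ | i
    · have := hQ r le_rfl
      rwa [smul_smul, ← pow_succ, h.ret] at this
    · have := hQ i (by omega)
      rwa [smul_smul, ← pow_succ] at this

theorem pow_smul (h : IsCyc y r P) (j : ℕ) : IsCyc y r (y ^ j • P) := by
  induction j with
  | zero => simpa using h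
  | succ j ih =>
    rw [pow_succ', mul_smul]
    exact ih.smul

/-- The starting point of `y` is free: any moved position with any `Γ`-coordinate will do. This
ambiguity is measured in `label_count`. -/
theorem of_mem (h : IsCyc y r P) (hr : 1 ≤ r) {Q : Pt Γ n} (hQ : Q.pos ∈ mov y) :
    IsCyc y r Q := by
  obtain ⟨j, -, hj⟩ := (h.mem_mov hr).1 hQ
  obtain ⟨g, hg⟩ := Pt.exists_tr hj.symm
  rw [hg]
  exact (h.pow_smul j).tr g

theorem pos_mem (h : IsCyc y r P) (hr : 1 ≤ r) : P.pos ∈ mov y :=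
  (h.mem_mov hr).2 ⟨0, Nat.zero_le _, by simp⟩

theorem pow_mem (h : IsCyc y r P) (hr : 1 ≤ r) (j : ℕ) : (y ^ j • P).pos ∈ mov y :=
  (h.pow_smul j).pos_mem hr

theorem mov_eq (h : IsCyc y r P) (hr : 1 ≤ r) :
    mov y = (Finset.range (r + 1)).image fun j => (y ^ j • P).pos := by
  ext i
  simp [h.mem_mov hr]

theorem injOn (h : IsCyc y r P) :
    Set.InjOn (fun j => (y ^ j • P).pos) (Finset.range (r + 1)) := fun i hi j hj hij =>
  h.inj i (by simpa [Nat.lt_succ_iff] using hi) j (by simpa [Nat.lt_succ_iff] using hj) hij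

theorem card_mov (h : IsCyc y r P) (hr : 1 ≤ r) : (mov y).card = r + 1 := by
  rw [h.mov_eq hr, Finset.card_image_of_injOn h.injOn, Finset.card_range]

theorem len (h : IsCyc y r P) : len y P.pos = r + 1 := by
  refine len_eq_of_return (Nat.succ_pos r) (by rw [h.ret]) fun m h0 hm he => ?_
  have := h.inj m (by omega) 0 (Nat.zero_le _) (by simpa using he)
  omega

theorem mon (h : IsCyc y r P) : mon y P = 1 :=
  mon_eq_of_return (by rw [h.len, h.ret, Pt.tr_one])

theorem cls (h : IsCyc y r P) : cls y P.pos = 1 := mon_eq_one.1 h.mon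

theorem mtype (h : IsCyc y r P) (hr : 1 ≤ r) : mtype y = cyc r 1 := by
  refine ptype_ext fun φ => ?_
  rw [map_mtype, ← Finset.sum_subset (Finset.subset_univ (mov y))]
  · rw [Finset.sum_congr rfl (g := fun _ => φ (cyc r 1) / ((r + 1 : ℕ) : ℚ)), Finset.sum_const,
      h.card_mov hr, nsmul_eq_mul, mul_div_cancel₀]
    · positivity
    · intro i hi
      have hi' := h.of_mem hr (Q := ⟨1, i⟩) hi
      rw [mcycAt, hi'.len, hi'.cls, mcyc_id, Nat.add_sub_cancel]
  · intro i _ hi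
    have h1 : y • (⟨1, i⟩ : Pt Γ n) = ⟨1, i⟩ := smul_eq_of_notMem_mov hi
    have h2 : FarahatHigman.len y i = 1 :=
      len_eq_of_return (x := y) (P := (⟨1, i⟩ : Pt Γ n)) Nat.one_pos (by rw [pow_one, h1])
        (by intros; omega)
    have h3 : FarahatHigman.mon y (⟨1, i⟩ : Pt Γ n) = 1 := mon_eq_of_return (by
      change y ^ FarahatHigman.len y i • _ = _
      rw [h2, pow_one, h1, Pt.tr_one])
    have h4 : FarahatHigman.cls y i = 1 := mon_eq_one.1 h3
    rw [mcycAt, h2, h4, mcyc_id, cyc_zero, map_zero, zero_div]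

/-- Right translation extends agreement on the `r + 1` listed points to all points over the same
positions; elsewhere both elements are the identity. -/
theorem eq_of_pow_smul_eq (h : IsCyc y r P) {y' : Wreath Γ n} (h' : IsCyc y' r P)
    (he : ∀ i ≤ r, y ^ i • P = y' ^ i • P) : y = y' := by
  refine wreath_ext fun Q => ?_
  by_cases hQ : ∀ i ≤ r, Q.pos ≠ (y ^ i • P).pos
  · rw [h.fix Q hQ, h'.fix Q fun i hi => he i hi ▸ hQ i hi]
  · push Not at hQ
    obtain ⟨i, hi, hp⟩ := hQ
    obtain ⟨g, rfl⟩ := Pt.exists_tr hp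
    rw [smul_tr, smul_tr]
    congr 1
    conv_rhs => rw [he i hi]
    rw [smul_smul, smul_smul, ← pow_succ', ← pow_succ']
    rcases hi.lt_or_eq with hlt | rfl
    · exact he _ hlt
    · rw [h.ret, h'.ret]

end IsCyc

theorem exists_isCyc (r : ℕ) (P : ℕ → Pt Γ n)
    (hP : ∀ i ≤ r, ∀ j ≤ r, (P i).pos = (P j).pos → i = j) :
    ∃ y : Wreath Γ n, IsCyc y r (P 0) ∧ ∀ i ≤ r, y ^ i • P 0 = P i := by
  classical
  let f : Fin (r + 1) ↪ Fin n := ⟨fun j => (P j).pos, fun i j h =>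
    Fin.ext (hP i (Nat.lt_succ_iff.1 i.2) j (Nat.lt_succ_iff.1 j.2) h)⟩
  let σ := (finRotate (r + 1)).viaFintypeEmbedding f
  let a : Fin n → Γ := fun i => if h : ∃ j : Fin (r + 1), f j = i then (P h.choose).val else 1
  have ha : ∀ j : Fin (r + 1), a (f j) = (P j).val := fun j => by
    have h : ∃ k : Fin (r + 1), f k = f j := ⟨j, rfl⟩
    simp only [a, dif_pos h]
    rw [f.injective h.choose_spec]
  -- The left component is a quotient of consecutive values of `a`, so the factors telescope along
  -- the cycle: each listed point goes exactly to the next one, and the cycle-product is `1`.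
  let y : Wreath Γ n := ⟨fun i => a i * (a (σ⁻¹ i))⁻¹, σ⟩
  have hy : ∀ j : Fin (r + 1), y • P j = P ((finRotate (r + 1) j : Fin (r + 1)) : ℕ) := fun j => by
    have hσ : σ (P j).pos = f (finRotate (r + 1) j) :=
      Equiv.Perm.viaFintypeEmbedding_apply_image _ f j
    have h2 : (y • P j).val = a (σ (P j).pos) * (a (σ⁻¹ (σ (P j).pos)))⁻¹ * (P j).val := rfl
    refine Pt.ext ?_ hσ
    rw [h2, show σ⁻¹ (σ (P j).pos) = (P j).pos from σ.symm_apply_apply _, hσ, ha]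
    have := ha j
    change a (P j).pos = _ at this
    rw [this]
    group
  have hpow : ∀ i ≤ r, y ^ i • P 0 = P i := by
    intro i hi
    induction i with
    | zero => simp
    | succ i ih =>
      rw [pow_succ', mul_smul, ih (by omega)]
      have := hy ⟨i, by omega⟩
      rwa [finRotate_of_lt (by omega)] at this
  refine ⟨y, ⟨?_, ?_, ?_⟩, hpow⟩
  · rw [pow_succ', mul_smul, hpow r le_rfl]
    have := hy (Fin.last r)
    rwa [finRotate_last] at this
  · intro i hi j hj hij
    rw [hpow i hi, hpow j hj] at hij
    exact hP i hi j hj hij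
  · intro Q hQ
    have hσ : σ Q.pos = Q.pos := by
      apply Equiv.Perm.viaFintypeEmbedding_apply_notMem_range
      rintro ⟨j, hj⟩
      refine hQ j (Nat.lt_succ_iff.1 j.2) ?_
      rw [hpow j (Nat.lt_succ_iff.1 j.2)]
      exact hj.symm
    have h2 : (y • Q).val = a (σ Q.pos) * (a (σ⁻¹ (σ Q.pos)))⁻¹ * Q.val := rfl
    refine Pt.ext ?_ hσ
    rw [h2, show σ⁻¹ (σ Q.pos) = Q.pos from σ.symm_apply_apply _, hσ]
    group

theorem mcyc_apply_one_count {k r : ℕ} {c : ConjClasses Γ} (hr : 0 < r)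
    (h : (mcyc k c 1).count (r.toPNat hr) ≠ 0) : c = 1 ∧ k = r + 1 := by
  by_cases hc : c = 1
  · subst hc
    refine ⟨rfl, ?_⟩
    rw [mcyc_id] at h
    rcases Nat.eq_zero_or_pos (k - 1) with h0 | h0
    · rw [h0, cyc_zero] at h
      exact absurd (Multiset.count_zero _) h
    · rw [cyc_self h0, Multiset.count_singleton] at h
      have h1 := congrArg PNat.val (ite_ne_right_iff.1 h).1
      change r = k - 1 at h1
      omega
  · rw [mcyc_of_ne hc, cyc_of_ne (Ne.symm hc)] at h
    exact absurd (Multiset.count_zero _) h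

/-- The part `r` at the identity class can only come from a cycle of length `r + 1` with trivial
product. This cycle uses up the whole degree, so every other cycle has degree `0` and is a fixed
position with trivial product. -/
theorem exists_isCyc_of_mtype [Finite Γ] {y : Wreath Γ n} {r : ℕ} (hr : 1 ≤ r)
    (h : mtype y = cyc r 1) : ∃ P, IsCyc y r P := by
  classical
  have h1 : ∑ q : Cyc y, (mcycAt y q.out 1).count (r.toPNat hr) = 1 := by
    have := congrArg (fun ρ : PType Γ => (ρ 1).count (r.toPNat hr)) h
    simp only [mtype_eq_sum, cyc_self hr, Multiset.count_singleton_self] at this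
    rw [Finset.sum_apply, Multiset.count_sum'] at this
    exact this
  obtain ⟨q, -, hq⟩ := Finset.exists_ne_zero_of_sum_ne_zero (by rw [h1]; exact one_ne_zero)
  obtain ⟨hc, hl⟩ := mcyc_apply_one_count hr hq
  have hdeg : ∑ q : Cyc y, (deg (mcycAt y q.out) : ℚ) = r := by
    have := congrArg degHom h
    rw [mtype_eq_sum, map_sum] at this
    exact this.trans (congrArg Nat.cast (deg_cyc r 1))
  rw [← Finset.add_sum_erase _ _ (Finset.mem_univ q), mcycAt, hc, hl, mcyc_id, deg_cyc,
    Nat.add_sub_cancel, add_eq_left,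
    Finset.sum_eq_zero_iff_of_nonneg (fun _ _ => Nat.cast_nonneg _)] at hdeg
  let P : Pt Γ n := ⟨1, q.out⟩
  have hlP : len y P.pos = r + 1 := hl
  refine ⟨P, ?_, ?_, ?_⟩
  · rw [← hlP, pow_len_smul, mon_eq_one.2 hc, Pt.tr_one]
  · intro i hi j hj hij
    exact pow_smul_pos_inj (by omega) (by omega) hij
  · intro Q hQ
    have hne : (⟦Q.pos⟧ : Cyc y) ≠ q := by
      intro hq
      have hs := sameCycle_out y Q.pos
      rw [hq] at hs
      obtain ⟨m, hm, he⟩ := SameCycle.exists_pow_smul (P := P) (Q := Q) (x := y) hs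
      exact hQ m (by omega) he.symm
    have h0 := hdeg _ (Finset.mem_erase.2 ⟨hne, Finset.mem_univ _⟩)
    rw [deg_mcycAt, len_eq_of_sameCycle (sameCycle_out y Q.pos).symm,
      cls_eq_of_sameCycle (sameCycle_out y Q.pos).symm] at h0
    have hp := len_pos y Q.pos
    split_ifs at h0 with hc'
    · have hl1 : len y Q.pos = 1 := by
        have : (len y Q.pos : ℚ) = 1 := by linarith
        exact_mod_cast this
      have := pow_len_smul y Q
      rwa [hl1, pow_one, mon_eq_one.2 hc', Pt.tr_one] at this
    · rw [sub_zero, Nat.cast_eq_zero] at h0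
      omega

end IsCyc

/-! ### Partial sums of arc lengths -/

/-- Partial sums. -/
def psum (u : ℕ → ℕ) (j : ℕ) : ℕ := ∑ i ∈ Finset.range j, u i

theorem psum_zero (u : ℕ → ℕ) : psum u 0 = 0 := rfl

theorem psum_succ (u : ℕ → ℕ) (j : ℕ) : psum u (j + 1) = psum u j + u j :=
  Finset.sum_range_succ _ _

theorem psum_mono (u : ℕ → ℕ) : Monotone (psum u) :=
  monotone_nat_of_le_succ fun j => by rw [psum_succ]; omega

theorem sum_range_psum {M : Type*} [AddCommMonoid M] (u : ℕ → ℕ) (f : ℕ → M) (k : ℕ) :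
    ∑ t ∈ Finset.range (psum u k), f t =
      ∑ j ∈ Finset.range k, ∑ m ∈ Finset.range (u j), f (psum u j + m) := by
  induction k with
  | zero => simp [psum_zero]
  | succ k ih => rw [psum_succ, Finset.sum_range_add, ih, Finset.sum_range_succ]

theorem exists_psum_add {u : ℕ → ℕ} {k t : ℕ} (h : t < psum u k) :
    ∃ j < k, ∃ m < u j, t = psum u j + m := by
  induction k with
  | zero => simp [psum_zero] at h
  | succ k ih =>
    by_cases hlt : t < psum u k
    · obtain ⟨j, hj, m, hm, rfl⟩ := ih hlt
      exact ⟨j, by omega, m, hm, rfl⟩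
    · rw [psum_succ] at h
      exact ⟨k, by omega, t - psum u k, by omega, by omega⟩

theorem psum_lt_psum {u : ℕ → ℕ} {k i j : ℕ} (hu : ∀ j < k, 0 < u j) (hij : i < j) (hj : j ≤ k) :
    psum u i < psum u j := by
  have h1 := psum_mono u (Nat.succ_le_of_lt hij)
  rw [Nat.succ_eq_add_one, psum_succ] at h1
  have := hu i (by omega)
  omega

/-! ### Arcs: comparing the cycles of `x` with those of `z = x y` -/

section Arcs

variable {Γ : Type*} [Group Γ] {n : ℕ} {x y z : Wreath Γ n}

/-- After the first step `x y = z`, the two orbits agree as long as no position moved by `y` is met,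
because there `x` and `z` act alike. -/
theorem pow_smul_eq_of_arc (hz : x * y = z) {P : Pt Γ n} {u : ℕ}
    (hu : ∀ m, 0 < m → m < u → (z ^ m • P).pos ∉ mov y) {m : ℕ} (h0 : 0 < m) (h1 : m ≤ u) :
    x ^ m • y • P = z ^ m • P := by
  induction m with
  | zero => omega
  | succ m ih =>
    rcases m.eq_zero_or_pos with rfl | hm
    · rw [zero_add, pow_one, pow_one, smul_smul, hz]
    · rw [pow_succ', mul_smul, ih hm (by omega), pow_succ', mul_smul, ← hz, mul_smul, hz,
        smul_eq_of_notMem_mov (hu m hm (by omega))]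

/-- The same argument when the arcs are read off from `x` instead of `z`. -/
theorem pow_smul_eq_of_arc' (hz : x * y = z) {P : Pt Γ n} {u : ℕ}
    (hu : ∀ m, 0 < m → m < u → (x ^ m • y • P).pos ∉ mov y) {m : ℕ} (h0 : 0 < m) (h1 : m ≤ u) :
    x ^ m • y • P = z ^ m • P := by
  induction m with
  | zero => omega
  | succ m ih =>
    rcases m.eq_zero_or_pos with rfl | hm
    · rw [zero_add, pow_one, pow_one, smul_smul, hz]
    · have := smul_eq_of_notMem_mov (hu m hm (by omega))
      rw [ih hm (by omega)] at this
      rw [pow_succ', mul_smul, ih hm (by omega), pow_succ', mul_smul, ← hz, mul_smul, hz, this]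

/-- If the arc of `z` leaving `P` ends over `y • P`, then `x`, started at `y • P`, runs along this
arc and closes up at its end: the arc becomes a whole cycle of `x`. -/
theorem len_cls_of_arc (hz : x * y = z) {P : Pt Γ n} {u : ℕ} {g : Γ} (h0 : 0 < u)
    (hP : (y • P).pos ∈ mov y)
    (hu : ∀ m, 0 < m → m < u → (z ^ m • P).pos ∉ mov y) (hg : z ^ u • P = (y • P).tr g) :
    len x (y • P).pos = u ∧ mon x (y • P) = g := by
  have hl : len x (y • P).pos = u := by
    refine len_eq_of_return h0 ?_ fun m hm hmu he => ?_
    · rw [pow_smul_eq_of_arc hz hu h0 le_rfl, hg, Pt.tr_pos]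
    · rw [pow_smul_eq_of_arc hz hu hm hmu.le] at he
      exact hu m hm hmu (he ▸ hP)
  exact ⟨hl, mon_eq_of_return (by rw [hl, pow_smul_eq_of_arc hz hu h0 le_rfl, hg])⟩

theorem mcycAt_pow_smul (x : Wreath Γ n) (P : Pt Γ n) (m : ℕ) :
    mcycAt x (x ^ m • P).pos = mcycAt x P.pos := by
  rw [mcycAt, len_pow_smul, cls_pow_smul, mcycAt]

theorem len_cls_eq_of_pow_smul {P : Pt Γ n} (h : ∀ m, x ^ m • P = z ^ m • P) :
    len x P.pos = len z P.pos ∧ cls x P.pos = cls z P.pos := by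
  have hl : len x P.pos = len z P.pos := by
    refine len_eq_of_return (len_pos z _) (by rw [h, pow_len_smul, Pt.tr_pos])
      fun m h0 hm => ?_
    rw [h]
    exact pow_smul_pos_ne h0 hm
  refine ⟨hl, ?_⟩
  rw [← mk_mon, ← mk_mon, mon_eq_of_return (h := mon z P) (by rw [h, hl, pow_len_smul])]

theorem pow_smul_eq_of_forall_notMem (hz : x * y = z) {P : Pt Γ n}
    (h : ∀ m, (z ^ m • P).pos ∉ mov y) (m : ℕ) : x ^ m • P = z ^ m • P := by
  have hy : y • P = P := smul_eq_of_notMem_mov (by simpa using h 0)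
  rcases m.eq_zero_or_pos with rfl | hm
  · simp
  · have := pow_smul_eq_of_arc hz (u := m) (fun i _ _ => h i) hm le_rfl
    rwa [hy] at this

theorem pow_smul_eq_of_forall_notMem' (hz : x * y = z) {P : Pt Γ n}
    (h : ∀ m, (x ^ m • P).pos ∉ mov y) (m : ℕ) : x ^ m • P = z ^ m • P := by
  have hy : y • P = P := smul_eq_of_notMem_mov (by simpa using h 0)
  rcases m.eq_zero_or_pos with rfl | hm
  · simp
  · have := pow_smul_eq_of_arc' hz (P := P) (u := m) (fun i _ _ => by rw [hy]; exact h i) hm le_rfl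
    rwa [hy] at this

/-- The positions of the cycle of `z` through `P`. -/
noncomputable def orb (z : Wreath Γ n) (P : Pt Γ n) : Finset (Fin n) :=
  (Finset.range (len z P.pos)).image fun m => (z ^ (m + 1) • P).pos

theorem mem_orb {P : Pt Γ n} {i : Fin n} : i ∈ orb z P ↔ z.right.SameCycle P.pos i := by
  rw [orb, Finset.mem_image]
  constructor
  · rintro ⟨m, -, rfl⟩
    exact sameCycle_pow_smul z P (m + 1)
  · intro h
    obtain ⟨m, hm, he⟩ := SameCycle.exists_pow_smul (Q := (⟨1, i⟩ : Pt Γ n)) h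
    rcases m with _ | m
    · refine ⟨len z P.pos - 1, Finset.mem_range.2 (by omega), ?_⟩
      rw [Nat.sub_add_cancel (by omega), pow_len_smul, Pt.tr_pos]
      simpa using he
    · exact ⟨m, Finset.mem_range.2 (by omega), he⟩

theorem sum_orb (P : Pt Γ n) (f : Fin n → ℚ) :
    ∑ i ∈ orb z P, f i = ∑ m ∈ Finset.range (len z P.pos), f (z ^ (m + 1) • P).pos := by
  rw [orb, Finset.sum_image]
  intro a ha b hb hab
  have ha := Finset.mem_range.1 (Finset.mem_coe.1 ha)
  have hb := Finset.mem_range.1 (Finset.mem_coe.1 hb)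
  have h2 : len z (z • P).pos = len z P.pos := by simpa using len_pow_smul z P 1
  refine pow_smul_pos_inj (x := z) (P := z • P) (by rwa [h2]) (by rwa [h2]) ?_
  simpa only [smul_smul, ← pow_succ] using hab

/-- The share in a statistic of the modified type of the position `i`. -/
noncomputable def share (φ : PType Γ →+ ℚ) (x : Wreath Γ n) (i : Fin n) : ℚ :=
  φ (mcycAt x i) / len x i

theorem share_pow_smul (φ : PType Γ →+ ℚ) (x : Wreath Γ n) (P : Pt Γ n) (m : ℕ) :
    share φ x (x ^ m • P).pos = share φ x P.pos := by
  rw [share, mcycAt_pow_smul, len_pow_smul, share]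

theorem sum_orb_share (φ : PType Γ →+ ℚ) (z : Wreath Γ n) (P : Pt Γ n) :
    ∑ i ∈ orb z P, share φ z i = φ (mcycAt z P.pos) := by
  rw [sum_orb, Finset.sum_congr rfl fun m _ => share_pow_smul φ z P (m + 1), Finset.sum_const,
    Finset.card_range, share, nsmul_eq_mul, mul_div_cancel₀]
  exact Nat.cast_ne_zero.2 (len_pos _ _).ne'

/-- If `U` is a union of cycles of `z` that contains the positions moved by `y`, then the types
of `x` and `z = x y` differ only by the contributions of `U`. -/
theorem mtype_sub_sum_share (hz : x * y = z) {U : Finset (Fin n)}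
    (hU : ∀ i ∈ U, ∀ j, z.right.SameCycle j i → j ∈ U) (hy : mov y ⊆ U) (φ : PType Γ →+ ℚ) :
    φ (mtype x) + ∑ i ∈ U, share φ z i = φ (mtype z) + ∑ i ∈ U, share φ x i := by
  have h : ∑ i ∈ Uᶜ, share φ x i = ∑ i ∈ Uᶜ, share φ z i := by
    refine Finset.sum_congr rfl fun i hi => ?_
    have hi := Finset.mem_compl.1 hi
    obtain ⟨h1, h2⟩ := len_cls_eq_of_pow_smul (P := (⟨1, i⟩ : Pt Γ n))
      (pow_smul_eq_of_forall_notMem hz fun m hm => hi (hU _ (hy hm) i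
        (sameCycle_pow_smul z (⟨1, i⟩ : Pt Γ n) m)))
    change len x i = len z i at h1
    change cls x i = cls z i at h2
    rw [share, share, mcycAt, h1, h2, mcycAt]
  have hx := map_mtype x φ
  have hz := map_mtype z φ
  change _ = ∑ i, share φ x i at hx
  change _ = ∑ i, share φ z i at hz
  rw [hx, hz, ← Finset.sum_add_sum_compl U, ← Finset.sum_add_sum_compl U (share φ z), h]
  ring

/-- The arc closes up to a cycle of `x` of length `u`, so its `u` equal shares add up to the full
contribution of that cycle. -/
theorem sum_arc_share (φ : PType Γ →+ ℚ) (hz : x * y = z) {P : Pt Γ n} {u : ℕ} {g : Γ} (h0 : 0 < u)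
    (hP : (y • P).pos ∈ mov y)
    (hu : ∀ m, 0 < m → m < u → (z ^ m • P).pos ∉ mov y) (hg : z ^ u • P = (y • P).tr g) :
    ∑ m ∈ Finset.range u, share φ x (z ^ (m + 1) • P).pos = φ (mcyc u (ConjClasses.mk g)) := by
  obtain ⟨h1, h2⟩ := len_cls_of_arc hz h0 hP hu hg
  rw [Finset.sum_congr rfl (g := fun _ => share φ x (y • P).pos), Finset.sum_const,
    Finset.card_range, share, mcycAt, h1, ← mk_mon, h2, nsmul_eq_mul, mul_div_cancel₀]
  · exact Nat.cast_ne_zero.2 h0.ne'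
  · intro m hm
    rw [← pow_smul_eq_of_arc hz hu (Nat.succ_pos m) (Finset.mem_range.1 hm), share_pow_smul]

theorem pow_psum_ne {P : Pt Γ n} {u : ℕ → ℕ} {k i j m : ℕ}
    (hlen : psum u k ≤ len z P.pos) (hi : i < k) (hu : ∀ j < k, 0 < u j)
    (hj : j < k) (h0 : 0 < m) (hm : m < u j) :
    (z ^ m • z ^ psum u j • P).pos ≠ (z ^ psum u i • P).pos := by
  intro h
  rw [smul_smul, ← pow_add] at h
  have h1 := psum_lt_psum hu (Nat.lt_succ_self i) hi
  have h2 := psum_mono u hi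
  have h3 := psum_mono u hj
  simp only [Nat.succ_eq_add_one, psum_succ] at h1 h2 h3
  have h4 := pow_smul_pos_inj (by omega) (by omega) h
  rcases lt_trichotomy i j with hij | rfl | hij
  · have := psum_mono u hij.le
    omega
  · omega
  · have := psum_mono u (Nat.succ_le_of_lt hij)
    simp only [Nat.succ_eq_add_one, psum_succ] at this
    omega

theorem pow_psum_inj {P : Pt Γ n} {u : ℕ → ℕ} {k i j : ℕ}
    (hlen : psum u k ≤ len z P.pos) (hu : ∀ j < k, 0 < u j) (hi : i < k)
    (hj : j < k) (h : (z ^ psum u i • P).pos = (z ^ psum u j • P).pos) : i = j := by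
  have h1 := psum_lt_psum hu hi le_rfl
  have h2 := psum_lt_psum hu hj le_rfl
  have h3 := pow_smul_pos_inj (by omega) (by omega) h
  rcases lt_trichotomy i j with hij | rfl | hij
  · have := psum_lt_psum hu hij hj.le
    omega
  · rfl
  · have := psum_lt_psum hu hij hi.le
    omega

/-- A point of a run of arcs that is moved by `y` is the start of an arc. -/
theorem exists_start_of_mem_mov {P : Pt Γ n} {u : ℕ → ℕ} {k t : ℕ}
    (hu : ∀ j < k, ∀ m, 0 < m → m < u j → (z ^ m • z ^ psum u j • P).pos ∉ mov y)
    (ht : t < psum u k) (h : (z ^ t • P).pos ∈ mov y) : ∃ j < k, t = psum u j := by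
  obtain ⟨j, hj, m, hm, rfl⟩ := exists_psum_add ht
  rcases m.eq_zero_or_pos with rfl | h0
  · exact ⟨j, hj, rfl⟩
  · refine absurd ?_ (hu j hj m h0 hm)
    rwa [smul_smul, ← pow_add, add_comm]

/-- A return to `P` is a visit to a position moved by `y`, hence happens at the start of an arc.
Only these finitely many times have to be excluded. -/
theorem len_eq_psum {P : Pt Γ n} {u : ℕ → ℕ} {k : ℕ} (hk : 0 < psum u k) (hP : P.pos ∈ mov y)
    (hu : ∀ j < k, ∀ m, 0 < m → m < u j → (z ^ m • z ^ psum u j • P).pos ∉ mov y)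
    (hr : (z ^ psum u k • P).pos = P.pos)
    (hs : ∀ j < k, j ≠ 0 → (z ^ psum u j • P).pos ≠ P.pos) : len z P.pos = psum u k := by
  refine len_eq_of_return hk hr fun t h0 ht he => ?_
  obtain ⟨j, hj, rfl⟩ := exists_start_of_mem_mov hu ht (he ▸ hP)
  refine hs j hj ?_ he
  rintro rfl
  simp [psum_zero] at h0

end Arcs

/-! ### Splitting one cycle of `z` into `r + 1` cycles of `x` -/

section Chain

variable {Γ : Type*} [Group Γ] {n : ℕ} {x y z : Wreath Γ n} {r : ℕ} {P : Pt Γ n}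

/-- `y` is the cycle that cuts the cycle of `z` through `P` into arcs of lengths
`u 0, …, u r`. -/
structure Chain (z y : Wreath Γ n) (r : ℕ) (P : Pt Γ n) (u : ℕ → ℕ) : Prop where
  isCyc : IsCyc y r P
  pos : ∀ j < r + 1, 0 < u j
  sum : psum u (r + 1) = len z P.pos
  pow : ∀ j ≤ r, y ^ j • P = z ^ psum u j • P

/-- The positions moved by `y` lie in different cycles of `x`, all of whose cycle-products,
except possibly the one at `P`, are `1`. -/
structure Split (x y : Wreath Γ n) (r : ℕ) (P : Pt Γ n) : Prop where
  isCyc : IsCyc y r P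
  inj : ∀ i ∈ mov y, ∀ j ∈ mov y, x.right.SameCycle i j → i = j
  cls : ∀ i ∈ mov y, i ≠ P.pos → cls x i = 1

theorem exists_chain (z : Wreath Γ n) (P : Pt Γ n) {u : ℕ → ℕ} (hu : ∀ j < r + 1, 0 < u j)
    (hs : psum u (r + 1) = len z P.pos) : ∃ y, Chain z y r P u := by
  obtain ⟨y, hy, h⟩ := exists_isCyc r (fun j => z ^ psum u j • P) fun i hi j hj hij =>
    pow_psum_inj (u := u) hs.le hu (by omega) (by omega) hij
  simp only [psum_zero, pow_zero, one_smul] at hy h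
  exact ⟨y, hy, hu, hs, h⟩

namespace Chain

variable {u : ℕ → ℕ}

theorem notMem (h : Chain z y r P u) (hr : 1 ≤ r) {j m : ℕ} (hj : j ≤ r) (h0 : 0 < m)
    (hm : m < u j) : (z ^ m • y ^ j • P).pos ∉ mov y := by
  rw [h.isCyc.mem_mov hr, h.pow j hj]
  rintro ⟨i, hi, he⟩
  rw [h.pow i hi] at he
  exact pow_psum_ne h.sum.le (by omega) h.pos (by omega) h0 hm he.symm

theorem pow_smul_lt (h : Chain z y r P u) {j : ℕ} (hj : j < r) :
    z ^ u j • y ^ j • P = (y • y ^ j • P).tr 1 := by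
  rw [h.pow j hj.le, smul_smul, ← pow_add, add_comm, ← psum_succ, ← h.pow (j + 1) hj, Pt.tr_one,
    ← h.pow j hj.le, smul_smul, ← pow_succ']

theorem pow_smul_last (h : Chain z y r P u) :
    z ^ u r • y ^ r • P = (y • y ^ r • P).tr (mon z P) := by
  rw [h.pow r le_rfl, smul_smul, ← pow_add, add_comm, ← psum_succ, h.sum, pow_len_smul,
    ← h.pow r le_rfl, smul_smul, ← pow_succ', h.isCyc.ret]

/-- The arc of index `j` leads from `y ^ j • P` to `y ^ (j + 1) • P`, exactly for `j < r`. The last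
one completes the turn around the cycle of `z` and so picks up its monodromy. -/
theorem len_mon (h : Chain z y r P u) (hz : x * y = z) (hr : 1 ≤ r) {j : ℕ} (hj : j ≤ r) :
    len x (y ^ (j + 1) • P).pos = u j ∧
      mon x (y ^ (j + 1) • P) = if j = r then mon z P else 1 := by
  rw [pow_succ', mul_smul]
  refine len_cls_of_arc hz (h.pos j (by omega)) ?_ (fun m h0 hm => h.notMem hr hj h0 hm) ?_
  · rw [smul_smul, ← pow_succ']
    exact h.isCyc.pow_mem hr _
  · split_ifs with hjr
    · subst hjr
      exact h.pow_smul_last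
    · exact h.pow_smul_lt (by omega)

theorem cls_eq (h : Chain z y r P u) (hz : x * y = z) (hr : 1 ≤ r) :
    FarahatHigman.cls x P.pos = FarahatHigman.cls z P.pos := by
  have := (h.len_mon hz hr le_rfl).2
  rw [h.isCyc.ret, if_pos rfl] at this
  rw [← mk_mon, this, mk_mon]

theorem split (h : Chain z y r P u) (hz : x * y = z) (hr : 1 ≤ r) : Split x y r P where
  isCyc := h.isCyc
  inj := by
    have key : ∀ i ∈ mov y, ∃ j ≤ r, (y ^ (j + 1) • P).pos = i := fun i hi => by
      obtain ⟨j, hj, rfl⟩ := (h.isCyc.mem_mov hr).1 hi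
      rcases j with _ | j
      · exact ⟨r, le_rfl, by rw [h.isCyc.ret, pow_zero, one_smul]⟩
      · exact ⟨j, by omega, rfl⟩
    intro i hi j hj hij
    obtain ⟨a, ha, rfl⟩ := key i hi
    obtain ⟨m, hm, he⟩ := SameCycle.exists_pow_smul (Q := (⟨1, j⟩ : Pt Γ n)) hij
    rw [(h.len_mon hz hr ha).1] at hm
    rcases m.eq_zero_or_pos with rfl | h0
    · simpa using he
    · rw [pow_succ', mul_smul, pow_smul_eq_of_arc hz
        (fun m h0 hm => h.notMem hr ha h0 hm) h0 hm.le] at he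
      exact absurd (by rw [he]; exact hj) (h.notMem hr ha h0 hm)
  cls := by
    intro i hi hne
    obtain ⟨j, hj, rfl⟩ := (h.isCyc.mem_mov hr).1 hi
    rcases j with _ | j
    · simp at hne
    · have := (h.len_mon hz hr (j := j) (by omega)).2
      rw [if_neg (by omega)] at this
      exact mon_eq_one.1 this

/-- Only the cycle of `z` through `P` is affected, and its positions are regrouped into the `r + 1`
arcs. Adding on both sides avoids truncated subtraction. -/
theorem mtype_eq (h : Chain z y r P u) (hz : x * y = z) (hr : 1 ≤ r) :
    mtype x + mcycAt z P.pos =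
      mtype z + (∑ j ∈ Finset.range r, mcyc (u j) 1 + mcyc (u r) (FarahatHigman.cls z P.pos)) := by
  refine ptype_ext fun φ => ?_
  have hsum := mtype_sub_sum_share hz (U := orb z P)
    (fun i hi j hj => mem_orb.2 ((mem_orb.1 hi).trans hj.symm)) (fun i hi => by
      obtain ⟨j, hj, rfl⟩ := (h.isCyc.mem_mov hr).1 hi
      rw [h.pow j hj]
      exact mem_orb.2 (sameCycle_pow_smul _ _ _)) φ
  rw [sum_orb_share] at hsum
  have key : ∀ j ≤ r, ∀ g, z ^ u j • y ^ j • P = (y • y ^ j • P).tr g →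
      ∑ m ∈ Finset.range (u j), share φ x (z ^ (psum u j + m + 1) • P).pos =
        φ (mcyc (u j) (ConjClasses.mk g)) := fun j hj g hg => by
    rw [← sum_arc_share φ hz (h.pos j (by omega)) (by
      rw [smul_smul, ← pow_succ']
      exact h.isCyc.pow_mem hr _) (fun m h0 hm => h.notMem hr hj h0 hm) hg]
    refine Finset.sum_congr rfl fun m _ => ?_
    rw [h.pow j hj, smul_smul, ← pow_add]
    congr 4
    omega
  rw [map_add, hsum, map_add, map_add, sum_orb, ← h.sum, sum_range_psum, Finset.sum_range_succ,
    map_sum, key r le_rfl _ h.pow_smul_last, mk_mon]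
  congr 2
  refine Finset.sum_congr rfl fun j hj => ?_
  have hj := Finset.mem_range.1 hj
  rw [key j hj.le _ (h.pow_smul_lt hj), mk_eq_one.2 rfl]

end Chain

/-- Converse of `Chain.split`. Each cycle of `x` met by `y` contains a single moved position, so it
opens to an arc of `z`. Triviality of its product makes the arc end at the next point of `y` itself,
not at a translate; the arc ending over `P` is exempt, and it closes the cycle of `z`. -/
theorem Split.chain (h : Split x y r P) (hz : x * y = z) (hr : 1 ≤ r) :
    Chain z y r P fun j => len x (y ^ (j + 1) • P).pos := by
  set u : ℕ → ℕ := fun j => len x (y ^ (j + 1) • P).pos with hu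
  have hpos : ∀ j, 0 < u j := fun j => len_pos _ _
  have arc : ∀ j, ∀ m, 0 < m → m < u j → (x ^ m • y • y ^ j • P).pos ∉ mov y := by
    intro j m h0 hm hmem
    rw [smul_smul y, ← pow_succ'] at hmem
    exact pow_smul_pos_ne h0 hm (h.inj _ (h.isCyc.pow_mem hr _) _ hmem
      (sameCycle_pow_smul _ _ _)).symm
  have step : ∀ j, z ^ u j • y ^ j • P = (y ^ (j + 1) • P).tr (mon x (y ^ (j + 1) • P)) := by
    intro j
    rw [← pow_smul_eq_of_arc' hz (arc j) (hpos j) le_rfl, smul_smul y, ← pow_succ', hu,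
      pow_len_smul]
  have hpow : ∀ j ≤ r, y ^ j • P = z ^ psum u j • P := by
    intro j hj
    induction j with
    | zero => simp [psum_zero]
    | succ j ih =>
      have hne : (y ^ (j + 1) • P).pos ≠ P.pos := fun he => by
        have := h.isCyc.inj (j + 1) hj 0 (Nat.zero_le _) (by simpa using he)
        omega
      rw [psum_succ, add_comm (psum u j), pow_add z, mul_smul, ← ih (by omega), step,
        mon_eq_one.2 (h.cls _ (h.isCyc.pow_mem hr _) hne), Pt.tr_one]
  refine ⟨h.isCyc, fun j _ => hpos j, ?_, hpow⟩
  refine (len_eq_psum (y := y) ?_ (h.isCyc.pos_mem hr) ?_ ?_ ?_).symm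
  · rw [psum_succ]
    have := hpos r
    omega
  · intro j hj m h0 hm
    rw [← hpow j (by omega), ← pow_smul_eq_of_arc' hz (arc j) h0 hm.le]
    exact arc j m h0 hm
  · rw [psum_succ, add_comm, pow_add, mul_smul, ← hpow r le_rfl, step, h.isCyc.ret, Pt.tr_pos]
  · intro j hj hj0 he
    rw [← hpow j (by omega)] at he
    exact hj0 (h.isCyc.inj j (by omega) 0 (Nat.zero_le _) (by simpa using he))

end Chain

/-! ### Merging two cycles of `z` with inverse monodromies -/

section MChain

variable {Γ : Type*} [Group Γ] {n : ℕ} {x y z : Wreath Γ n} {r a d : ℕ} {P Q : Pt Γ n}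
  {u v : ℕ → ℕ}

theorem pow_smul_swap (hz : x * y = z) {A B : Pt Γ n} {k : ℕ} {g : Γ} (hk : 0 < k)
    (hA : ∀ m, 0 < m → m < k → (z ^ m • A).pos ∉ mov y) (hg : z ^ k • A = (y • B).tr g) :
    x ^ k • y • A = (y • B).tr g := by
  rw [pow_smul_eq_of_arc hz hA hk le_rfl, hg]

/-- The arc from `A` ends over `y • B` and the arc from `B` ends over `y • A`, so in `x` they are
traversed one after the other as a single cycle, around which `g` and `h` cancel. -/
theorem len_mon_swap (hz : x * y = z) {A B : Pt Γ n} {k l : ℕ} {g h : Γ} (hk : 0 < k) (hl : 0 < l)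
    (hAm : (y • A).pos ∈ mov y) (hne : (y • A).pos ≠ (y • B).pos)
    (hA : ∀ m, 0 < m → m < k → (z ^ m • A).pos ∉ mov y)
    (hB : ∀ m, 0 < m → m < l → (z ^ m • B).pos ∉ mov y)
    (hg : z ^ k • A = (y • B).tr g) (hh : z ^ l • B = (y • A).tr h) (hgh : g * h = 1) :
    len x (y • A).pos = k + l ∧ mon x (y • A) = 1 := by
  have h1 := pow_smul_swap hz hk hA hg
  have h2 := pow_smul_swap hz hl hB hh
  have h3 : x ^ (k + l) • y • A = y • A := by
    rw [add_comm, pow_add, mul_smul, h1, smul_tr, h2, Pt.tr_tr, mul_eq_one_comm.1 hgh, Pt.tr_one]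
  have hlen : len x (y • A).pos = k + l := by
    refine len_eq_of_return (by omega) (by rw [h3]) fun m h0 hm he => ?_
    rcases lt_trichotomy m k with hmk | rfl | hmk
    · rw [pow_smul_eq_of_arc hz hA h0 hmk.le] at he
      exact hA m h0 hmk (he ▸ hAm)
    · rw [h1] at he
      exact hne he.symm
    · obtain ⟨m, rfl⟩ := Nat.exists_eq_add_of_lt hmk
      have h0 : 0 < m + 1 := by omega
      have hml : m + 1 < l := by omega
      rw [add_assoc, add_comm k, pow_add, mul_smul, h1, smul_tr, Pt.tr_pos,
        pow_smul_eq_of_arc hz hB h0 hml.le] at he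
      exact hB _ h0 hml (he ▸ hAm)
  exact ⟨hlen, mon_eq_of_return (by rw [hlen, h3, Pt.tr_one])⟩

theorem eq_of_sameCycle_arc (hz : x * y = z) {A : Pt Γ n} {k : ℕ} {g : Γ} (hk : 0 < k)
    (hAm : (y • A).pos ∈ mov y) (hA : ∀ m, 0 < m → m < k → (z ^ m • A).pos ∉ mov y)
    (hg : z ^ k • A = (y • A).tr g) {j : Fin n} (hj : j ∈ mov y)
    (h : x.right.SameCycle (y • A).pos j) : j = (y • A).pos := by
  obtain ⟨m, hm, he⟩ := SameCycle.exists_pow_smul (Q := (⟨1, j⟩ : Pt Γ n)) h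
  rw [(len_cls_of_arc hz hk hAm hA hg).1] at hm
  rcases m.eq_zero_or_pos with rfl | h0
  · simpa using he.symm
  · rw [pow_smul_eq_of_arc hz hA h0 hm.le] at he
    exact absurd (by rw [he]; exact hj) (hA m h0 hm)

theorem sum_swap_share (φ : PType Γ →+ ℚ) (hz : x * y = z) {A B : Pt Γ n} {k l : ℕ} {g h : Γ}
    (hk : 0 < k) (hl : 0 < l) (hAm : (y • A).pos ∈ mov y) (hne : (y • A).pos ≠ (y • B).pos)
    (hA : ∀ m, 0 < m → m < k → (z ^ m • A).pos ∉ mov y)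
    (hB : ∀ m, 0 < m → m < l → (z ^ m • B).pos ∉ mov y)
    (hg : z ^ k • A = (y • B).tr g) (hh : z ^ l • B = (y • A).tr h) (hgh : g * h = 1) :
    ∑ m ∈ Finset.range k, share φ x (z ^ (m + 1) • A).pos +
      ∑ m ∈ Finset.range l, share φ x (z ^ (m + 1) • B).pos = φ (mcyc (k + l) 1) := by
  obtain ⟨h1, h2⟩ := len_mon_swap hz hk hl hAm hne hA hB hg hh hgh
  have hB' : share φ x (y • B).pos = share φ x (y • A).pos := by
    have := share_pow_smul φ x (y • A) k
    rwa [pow_smul_swap hz hk hA hg] at this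
  rw [Finset.sum_congr rfl (g := fun _ => share φ x (y • A).pos), Finset.sum_const,
    Finset.sum_congr (s₁ := Finset.range l) rfl (g := fun _ => share φ x (y • A).pos),
    Finset.sum_const, ← add_nsmul, Finset.card_range, Finset.card_range, share, mcycAt, h1,
    mon_eq_one.1 h2, nsmul_eq_mul, mul_div_cancel₀]
  · exact Nat.cast_ne_zero.2 (by omega)
  · intro m hm
    rw [← pow_smul_eq_of_arc hz hB (Nat.succ_pos m) (Finset.mem_range.1 hm), share_pow_smul, hB']
  · intro m hm
    rw [← pow_smul_eq_of_arc hz hA (Nat.succ_pos m) (Finset.mem_range.1 hm), share_pow_smul]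

/-- `y` is a cycle that visits the starts of arcs of lengths `u 0, …, u a` of the cycle of `z`
through `P`, then the starts of arcs of lengths `v 0, …, v d` of the different cycle of `z`
through `Q`; the monodromies of `z` at `P` and `Q` are inverse to each other. -/
structure MChain (z y : Wreath Γ n) (r : ℕ) (P Q : Pt Γ n) (a d : ℕ) (u v : ℕ → ℕ) : Prop where
  isCyc : IsCyc y r P
  add : a + d + 1 = r
  upos : ∀ j < a + 1, 0 < u j
  vpos : ∀ j < d + 1, 0 < v j
  usum : psum u (a + 1) = len z P.pos
  vsum : psum v (d + 1) = len z Q.pos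
  upow : ∀ j ≤ a, y ^ j • P = z ^ psum u j • P
  vpow : ∀ j ≤ d, y ^ (a + 1 + j) • P = z ^ psum v j • Q
  disj : ¬ z.right.SameCycle P.pos Q.pos
  mon : mon z P * mon z Q = 1
  mon_ne : FarahatHigman.mon z P ≠ 1

/-- `y` is a cycle through `P` and `Q`, whose positions are the only moved positions that lie in
the same cycle of `x`; the cycles of `x` that meet `y` have cycle-product `1`, but the one
of `z` through `P` does not. -/
structure Merge (x y z : Wreath Γ n) (r : ℕ) (P Q : Pt Γ n) : Prop where
  isCyc : IsCyc y r P
  exists_pow : ∃ j < r, Q = y ^ (j + 1) • P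
  same : x.right.SameCycle P.pos Q.pos
  inj : ∀ i ∈ mov y, ∀ j ∈ mov y, x.right.SameCycle i j →
    i = j ∨ (i = P.pos ∧ j = Q.pos) ∨ (i = Q.pos ∧ j = P.pos)
  cls : ∀ i ∈ mov y, cls x i = 1
  cls_ne : FarahatHigman.cls z P.pos ≠ 1

theorem exists_mchain (z : Wreath Γ n) (P Q : Pt Γ n) (hr : a + d + 1 = r)
    (hu : ∀ j < a + 1, 0 < u j) (hv : ∀ j < d + 1, 0 < v j)
    (hus : psum u (a + 1) = len z P.pos) (hvs : psum v (d + 1) = len z Q.pos)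
    (hd : ¬ z.right.SameCycle P.pos Q.pos) (hm : mon z P * mon z Q = 1) (hne : mon z P ≠ 1) :
    ∃ y, MChain z y r P Q a d u v := by
  have hdiff : ∀ i j, (z ^ i • P).pos ≠ (z ^ j • Q).pos := fun i j h =>
    hd ((sameCycle_pow_smul z P i).trans (h ▸ (sameCycle_pow_smul z Q j).symm))
  obtain ⟨y, hy, h⟩ := exists_isCyc r
    (fun j => if j < a + 1 then z ^ psum u j • P else z ^ psum v (j - (a + 1)) • Q)
    fun i hi j hj hij => by
      split_ifs at hij with h1 h2 h2
      · exact pow_psum_inj hus.le hu h1 h2 hij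
      · exact absurd hij (hdiff _ _)
      · exact absurd hij.symm (hdiff _ _)
      · have := pow_psum_inj hvs.le hv (by omega) (by omega) hij
        omega
  simp only [psum_zero, pow_zero, one_smul, Nat.succ_pos, if_true] at hy h
  refine ⟨y, hy, hr, hu, hv, hus, hvs, fun j hj => ?_, fun j hj => ?_, hd, hm, hne⟩
  · rw [h j (by omega), if_pos (by omega)]
  · rw [h _ (by omega), if_neg (by omega), Nat.add_sub_cancel_left]

namespace MChain

theorem one_le (h : MChain z y r P Q a d u v) : 1 ≤ r := by
  have := h.add
  omega

theorem eq_pow (h : MChain z y r P Q a d u v) : y ^ (a + 1) • P = Q := by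
  have := h.vpow 0 (Nat.zero_le _)
  simpa [psum_zero] using this

theorem pow_ne (h : MChain z y r P Q a d u v) (i j : ℕ) : (z ^ i • P).pos ≠ (z ^ j • Q).pos :=
  fun he => h.disj ((sameCycle_pow_smul z P i).trans (he ▸ (sameCycle_pow_smul z Q j).symm))

theorem mem_mov (h : MChain z y r P Q a d u v) {i : Fin n} :
    i ∈ mov y ↔ (∃ j ≤ a, (z ^ psum u j • P).pos = i) ∨ ∃ j ≤ d, (z ^ psum v j • Q).pos = i := by
  have hadd := h.add
  rw [h.isCyc.mem_mov h.one_le]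
  constructor
  · rintro ⟨j, hj, rfl⟩
    by_cases hja : j ≤ a
    · exact Or.inl ⟨j, hja, by rw [h.upow j hja]⟩
    · refine Or.inr ⟨j - (a + 1), by omega, ?_⟩
      rw [← h.vpow _ (by omega), Nat.add_sub_cancel' (by omega)]
  · rintro (⟨j, hj, rfl⟩ | ⟨j, hj, rfl⟩)
    · exact ⟨j, by omega, by rw [h.upow j hj]⟩
    · exact ⟨a + 1 + j, by omega, by rw [h.vpow j hj]⟩

theorem notMem_u (h : MChain z y r P Q a d u v) {j m : ℕ} (hj : j ≤ a) (h0 : 0 < m)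
    (hm : m < u j) : (z ^ m • y ^ j • P).pos ∉ mov y := by
  rw [h.mem_mov, h.upow j hj]
  rintro (⟨i, hi, he⟩ | ⟨i, hi, he⟩)
  · exact pow_psum_ne h.usum.le (by omega) h.upos (by omega) h0 hm he.symm
  · rw [smul_smul, ← pow_add] at he
    exact h.pow_ne _ _ he.symm

theorem notMem_v (h : MChain z y r P Q a d u v) {j m : ℕ} (hj : j ≤ d) (h0 : 0 < m)
    (hm : m < v j) : (z ^ m • y ^ (a + 1 + j) • P).pos ∉ mov y := by
  rw [h.mem_mov, h.vpow j hj]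
  rintro (⟨i, hi, he⟩ | ⟨i, hi, he⟩)
  · rw [smul_smul, ← pow_add] at he
    exact h.pow_ne _ _ he
  · exact pow_psum_ne h.vsum.le (by omega) h.vpos (by omega) h0 hm he.symm

theorem pow_u (h : MChain z y r P Q a d u v) {j : ℕ} (hj : j < a) :
    z ^ u j • y ^ j • P = (y • y ^ j • P).tr 1 := by
  rw [h.upow j hj.le, smul_smul, ← pow_add, add_comm, ← psum_succ, ← h.upow (j + 1) hj, Pt.tr_one,
    ← h.upow j hj.le, smul_smul, ← pow_succ']

theorem pow_v (h : MChain z y r P Q a d u v) {j : ℕ} (hj : j < d) :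
    z ^ v j • y ^ (a + 1 + j) • P = (y • y ^ (a + 1 + j) • P).tr 1 := by
  rw [h.vpow j hj.le, smul_smul, ← pow_add, add_comm, ← psum_succ, ← h.vpow (j + 1) hj, Pt.tr_one,
    ← h.vpow j hj.le, smul_smul, ← pow_succ', ← add_assoc (a + 1)]

theorem smul_last_u (h : MChain z y r P Q a d u v) : y • y ^ a • P = Q := by
  rw [smul_smul, ← pow_succ', h.eq_pow]

theorem smul_last_v (h : MChain z y r P Q a d u v) : y • y ^ (a + 1 + d) • P = P := by
  rw [smul_smul, ← pow_succ', show a + 1 + d + 1 = r + 1 by have := h.add; omega, h.isCyc.ret]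

theorem pow_last_u (h : MChain z y r P Q a d u v) :
    z ^ u a • y ^ a • P = (y • y ^ (a + 1 + d) • P).tr (FarahatHigman.mon z P) := by
  rw [h.upow a le_rfl, smul_smul, ← pow_add, add_comm, ← psum_succ, h.usum, pow_len_smul,
    h.smul_last_v]

theorem pow_last_v (h : MChain z y r P Q a d u v) :
    z ^ v d • y ^ (a + 1 + d) • P = (y • y ^ a • P).tr (FarahatHigman.mon z Q) := by
  rw [h.vpow d le_rfl, smul_smul, ← pow_add, add_comm, ← psum_succ, h.vsum, pow_len_smul,
    h.smul_last_u]

theorem smul_mem (h : MChain z y r P Q a d u v) (j : ℕ) : (y • y ^ j • P).pos ∈ mov y := by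
  rw [smul_smul, ← pow_succ']
  exact h.isCyc.pow_mem h.one_le _

theorem pos_ne (h : MChain z y r P Q a d u v) :
    (y • y ^ a • P).pos ≠ (y • y ^ (a + 1 + d) • P).pos := by
  rw [h.smul_last_u, h.smul_last_v]
  intro he
  exact h.disj (he ▸ Equiv.Perm.SameCycle.refl _ _)

theorem len_mon (h : MChain z y r P Q a d u v) (hz : x * y = z) :
    len x Q.pos = u a + v d ∧ FarahatHigman.mon x Q = 1 := by
  have := len_mon_swap hz (h.upos a (by omega)) (h.vpos d (by omega)) (h.smul_mem a) h.pos_ne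
    (fun m h0 hm => h.notMem_u le_rfl h0 hm) (fun m h0 hm => h.notMem_v le_rfl h0 hm)
    h.pow_last_u h.pow_last_v h.mon
  rwa [h.smul_last_u] at this

theorem same (h : MChain z y r P Q a d u v) (hz : x * y = z) :
    x.right.SameCycle Q.pos P.pos := by
  have := pow_smul_swap hz (h.upos a (by omega)) (fun m h0 hm => h.notMem_u le_rfl h0 hm)
    h.pow_last_u
  rw [h.smul_last_u, h.smul_last_v] at this
  have h2 := sameCycle_pow_smul x Q (u a)
  rwa [this] at h2

/-- All arcs except the last one in each cycle of `z` close up separately, as in a splitting. The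
two last arcs start, as seen from `x`, at `Q` and `P`, which are therefore the only exceptions. -/
theorem regular (h : MChain z y r P Q a d u v) (hz : x * y = z) {i : Fin n} (hi : i ∈ mov y) :
    i = P.pos ∨ i = Q.pos ∨
      (FarahatHigman.cls x i = 1 ∧ ∀ j ∈ mov y, x.right.SameCycle i j → j = i) := by
  have hadd := h.add
  have key : ∀ (k l : ℕ), 0 < l → (∀ m, 0 < m → m < l → (z ^ m • y ^ k • P).pos ∉ mov y) →
      z ^ l • y ^ k • P = (y • y ^ k • P).tr 1 →
      (FarahatHigman.cls x (y • y ^ k • P).pos = 1 ∧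
        ∀ j ∈ mov y, x.right.SameCycle (y • y ^ k • P).pos j → j = (y • y ^ k • P).pos) :=
    fun k l hl hk he => ⟨mon_eq_one.1 (len_cls_of_arc hz hl (h.smul_mem k) hk he).2,
      fun j hj hs => eq_of_sameCycle_arc hz hl (h.smul_mem k) hk he hj hs⟩
  obtain ⟨j, hj, rfl⟩ := (h.isCyc.mem_mov h.one_le).1 hi
  rcases j with _ | j
  · exact Or.inl (by simp)
  · rw [pow_succ', mul_smul]
    rcases lt_trichotomy j a with hja | rfl | hja
    · exact Or.inr (Or.inr (key j (u j) (h.upos j (by omega))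
        (fun m h0 hm => h.notMem_u hja.le h0 hm) (h.pow_u hja)))
    · exact Or.inr (Or.inl (by rw [h.smul_last_u]))
    · obtain ⟨k, rfl⟩ := Nat.exists_eq_add_of_lt hja
      rw [show a + k + 1 = a + 1 + k by omega]
      exact Or.inr (Or.inr (key _ (v k) (h.vpos k (by omega))
        (fun m h0 hm => h.notMem_v (by omega) h0 hm) (h.pow_v (by omega))))

theorem merge (h : MChain z y r P Q a d u v) (hz : x * y = z) : Merge x y z r P Q where
  isCyc := h.isCyc
  exists_pow := ⟨a, by have := h.add; omega, h.eq_pow.symm⟩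
  same := (h.same hz).symm
  inj i hi j hj hij := by
    rcases h.regular hz hi with rfl | rfl | ⟨-, h1⟩
    · rcases h.regular hz hj with rfl | rfl | ⟨-, h1⟩
      · exact Or.inl rfl
      · exact Or.inr (Or.inl ⟨rfl, rfl⟩)
      · exact Or.inl (h1 _ hi hij.symm)
    · rcases h.regular hz hj with rfl | rfl | ⟨-, h1⟩
      · exact Or.inr (Or.inr ⟨rfl, rfl⟩)
      · exact Or.inl rfl
      · exact Or.inl (h1 _ hi hij.symm)
    · exact Or.inl (h1 j hj hij).symm
  cls i hi := by
    have hQ := mon_eq_one.1 (h.len_mon hz).2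
    rcases h.regular hz hi with rfl | rfl | ⟨h1, -⟩
    · rw [cls_eq_of_sameCycle (h.same hz), hQ]
    · exact hQ
    · exact h1
  cls_ne := fun h1 => h.mon_ne (mon_eq_one.2 h1)

/-- The positions of the two cycles of `z` are regrouped into `a + d` arcs that close up separately
and one cycle made of the two last arcs. -/
theorem mtype_eq (h : MChain z y r P Q a d u v) (hz : x * y = z) :
    mtype x + (mcycAt z P.pos + mcycAt z Q.pos) =
      mtype z + (∑ j ∈ Finset.range a, mcyc (u j) 1 + mcyc (u a + v d) 1 +
        ∑ j ∈ Finset.range d, mcyc (v j) 1) := by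
  refine ptype_ext fun φ => ?_
  have hdisj : Disjoint (orb z P) (orb z Q) := Finset.disjoint_left.2 fun i hi hi' =>
    h.disj ((mem_orb.1 hi).trans (mem_orb.1 hi').symm)
  have hsum := mtype_sub_sum_share hz (U := orb z P ∪ orb z Q)
    (fun i hi j hj => by
      rw [Finset.mem_union, mem_orb, mem_orb] at hi ⊢
      exact hi.imp (fun h => h.trans hj.symm) fun h => h.trans hj.symm) (fun i hi => by
      rw [Finset.mem_union, mem_orb, mem_orb]
      refine (h.mem_mov.1 hi).imp ?_ ?_
      · rintro ⟨j, -, rfl⟩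
        exact sameCycle_pow_smul _ _ _
      · rintro ⟨j, -, rfl⟩
        exact sameCycle_pow_smul _ _ _) φ
  rw [Finset.sum_union hdisj, Finset.sum_union hdisj, sum_orb_share, sum_orb_share, sum_orb,
    sum_orb, ← h.usum, ← h.vsum, sum_range_psum, sum_range_psum, Finset.sum_range_succ,
    Finset.sum_range_succ] at hsum
  have ku : ∀ j ≤ a, ∀ m, (z ^ (psum u j + m + 1) • P).pos = (z ^ (m + 1) • y ^ j • P).pos :=
    fun j hj m => by
      rw [h.upow j hj, smul_smul, ← pow_add]
      congr 3
      omega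
  have kv : ∀ j ≤ d, ∀ m,
      (z ^ (psum v j + m + 1) • Q).pos = (z ^ (m + 1) • y ^ (a + 1 + j) • P).pos :=
    fun j hj m => by
      rw [h.vpow j hj, smul_smul, ← pow_add]
      congr 3
      omega
  have hu : ∑ j ∈ Finset.range a, ∑ m ∈ Finset.range (u j),
      share φ x (z ^ (psum u j + m + 1) • P).pos = φ (∑ j ∈ Finset.range a, mcyc (u j) 1) := by
    rw [map_sum]
    refine Finset.sum_congr rfl fun j hj => ?_
    have hj := Finset.mem_range.1 hj
    simp only [ku j hj.le]
    rw [sum_arc_share φ hz (h.upos j (by omega)) (h.smul_mem j)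
      (fun m h0 hm => h.notMem_u hj.le h0 hm) (h.pow_u hj), mk_eq_one.2 rfl]
  have hv : ∑ j ∈ Finset.range d, ∑ m ∈ Finset.range (v j),
      share φ x (z ^ (psum v j + m + 1) • Q).pos = φ (∑ j ∈ Finset.range d, mcyc (v j) 1) := by
    rw [map_sum]
    refine Finset.sum_congr rfl fun j hj => ?_
    have hj := Finset.mem_range.1 hj
    simp only [kv j hj.le]
    rw [sum_arc_share φ hz (h.vpos j (by omega)) (h.smul_mem _)
      (fun m h0 hm => h.notMem_v hj.le h0 hm) (h.pow_v hj), mk_eq_one.2 rfl]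
  have hw := sum_swap_share φ hz (h.upos a (by omega)) (h.vpos d (by omega)) (h.smul_mem a) h.pos_ne
    (fun m h0 hm => h.notMem_u le_rfl h0 hm) (fun m h0 hm => h.notMem_v le_rfl h0 hm)
    h.pow_last_u h.pow_last_v h.mon
  simp only [← ku a le_rfl, ← kv d le_rfl] at hw
  rw [hu, hv] at hsum
  simp only [map_add]
  linarith

end MChain

/-- `P` and `Q` cut their common cycle of `x`, of length `L`, into a piece of length `w` from `P` to
`Q` with translation `g` and a piece of length `L - w` back. The product of the cycle is trivial, so
the second piece translates by `g⁻¹`. In `z` the run from `P` is closed by the second piece and the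
run from `Q` by the first, whence the inverse monodromies. -/
theorem Merge.exists_mchain (h : Merge x y z r P Q) (hz : x * y = z) :
    ∃ a d u v, MChain z y r P Q a d u v := by
  obtain ⟨a, ha, hQ⟩ := h.exists_pow
  obtain ⟨d, hd⟩ : ∃ d, a + d + 1 = r := ⟨r - (a + 1), by omega⟩
  have hr : 1 ≤ r := by omega
  have hne : ∀ i ≤ r, ∀ j ≤ r, i ≠ j → (y ^ i • P).pos ≠ (y ^ j • P).pos :=
    fun i hi j hj hij he => hij (h.isCyc.inj i hi j hj he)
  have hPQ : P.pos ≠ Q.pos := by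
    have := hne 0 (Nat.zero_le _) (a + 1) (by omega) (by omega)
    rwa [← hQ, pow_zero, one_smul] at this
  have hPm : P.pos ∈ mov y := h.isCyc.pos_mem hr
  have hQm : Q.pos ∈ mov y := hQ ▸ h.isCyc.pow_mem hr _
  obtain ⟨w, hwL, hw⟩ := SameCycle.exists_pow_smul h.same
  set L := len x P.pos with hL
  have hw0 : 0 < w := Nat.pos_of_ne_zero fun h0 => hPQ (by simpa [h0] using hw)
  obtain ⟨g, hg⟩ := Pt.exists_tr hw
  have hLP : x ^ L • P = P := by
    rw [hL, pow_len_smul, mon_eq_one.2 (h.cls _ hPm), Pt.tr_one]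
  have hg' : x ^ (L - w) • Q = P.tr g⁻¹ := by
    have h1 : (x ^ (L - w) • Q).tr g = P := by
      rw [← smul_tr, ← hg, smul_smul, ← pow_add, Nat.sub_add_cancel hwL.le, hLP]
    conv_rhs => rw [← h1, Pt.tr_tr, mul_inv_cancel, Pt.tr_one]
  have hwm : ∀ m, 0 < m → m < w → (x ^ m • P).pos ∉ mov y := by
    intro m h0 hm hmem
    rcases h.inj _ hPm _ hmem (sameCycle_pow_smul _ _ _) with he | ⟨-, he⟩ | ⟨he, -⟩
    · exact pow_smul_pos_ne h0 (by omega) he.symm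
    · rw [← hw] at he
      have := pow_smul_pos_inj (by omega) (by omega) he
      omega
    · exact hPQ he
  have hwm' : ∀ m, 0 < m → m < L - w → (x ^ m • Q).pos ∉ mov y := by
    intro m h0 hm hmem
    have h1 : (x ^ m • Q).pos = (x ^ (m + w) • P).pos := by
      rw [pow_add, mul_smul, hg, smul_tr, Pt.tr_pos]
    have h2 : m + w < len x P.pos := by omega
    rw [h1] at hmem
    rcases h.inj _ hPm _ hmem (sameCycle_pow_smul _ _ _) with he | ⟨-, he⟩ | ⟨he, -⟩
    · exact pow_smul_pos_ne (by omega) h2 he.symm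
    · rw [← hw] at he
      have := pow_smul_pos_inj h2 (by omega) he
      omega
    · exact hPQ he
  -- Apart from the points of index `0` and `a + 1`, that is `P` and `Q`, each point of `y` is alone
  -- among the moved positions of its cycle of `x`.
  have hreg : ∀ k, k + 1 ≠ a + 1 → k + 1 < r + 1 → ∀ m, 0 < m → m < len x (y ^ (k + 1) • P).pos →
      (x ^ m • y • y ^ k • P).pos ∉ mov y := by
    intro k h1 h2 m h0 hm hmem
    rw [smul_smul y, ← pow_succ'] at hmem
    rcases h.inj _ (h.isCyc.pow_mem hr (k + 1)) _ hmem (sameCycle_pow_smul _ _ _)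
      with he | ⟨he, -⟩ | ⟨he, -⟩
    · exact pow_smul_pos_ne h0 hm he.symm
    · exact hne (k + 1) (by omega) 0 (by omega) (by omega) (by simpa using he)
    · exact hne (k + 1) (by omega) (a + 1) (by omega) h1 (by rw [he, hQ])
  have hregz : ∀ k, k + 1 ≠ a + 1 → k + 1 < r + 1 →
      z ^ len x (y ^ (k + 1) • P).pos • y ^ k • P = y ^ (k + 1) • P := by
    intro k h1 h2
    rw [← pow_smul_eq_of_arc' hz (hreg k h1 h2) (len_pos _ _) le_rfl, smul_smul y, ← pow_succ',
      pow_len_smul, mon_eq_one.2 (h.cls _ (h.isCyc.pow_mem hr _)), Pt.tr_one]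
  have hya : y • y ^ a • P = Q := by rw [smul_smul, ← pow_succ', hQ]
  have hyr : y • y ^ (a + 1 + d) • P = P := by
    rw [smul_smul, ← pow_succ', show a + 1 + d + 1 = r + 1 by omega, h.isCyc.ret]
  set u : ℕ → ℕ := fun j => if j = a then L - w else len x (y ^ (j + 1) • P).pos with hu
  set v : ℕ → ℕ := fun j => if j = d then w else len x (y ^ (a + 1 + j + 1) • P).pos with hv
  have hua : u a = L - w := if_pos rfl
  have hvd : v d = w := if_pos rfl
  have hu' : ∀ j < a, u j = len x (y ^ (j + 1) • P).pos := fun j hj => if_neg hj.ne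
  have hv' : ∀ j < d, v j = len x (y ^ (a + 1 + j + 1) • P).pos := fun j hj => if_neg hj.ne
  have upos : ∀ j < a + 1, 0 < u j := fun j hj => by
    rw [hu]
    dsimp only
    split_ifs
    · omega
    · exact len_pos _ _
  have vpos : ∀ j < d + 1, 0 < v j := fun j hj => by
    rw [hv]
    dsimp only
    split_ifs
    · omega
    · exact len_pos _ _
  have upow : ∀ j ≤ a, y ^ j • P = z ^ psum u j • P := by
    intro j hj
    induction j with
    | zero => simp [psum_zero]
    | succ j ih =>
      rw [psum_succ, add_comm (psum u j), pow_add z, mul_smul, ← ih (by omega), hu' j (by omega),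
        hregz j (by omega) (by omega)]
  have vpow : ∀ j ≤ d, y ^ (a + 1 + j) • P = z ^ psum v j • Q := by
    intro j hj
    induction j with
    | zero => simp [psum_zero, hQ]
    | succ j ih =>
      rw [psum_succ, add_comm (psum v j), pow_add z, mul_smul, ← ih (by omega), hv' j (by omega),
        hregz _ (by omega) (by omega), ← add_assoc (a + 1)]
  have uarc : ∀ j < a + 1, ∀ m, 0 < m → m < u j → (z ^ m • z ^ psum u j • P).pos ∉ mov y := by
    intro j hj m h0 hm
    rw [← upow j (by omega)]
    rcases (Nat.lt_succ_iff.1 hj).lt_or_eq with hja | rfl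
    · rw [hu' j hja] at hm
      have := hreg j (by omega) (by omega)
      rw [← pow_smul_eq_of_arc' hz this h0 hm.le]
      exact this m h0 hm
    · rw [hua] at hm
      have : ∀ m, 0 < m → m < L - w → (x ^ m • y • y ^ j • P).pos ∉ mov y := by rwa [hya]
      rw [← pow_smul_eq_of_arc' hz this h0 hm.le]
      exact this m h0 hm
  have varc : ∀ j < d + 1, ∀ m, 0 < m → m < v j → (z ^ m • z ^ psum v j • Q).pos ∉ mov y := by
    intro j hj m h0 hm
    rw [← vpow j (by omega)]
    rcases (Nat.lt_succ_iff.1 hj).lt_or_eq with hja | rfl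
    · rw [hv' j hja] at hm
      have := hreg (a + 1 + j) (by omega) (by omega)
      rw [← pow_smul_eq_of_arc' hz this h0 hm.le]
      exact this m h0 hm
    · rw [hvd] at hm
      have : ∀ m, 0 < m → m < w → (x ^ m • y • y ^ (a + 1 + j) • P).pos ∉ mov y := by rwa [hyr]
      rw [← pow_smul_eq_of_arc' hz this h0 hm.le]
      exact this m h0 hm
  have uret : z ^ psum u (a + 1) • P = P.tr g⁻¹ := by
    rw [psum_succ, add_comm, pow_add, mul_smul, ← upow a le_rfl, hua,
      ← pow_smul_eq_of_arc' hz (by rwa [hya]) (by omega) le_rfl, hya, hg']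
  have vret : z ^ psum v (d + 1) • Q = Q.tr g := by
    rw [psum_succ, add_comm, pow_add, mul_smul, ← vpow d le_rfl, hvd,
      ← pow_smul_eq_of_arc' hz (by rwa [hyr]) (by omega) le_rfl, hyr, hg]
  have ulen : len z P.pos = psum u (a + 1) := by
    refine len_eq_psum ?_ hPm uarc (by rw [uret, Pt.tr_pos]) fun j hj hj0 => ?_
    · exact psum_lt_psum (i := 0) upos (Nat.succ_pos a) le_rfl
    · rw [← upow j (by omega)]
      simpa using hne j (by omega) 0 (by omega) hj0
  have vlen : len z Q.pos = psum v (d + 1) := by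
    refine len_eq_psum ?_ hQm varc (by rw [vret, Pt.tr_pos]) fun j hj hj0 => ?_
    · exact psum_lt_psum (i := 0) vpos (Nat.succ_pos d) le_rfl
    · rw [← vpow j (by omega), hQ]
      exact hne _ (by omega) _ (by omega) (by omega)
  have umon : mon z P = g⁻¹ := mon_eq_of_return (by rw [ulen, uret])
  have vmon : mon z Q = g := mon_eq_of_return (by rw [vlen, vret])
  refine ⟨a, d, u, v, h.isCyc, hd, upos, vpos, ulen.symm, vlen.symm, upow, vpow, fun hs => ?_,
    by rw [umon, vmon, inv_mul_cancel], fun h1 => h.cls_ne (mon_eq_one.1 h1)⟩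
  -- If `P` and `Q` shared a cycle of `z`, then `Q` would start one of the arcs with index at most
  -- `a`; but `y` reaches it at index `a + 1`.
  obtain ⟨t, ht, he⟩ := SameCycle.exists_pow_smul hs
  rw [ulen] at ht
  obtain ⟨j, hj, rfl⟩ := exists_start_of_mem_mov uarc ht (he ▸ hQm)
  rw [← upow j (by omega), hQ] at he
  exact hne j (by omega) (a + 1) (by omega) (by omega) he

end MChain

/-! ### Top degree forces a splitting or a merging -/

section Trichotomy

variable {Γ : Type*} [Group Γ] {n : ℕ} {x y z : Wreath Γ n} {r : ℕ}

open Classical in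
/-- The classes of the moved positions in the set of cycles of `x`. -/
noncomputable def touched (x y : Wreath Γ n) : Finset (Cyc x) := (mov y).image fun i => ⟦i⟧

theorem mk_eq_iff_sameCycle {i j : Fin n} :
    (⟦i⟧ : Cyc x) = ⟦j⟧ ↔ x.right.SameCycle i j :=
  ⟨fun h => Quotient.exact h, fun h => Quotient.sound h⟩

variable [Finite Γ]

-- Cycles of `x` not touched by `y` are cycles of `z` as well. By `deg_mtype`, the number of touched
-- trivial cycles of `x` is therefore `r` plus the number of trivial cycles of `z` on the same
-- positions, and that number is positive as soon as one moved position lies in such a cycle.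
open Classical in
theorem card_touched (hz : x * y = z) (hdeg : deg (mtype z) = deg (mtype x) + r) :
    r ≤ ((touched x y).filter fun q => cls x q.out = 1).card ∧
      ((∃ i ∈ mov y, cls z i = 1) →
        r < ((touched x y).filter fun q => cls x q.out = 1).card) := by
  set U : Finset (Fin n) := Finset.univ.filter fun i => (⟦i⟧ : Cyc x) ∈ touched x y with hU
  have hc := sum_cycles x (touched x y) fun _ c => if c = 1 then (1 : ℚ) else 0
  rw [Finset.sum_boole] at hc
  have h1 := deg_mtype x
  have h2 := deg_mtype z
  rw [hdeg, Nat.cast_add, h1, ← Finset.sum_add_sum_compl U,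
    ← Finset.sum_add_sum_compl U (fun i => (if cls z i = 1 then 1 else 0) / (len z i : ℚ))] at h2
  have h3 : ∑ i ∈ Uᶜ, (if cls x i = 1 then 1 else 0) / (len x i : ℚ) =
      ∑ i ∈ Uᶜ, (if cls z i = 1 then 1 else 0) / (len z i : ℚ) := by
    refine Finset.sum_congr rfl fun i hi => ?_
    have hi := Finset.mem_compl.1 hi
    obtain ⟨h1, h2⟩ := len_cls_eq_of_pow_smul (P := (⟨1, i⟩ : Pt Γ n))
      (pow_smul_eq_of_forall_notMem' hz fun m hm => hi (by
        rw [hU, Finset.mem_filter, touched, Finset.mem_image]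
        exact ⟨Finset.mem_univ _, _, hm,
          (Quotient.sound (sameCycle_pow_smul x (⟨1, i⟩ : Pt Γ n) m)).symm⟩))
    change len x i = len z i at h1
    change cls x i = cls z i at h2
    rw [h1, h2]
  have h0 : ∀ i ∈ U, 0 ≤ (if cls z i = 1 then 1 else 0) / (len z i : ℚ) := fun i _ => by
    split_ifs <;> positivity
  have hs : (((touched x y).filter fun q => cls x q.out = 1).card : ℚ) =
      r + ∑ i ∈ U, (if cls z i = 1 then 1 else 0) / (len z i : ℚ) := by
    linarith
  constructor
  · have := Finset.sum_nonneg h0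
    have : (r : ℚ) ≤ ((touched x y).filter fun q => cls x q.out = 1).card := by linarith
    exact_mod_cast this
  · rintro ⟨i, hi, hci⟩
    have hiU : i ∈ U := Finset.mem_filter.2 ⟨Finset.mem_univ _, Finset.mem_image_of_mem _ hi⟩
    have := Finset.single_le_sum h0 hiU
    rw [if_pos hci] at this
    have hp : (0 : ℚ) < 1 / (len z i : ℚ) := by
      have := len_pos z i
      positivity
    have : (r : ℚ) < ((touched x y).filter fun q => cls x q.out = 1).card := by linarith
    exact_mod_cast this

/-- At most `r + 1` cycles of `x` are touched and at least `r` of these are trivial. If `r + 1` are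
touched, the moved positions are separated and at most one cycle is nontrivial. If only `r` are
touched, all are trivial, one coincidence occurs, and `z` can have no trivial cycle at a moved
position. -/
theorem trichotomy (hz : x * y = z) (hdeg : deg (mtype z) = deg (mtype x) + r)
    (hcard : (mov y).card = r + 1) :
    ((∀ i ∈ mov y, ∀ j ∈ mov y, x.right.SameCycle i j → i = j) ∧
      ((∀ i ∈ mov y, cls x i = 1) ∨
        ∃ i ∈ mov y, cls x i ≠ 1 ∧ ∀ j ∈ mov y, j ≠ i → cls x j = 1)) ∨
    ∃ i ∈ mov y, ∃ j ∈ mov y, i ≠ j ∧ x.right.SameCycle i j ∧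
      (∀ k ∈ mov y, ∀ l ∈ mov y, x.right.SameCycle k l →
        k = l ∨ (k = i ∧ l = j) ∨ (k = j ∧ l = i)) ∧
      (∀ k ∈ mov y, cls x k = 1) ∧ ∀ k ∈ mov y, cls z k ≠ 1 := by
  classical
  obtain ⟨h1, h2⟩ := card_touched hz hdeg
  have hle : (touched x y).card ≤ r + 1 := hcard ▸ Finset.card_image_le
  have hmem : ∀ i ∈ mov y, (⟦i⟧ : Cyc x) ∈ touched x y := fun i hi =>
    Finset.mem_image_of_mem _ hi
  have hout : ∀ i, cls x (⟦i⟧ : Cyc x).out = cls x i := fun i =>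
    (cls_eq_of_sameCycle (sameCycle_out x i)).symm
  have hfil := Finset.card_filter_add_card_filter_not (s := touched x y)
    (fun q => cls x q.out = 1)
  rcases hle.lt_or_eq with hlt | heq
  · right
    have hall : (touched x y).filter (fun q => cls x q.out = 1) = touched x y :=
      Finset.eq_of_subset_of_card_le (Finset.filter_subset _ _) (by omega)
    have hcls : ∀ k ∈ mov y, cls x k = 1 := fun k hk => by
      have := hmem k hk
      rw [← hall, Finset.mem_filter] at this
      rw [← hout]
      exact this.2
    have hclsz : ∀ k ∈ mov y, cls z k ≠ 1 := fun k hk hk1 => by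
      have := h2 ⟨k, hk, hk1⟩
      omega
    obtain ⟨i, hi, j, hj, hij, he⟩ : ∃ i ∈ mov y, ∃ j ∈ mov y, i ≠ j ∧ (⟦i⟧ : Cyc x) = ⟦j⟧ :=
      Finset.exists_ne_map_eq_of_card_lt_of_maps_to (t := touched x y) (by omega) hmem
    -- The `r` positions other than `j` still reach all `r` touched cycles, hence are separated by
    -- them: `{i, j}` is the only coincidence.
    have himg : ((mov y).erase j).image (fun i => (⟦i⟧ : Cyc x)) = touched x y := by
      apply Finset.Subset.antisymm (Finset.image_subset_image (Finset.erase_subset _ _))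
      intro q hq
      obtain ⟨k, hk, rfl⟩ := Finset.mem_image.1 hq
      by_cases hkj : k = j
      · subst hkj
        exact Finset.mem_image.2 ⟨i, Finset.mem_erase.2 ⟨hij, hi⟩, he⟩
      · exact Finset.mem_image_of_mem _ (Finset.mem_erase.2 ⟨hkj, hk⟩)
    have hinj : Set.InjOn (fun i => (⟦i⟧ : Cyc x)) ((mov y).erase j) := by
      apply Finset.card_image_iff.1
      rw [himg, Finset.card_erase_of_mem hj, hcard, ← hall]
      rw [hall] at h1 ⊢
      omega
    refine ⟨i, hi, j, hj, hij, mk_eq_iff_sameCycle.1 he, fun k hk l hl hkl => ?_, hcls, hclsz⟩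
    have hkl := mk_eq_iff_sameCycle.2 hkl
    have herase : ∀ {k}, k ∈ mov y → k ≠ j → k ∈ ((mov y).erase j : Finset (Fin n)) :=
      fun hk hkj => Finset.mem_erase.2 ⟨hkj, hk⟩
    by_cases hkj : k = j <;> by_cases hlj : l = j
    · exact Or.inl (hkj.trans hlj.symm)
    · exact Or.inr (Or.inr ⟨hkj, hinj (herase hl hlj) (herase hi hij)
        (hkl.symm.trans (hkj ▸ he.symm))⟩)
    · exact Or.inr (Or.inl ⟨hinj (herase hk hkj) (herase hi hij)
        (hkl.trans (hlj ▸ he.symm)), hlj⟩)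
    · exact Or.inl (hinj (herase hk hkj) (herase hl hlj) hkl)
  · left
    have hinj : Set.InjOn (fun i => (⟦i⟧ : Cyc x)) (mov y) :=
      Finset.card_image_iff.1 (heq.trans hcard.symm)
    refine ⟨fun i hi j hj hij => hinj hi hj (mk_eq_iff_sameCycle.2 hij), ?_⟩
    by_cases hall : ∀ i ∈ mov y, cls x i = 1
    · exact Or.inl hall
    · push Not at hall
      obtain ⟨i, hi, hci⟩ := hall
      refine Or.inr ⟨i, hi, hci, fun j hj hji => ?_⟩
      by_contra hcj
      have hone : ((touched x y).filter fun q => ¬ cls x q.out = 1).card ≤ 1 := by omega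
      refine hji (hinj hj hi (Finset.card_le_one.1 hone _ ?_ _ ?_))
      · exact Finset.mem_filter.2 ⟨hmem j hj, by rwa [hout]⟩
      · exact Finset.mem_filter.2 ⟨hmem i hi, by rwa [hout]⟩

open Classical in
theorem card_filter_pos {Γ : Type*} [Finite Γ] {n : ℕ} (A : Finset (Fin n)) :
    (Finset.univ.filter fun P : Pt Γ n => P.pos ∈ A).card = A.card * Nat.card Γ := by
  have := Fintype.ofFinite Γ
  have : (Finset.univ.filter fun P : Pt Γ n => P.pos ∈ A) =
      (Finset.univ ×ˢ A : Finset (Γ × Fin n)).map (ptEquiv Γ n).symm.toEmbedding := by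
    ext P
    simp only [Finset.mem_filter, Finset.mem_univ, true_and, Finset.mem_map_equiv,
      Equiv.symm_symm, Finset.mem_product]
    rfl
  rw [this, Finset.card_map, Finset.card_product, mul_comm, Finset.card_univ,
    Nat.card_eq_fintype_card]

end Trichotomy

/-! ### Counting the starting points of a given factor -/

section Labels

variable {Γ : Type*} [Group Γ] {n : ℕ} {x y z : Wreath Γ n} {r : ℕ}

theorem Split.cls_eq {P : Pt Γ n} (h : Split x y r P) (hz : x * y = z) (hr : 1 ≤ r) :
    FarahatHigman.cls x P.pos = FarahatHigman.cls z P.pos :=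
  (h.chain hz hr).cls_eq hz hr

theorem Merge.pos_ne {P Q : Pt Γ n} (h : Merge x y z r P Q) : P.pos ≠ Q.pos := by
  obtain ⟨j, hj, rfl⟩ := h.exists_pow
  intro he
  have := h.isCyc.inj 0 (Nat.zero_le _) (j + 1) hj (by simpa using he)
  omega

theorem Merge.pos_mem {P Q : Pt Γ n} (h : Merge x y z r P Q) : P.pos ∈ mov y ∧ Q.pos ∈ mov y := by
  obtain ⟨j, hj, rfl⟩ := h.exists_pow
  exact ⟨h.isCyc.pos_mem (by omega), h.isCyc.pow_mem (by omega) _⟩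

theorem Merge.right_unique {P Q Q' : Pt Γ n} (h : Merge x y z r P Q) (h' : Merge x y z r P Q') :
    Q = Q' := by
  have hQ : Q.pos = Q'.pos := by
    rcases h.inj _ h'.pos_mem.1 _ h'.pos_mem.2 h'.same with he | ⟨-, he⟩ | ⟨he, -⟩
    · exact absurd he h'.pos_ne
    · exact he.symm
    · exact absurd he h.pos_ne
  obtain ⟨j, hj, rfl⟩ := h.exists_pow
  obtain ⟨k, hk, rfl⟩ := h'.exists_pow
  rw [h.isCyc.inj (j + 1) hj (k + 1) hk hQ]

variable [Finite Γ]

open Classical in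
/-- The points from which `y` splits a cycle of `z` with cycle-product `1`. -/
noncomputable def splitId (x y z : Wreath Γ n) (r : ℕ) : Finset (Pt Γ n) :=
  Finset.univ.filter fun P => Split x y r P ∧ cls z P.pos = 1

open Classical in
/-- The points from which `y` splits a cycle of `z` with cycle-product different from `1`. -/
noncomputable def splitNe (x y z : Wreath Γ n) (r : ℕ) : Finset (Pt Γ n) :=
  Finset.univ.filter fun P => Split x y r P ∧ cls z P.pos ≠ 1

open Classical in
/-- The pairs of points from which `y` merges two cycles of `z`. -/
noncomputable def mergeAt (x y z : Wreath Γ n) (r : ℕ) : Finset (Pt Γ n × Pt Γ n) :=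
  Finset.univ.filter fun p => Merge x y z r p.1 p.2

/-- By `trichotomy` exactly one of the three terms is nonzero. In its case `P` lies over any of the
`r + 1` moved positions, over the position in the nontrivial cycle of `x`, or over either position
of the coinciding pair. The `Γ`-coordinate of `P` is free, and in the last case `P` determines `Q`.
-/
theorem label_count (hr : 1 ≤ r) (hz : x * y = z) (hy : mtype y = cyc r 1)
    (hdeg : deg (mtype z) = deg (mtype x) + r) :
    ((splitId x y z r).card : ℚ) / ((r + 1) * Nat.card Γ) +
      (splitNe x y z r).card / Nat.card Γ + (mergeAt x y z r).card / (2 * Nat.card Γ) = 1 := by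
  classical
  obtain ⟨P₀, hP₀⟩ := exists_isCyc_of_mtype hr hy
  have hcard := hP₀.card_mov hr
  have hG : (Nat.card Γ : ℚ) ≠ 0 := Nat.cast_ne_zero.2 Nat.card_pos.ne'
  have hr' : (r + 1 : ℚ) ≠ 0 := by positivity
  rcases trichotomy hz hdeg hcard with ⟨hinj, hcls⟩ | ⟨i, hi, j, hj, hij, hs, huniq, hcls, hclsz⟩
  · have h3 : mergeAt x y z r = ∅ := by
      rw [mergeAt, Finset.filter_eq_empty_iff]
      rintro ⟨P, Q⟩ - h
      exact h.pos_ne (hinj _ h.pos_mem.1 _ h.pos_mem.2 h.same)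
    rcases hcls with hcls | ⟨i, hi, hci, hcls⟩
    · have h1 : splitId x y z r = Finset.univ.filter fun P => P.pos ∈ mov y := by
        refine Finset.filter_congr fun P _ => ⟨fun h => h.1.isCyc.pos_mem hr, fun h => ?_⟩
        have hsp : Split x y r P := ⟨hP₀.of_mem hr h, hinj, fun i hi _ => hcls i hi⟩
        exact ⟨hsp, by rw [← hsp.cls_eq hz hr, hcls _ h]⟩
      have h2 : splitNe x y z r = ∅ := by
        rw [splitNe, Finset.filter_eq_empty_iff]
        rintro P - ⟨h, hne⟩
        exact hne (by rw [← h.cls_eq hz hr, hcls _ (h.isCyc.pos_mem hr)])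
      rw [h1, h2, h3, card_filter_pos, hcard]
      push_cast
      field_simp
      simp
    · have h1 : splitId x y z r = ∅ := by
        rw [splitId, Finset.filter_eq_empty_iff]
        rintro P - ⟨h, he⟩
        rw [← h.cls_eq hz hr] at he
        by_cases hPi : P.pos = i
        · exact hci (hPi ▸ he)
        · exact hci (h.cls i hi (Ne.symm hPi))
      have h2 : splitNe x y z r = Finset.univ.filter fun P => P.pos ∈ ({i} : Finset (Fin n)) := by
        refine Finset.filter_congr fun P _ => ?_
        rw [Finset.mem_singleton]
        constructor
        · rintro ⟨h, -⟩
          by_contra hPi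
          exact hci (h.cls i hi (Ne.symm hPi))
        · intro h
          have hsp : Split x y r P := ⟨hP₀.of_mem hr (h ▸ hi), hinj, fun j hj hne =>
            hcls j hj (h ▸ hne)⟩
          exact ⟨hsp, by rwa [← hsp.cls_eq hz hr, h]⟩
      rw [h1, h2, h3, card_filter_pos]
      simp [hG]
  · have h1 : ∀ P, ¬ Split x y r P := fun P h => hij (h.inj i hi j hj hs)
    have hid : splitId x y z r = ∅ :=
      Finset.filter_eq_empty_iff.2 fun P _ h => h1 P h.1
    have hne : splitNe x y z r = ∅ :=
      Finset.filter_eq_empty_iff.2 fun P _ h => h1 P h.1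
    have h3 : (mergeAt x y z r).card =
        (Finset.univ.filter fun P : Pt Γ n => P.pos ∈ ({i, j} : Finset (Fin n))).card := by
      refine Finset.card_bij (fun p _ => p.1) ?_ ?_ ?_
      · rintro ⟨P, Q⟩ h
        have h : Merge x y z r P Q := (Finset.mem_filter.1 h).2
        rw [Finset.mem_filter, Finset.mem_insert, Finset.mem_singleton]
        refine ⟨Finset.mem_univ _, ?_⟩
        rcases huniq _ h.pos_mem.1 _ h.pos_mem.2 h.same with he | ⟨he, -⟩ | ⟨he, -⟩
        · exact absurd he h.pos_ne
        · exact Or.inl he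
        · exact Or.inr he
      · rintro ⟨P, Q⟩ h ⟨P', Q'⟩ h' he
        have h : Merge x y z r P Q := (Finset.mem_filter.1 h).2
        have h' : Merge x y z r P' Q' := (Finset.mem_filter.1 h').2
        obtain rfl : P = P' := he
        rw [h.right_unique h']
      · have key : ∀ P : Pt Γ n, ∀ j ∈ mov y, P.pos ∈ mov y → P.pos ≠ j →
            x.right.SameCycle P.pos j →
            (∀ k ∈ mov y, ∀ l ∈ mov y, x.right.SameCycle k l →
              k = l ∨ (k = P.pos ∧ l = j) ∨ (k = j ∧ l = P.pos)) →
            ∃ a, ∃ ha : a ∈ mergeAt x y z r, a.1 = P := by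
          intro P j hj hP hne hs huniq
          have hc := hP₀.of_mem hr hP
          obtain ⟨k, hk, rfl⟩ := (hc.mem_mov hr).1 hj
          rcases k with _ | k
          · exact absurd (by simp) hne
          · exact ⟨(P, y ^ (k + 1) • P), Finset.mem_filter.2 ⟨Finset.mem_univ _, hc, ⟨k, hk, rfl⟩,
              hs, huniq, hcls, hclsz _ hP⟩, rfl⟩
        intro P hP
        have hP := (Finset.mem_filter.1 hP).2
        rw [Finset.mem_insert, Finset.mem_singleton] at hP
        rcases hP with rfl | rfl
        · exact key P j hj hi hij hs huniq
        · exact key P i hi hj hij.symm hs.symm fun k hk l hl h => (huniq k hk l hl h).imp id Or.symm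
    rw [hid, hne, h3, card_filter_pos, Finset.card_pair hij]
    push_cast
    field_simp
    simp

end Labels

/-! ### Lists, arcs and cuts -/

theorem card_eq_of_rel {α β : Type*} {s : Finset α} {t : Finset β} (R : α → β → Prop)
    (h₁ : ∀ a ∈ s, ∃ b ∈ t, R a b) (h₂ : ∀ b ∈ t, ∃ a ∈ s, R a b)
    (u₁ : ∀ a b b', R a b → R a b' → b = b') (u₂ : ∀ a a' b, R a b → R a' b → a = a') :
    s.card = t.card := by
  choose f hf using h₁
  refine Finset.card_bij f (fun a ha => (hf a ha).1)
    (fun a ha a' ha' h => u₂ a a' (f a ha) (hf a ha).2 (h ▸ (hf a' ha').2)) fun b hb => ?_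
  obtain ⟨a, ha, hab⟩ := h₂ b hb
  exact ⟨a, ha, u₁ a _ _ (hf a ha).2 hab⟩

/-- The entries of a list of natural numbers, continued by zeros. -/
def entry (l : List ℕ) (j : ℕ) : ℕ := l.getD j 0

theorem sum_map_range {M : Type*} [AddCommMonoid M] (f : ℕ → M) (k : ℕ) :
    ((List.range k).map f).sum = ∑ j ∈ Finset.range k, f j := by
  induction k with
  | zero => simp
  | succ k ih => rw [List.range_succ, List.map_append, List.sum_append, ih,
      Finset.sum_range_succ, List.map_singleton, List.sum_singleton]

theorem entry_map_range (u : ℕ → ℕ) {k j : ℕ} (hj : j < k) :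
    entry ((List.range k).map u) j = u j := by
  simp [entry, List.getD, hj]

theorem map_range_entry (l : List ℕ) : (List.range l.length).map (entry l) = l := by
  refine List.ext_getElem (by simp) fun j h1 h2 => ?_
  simp [entry, h2]

theorem psum_entry (l : List ℕ) : psum (entry l) l.length = l.sum := by
  rw [psum, ← sum_map_range, map_range_entry]

theorem entry_pos {l : List ℕ} (h : ∀ i ∈ l, 0 < i) {j : ℕ} (hj : j < l.length) :
    0 < entry l j := by
  refine h _ ?_
  rw [entry, List.getD_eq_getElem _ _ hj]
  exact List.getElem_mem hj

theorem psum_congr {u u' : ℕ → ℕ} {k : ℕ} (h : ∀ j < k, u j = u' j) : psum u k = psum u' k :=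
  Finset.sum_congr rfl fun j hj => h j (Finset.mem_range.1 hj)

/-- The prescribed sum is a cut strictly inside one part, since `k` and `l` are positive. The list
and the cut determine that part and its two pieces. -/
theorem split_unique {a b a' b' : List ℕ} {k l k' l' : ℕ}
    (h : a ++ (k + l) :: b = a' ++ (k' + l') :: b') (hs : a.sum + k = a'.sum + k')
    (hk : 0 < k) (hl : 0 < l) (hk' : 0 < k') (hl' : 0 < l') :
    a = a' ∧ k = k' ∧ l = l' ∧ b = b' := by
  induction a generalizing a' with
  | nil =>
    cases a' with
    | nil =>
      simp only [List.nil_append, List.cons.injEq, List.sum_nil] at h hs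
      exact ⟨rfl, by omega, by omega, h.2⟩
    | cons c a' =>
      simp only [List.nil_append, List.cons_append, List.cons.injEq, List.sum_nil,
        List.sum_cons] at h hs
      omega
  | cons c a ih =>
    cases a' with
    | nil =>
      simp only [List.nil_append, List.cons_append, List.cons.injEq, List.sum_nil,
        List.sum_cons] at h hs
      omega
    | cons c' a' =>
      simp only [List.cons_append, List.cons.injEq, List.sum_cons] at h hs
      obtain ⟨rfl, h2⟩ := h
      obtain ⟨rfl, h3⟩ := ih h2 (by omega)
      exact ⟨rfl, h3⟩

/-- A number below the total that is not a partial sum falls strictly inside some part; this part is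
found by discarding initial parts as long as they are smaller than what remains of `s`. -/
theorem exists_split {t : List ℕ} {s : ℕ} (h0 : 0 < s) (hs : s < t.sum)
    (h : ∀ i ∈ Finset.Icc 1 t.length, (t.take i).sum ≠ s) :
    ∃ a k l b, 0 < k ∧ 0 < l ∧ t = a ++ (k + l) :: b ∧ a.sum + k = s := by
  induction t generalizing s with
  | nil => simp at hs
  | cons c t ih =>
    have hc := h 1 (by simp)
    simp only [List.take_succ_cons, List.take_zero, List.sum_cons, List.sum_nil, add_zero] at hc
    rcases lt_or_gt_of_ne hc with hlt | hgt
    · have hs' : s - c < t.sum := by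
        rw [List.sum_cons] at hs
        omega
      obtain ⟨a, k, l, b, hk, hl, rfl, he⟩ := ih (s := s - c) (by omega) hs' fun i hi he => by
        have := h (i + 1) (by
          rw [Finset.mem_Icc] at hi ⊢
          rw [List.length_cons]
          omega)
        rw [List.take_succ_cons, List.sum_cons] at this
        omega
      exact ⟨c :: a, k, l, b, hk, hl, rfl, by rw [List.sum_cons]; omega⟩
    · exact ⟨[], s, c - s, t, h0, by omega, by
        rw [List.nil_append, Nat.add_sub_cancel' hgt.le], by simp⟩

theorem sum_take_ne {a b : List ℕ} {k l i : ℕ} (hk : 0 < k) (hl : 0 < l) :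
    ((a ++ (k + l) :: b).take i).sum ≠ a.sum + k := by
  induction a generalizing i with
  | nil =>
    rcases i with _ | i
    · simp
      omega
    · simp
      omega
  | cons c a ih =>
    rcases i with _ | i
    · simp
      omega
    · have := ih (i := i)
      simp only [List.cons_append, List.take_succ_cons, List.sum_cons]
      omega

/-! ### The coefficient as a number of factorizations -/

section Coeff

variable {Γ : Type*} [Group Γ] [Finite Γ] {n : ℕ}

open Classical in
theorem coeff_classSum_mul (lam μ : PType Γ) (z : Wreath Γ n) :
    (classSum n lam * classSum n μ).coeff z =
      (Finset.univ.filter fun y : Wreath Γ n => mtype y = μ ∧ mtype (z * y⁻¹) = lam).card := by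
  rw [classSum, classSum, Finset.sum_mul_sum, Finset.sum_comm, MonoidAlgebra.coeff_sum,
    Finsupp.finsetSum_apply, ← Finset.filter_filter, Finset.card_filter, Nat.cast_sum]
  refine Finset.sum_congr rfl fun y _ => ?_
  rw [MonoidAlgebra.coeff_sum, Finsupp.finsetSum_apply, Finset.sum_filter,
    Finset.sum_eq_single (z * y⁻¹)]
  · simp
  · intro x _ hx
    have hxy : x * y ≠ z := by
      rintro rfl
      simp at hx
    rw [← map_mul, MonoidAlgebra.of_apply, MonoidAlgebra.coeff_single, Finsupp.single_apply,
      if_neg hxy, ite_self]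
  · simp

end Coeff

/-! ### Factorizations as compositions -/

section Count

variable {Γ : Type*} [Group Γ] {n : ℕ} {r : ℕ}

theorem Chain.congr {z y : Wreath Γ n} {P : Pt Γ n} {u u' : ℕ → ℕ} (h : Chain z y r P u)
    (hu : ∀ j < r + 1, u j = u' j) : Chain z y r P u' where
  isCyc := h.isCyc
  pos j hj := hu j hj ▸ h.pos j hj
  sum := by rw [← psum_congr hu, h.sum]
  pow j hj := by rw [h.pow j hj, psum_congr fun i hi => hu i (by omega)]

theorem Chain.unique {z y y' : Wreath Γ n} {P : Pt Γ n} {u : ℕ → ℕ} (h : Chain z y r P u)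
    (h' : Chain z y' r P u) : y = y' :=
  h.isCyc.eq_of_pow_smul_eq h'.isCyc fun i hi => by rw [h.pow i hi, h'.pow i hi]

theorem MChain.congr {z y : Wreath Γ n} {P Q : Pt Γ n} {a d : ℕ} {u v u' v' : ℕ → ℕ}
    (h : MChain z y r P Q a d u v) (hu : ∀ j < a + 1, u j = u' j) (hv : ∀ j < d + 1, v j = v' j) :
    MChain z y r P Q a d u' v' where
  isCyc := h.isCyc
  add := h.add
  upos j hj := hu j hj ▸ h.upos j hj
  vpos j hj := hv j hj ▸ h.vpos j hj
  usum := by rw [← psum_congr hu, h.usum]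
  vsum := by rw [← psum_congr hv, h.vsum]
  upow j hj := by rw [h.upow j hj, psum_congr fun i hi => hu i (by omega)]
  vpow j hj := by rw [h.vpow j hj, psum_congr fun i hi => hv i (by omega)]
  disj := h.disj
  mon := h.mon
  mon_ne := h.mon_ne

theorem MChain.unique {z y y' : Wreath Γ n} {P Q : Pt Γ n} {a d : ℕ} {u v : ℕ → ℕ}
    (h : MChain z y r P Q a d u v) (h' : MChain z y' r P Q a d u v) : y = y' :=
  h.isCyc.eq_of_pow_smul_eq h'.isCyc fun i hi => by
    have hadd := h.add
    by_cases hia : i ≤ a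
    · rw [h.upow i hia, h'.upow i hia]
    · obtain ⟨j, rfl⟩ := Nat.exists_eq_add_of_le (show a + 1 ≤ i by omega)
      rw [h.vpow j (by omega), h'.vpow j (by omega)]

theorem eq_of_psum_eq {u u' : ℕ → ℕ} {k : ℕ} (h : ∀ j ≤ k, psum u j = psum u' j) :
    ∀ j < k, u j = u' j := fun j hj => by
  have h1 := h j hj.le
  have h2 := h (j + 1) hj
  rw [psum_succ, psum_succ] at h2
  omega

/-- The index of `Q` along `y` gives `a`, and the times at which `z` reaches the points of `y` give
the partial sums of the arc lengths. -/
theorem MChain.params {z y : Wreath Γ n} {P Q : Pt Γ n} {a d a' d' : ℕ} {u v u' v' : ℕ → ℕ}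
    (h : MChain z y r P Q a d u v) (h' : MChain z y r P Q a' d' u' v') :
    a = a' ∧ d = d' ∧ (∀ j < a + 1, u j = u' j) ∧ ∀ j < d + 1, v j = v' j := by
  have h1 := h.add
  have h1' := h'.add
  obtain rfl : a = a' := by
    have := h.isCyc.inj (a + 1) (by omega) (a' + 1) (by omega) (by rw [h.eq_pow, h'.eq_pow])
    omega
  obtain rfl : d = d' := by omega
  refine ⟨rfl, rfl, eq_of_psum_eq fun j hj => ?_, eq_of_psum_eq fun j hj => ?_⟩
  · rcases hj.lt_or_eq with hj | rfl
    · refine pow_smul_pos_inj (x := z) (P := P) ?_ ?_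
        (by rw [← h.upow j (by omega), ← h'.upow j (by omega)])
      · rw [← h.usum]
        exact psum_lt_psum h.upos hj le_rfl
      · rw [← h'.usum]
        exact psum_lt_psum h'.upos hj le_rfl
    · rw [h.usum, h'.usum]
  · rcases hj.lt_or_eq with hj | rfl
    · refine pow_smul_pos_inj (x := z) (P := Q) ?_ ?_
        (by rw [← h.vpow j (by omega), ← h'.vpow j (by omega)])
      · rw [← h.vsum]
        exact psum_lt_psum h.vpos hj le_rfl
      · rw [← h'.vsum]
        exact psum_lt_psum h'.vpos hj le_rfl
    · rw [h.vsum, h'.vsum]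

/-- The lengths of the cycles of `x` that arise from the two cycles of `z` in an `MChain`. -/
def mergeList (a d : ℕ) (u v : ℕ → ℕ) : List ℕ :=
  (List.range a).map u ++ (u a + v d) :: (List.range d).map v

variable [Finite Γ]

-- The composition lists the arc lengths in the order of the cycle of `z`. They determine `y`, and
-- every composition into `r + 1` parts occurs, the type condition being translated by
-- `Chain.mtype_eq`.
open Classical in
theorem card_split (lam : PType Γ) (hr : 1 ≤ r) (z : Wreath Γ n) (P : Pt Γ n) :
    (Finset.univ.filter fun y : Wreath Γ n => (mtype y = cyc r 1 ∧ mtype (z * y⁻¹) = lam) ∧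
      Split (z * y⁻¹) y r P).card =
    (Finset.univ.filter fun c : Composition (len z P.pos) => c.blocks.length = r + 1 ∧
      lam + mcycAt z P.pos = mtype z + (∑ j ∈ Finset.range r, mcyc (entry c.blocks j) 1 +
        mcyc (entry c.blocks r) (cls z P.pos))).card := by
  refine card_eq_of_rel (fun y c => c.blocks.length = r + 1 ∧ Chain z y r P (entry c.blocks))
    ?_ ?_ ?_ ?_
  · intro y hy
    obtain ⟨-, ⟨-, hlam⟩, hs⟩ := Finset.mem_filter.1 hy
    have hz : z * y⁻¹ * y = z := inv_mul_cancel_right z y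
    have hc := hs.chain hz hr
    set u : ℕ → ℕ := fun j => len (z * y⁻¹) (y ^ (j + 1) • P).pos
    let c : Composition (len z P.pos) :=
      { blocks := (List.range (r + 1)).map u
        blocks_pos := by
          intro i hi
          obtain ⟨j, hj, rfl⟩ := List.mem_map.1 hi
          exact hc.pos j (List.mem_range.1 hj)
        blocks_sum := by
          rw [sum_map_range]
          exact hc.sum }
    have hlen : c.blocks.length = r + 1 := by simp [c]
    have hc' : Chain z y r P (entry c.blocks) :=
      hc.congr fun j hj => (entry_map_range u hj).symm
    refine ⟨c, Finset.mem_filter.2 ⟨Finset.mem_univ _, hlen, ?_⟩, hlen, hc'⟩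
    rw [← hlam]
    exact hc'.mtype_eq hz hr
  · intro c hc
    obtain ⟨-, hlen, hlam⟩ := Finset.mem_filter.1 hc
    obtain ⟨y, hy⟩ := exists_chain (r := r) z P (u := entry c.blocks)
      (fun j hj => entry_pos (fun i hi => c.blocks_pos hi) (by omega))
      (by rw [← hlen, psum_entry, c.blocks_sum])
    have hz : z * y⁻¹ * y = z := inv_mul_cancel_right z y
    refine ⟨y, Finset.mem_filter.2 ⟨Finset.mem_univ _, ⟨hy.isCyc.mtype hr, ?_⟩, hy.split hz hr⟩,
      hlen, hy⟩
    have := hy.mtype_eq hz hr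
    rw [← hlam] at this
    exact add_right_cancel this
  · rintro y c c' ⟨h1, h2⟩ ⟨h1', h2'⟩
    have hz : z * y⁻¹ * y = z := inv_mul_cancel_right z y
    ext1
    rw [← map_range_entry c.blocks, ← map_range_entry c'.blocks, h1, h1']
    refine List.map_congr_left fun j hj => ?_
    have hj : j ≤ r := Nat.lt_succ_iff.1 (List.mem_range.1 hj)
    rw [← (h2.len_mon hz hr hj).1, (h2'.len_mon hz hr hj).1]
  · rintro y y' c ⟨-, h⟩ ⟨-, h'⟩
    exact h.unique h'

-- The composition is `mergeList`. Its part `u a + v d` contains the length of the cycle of `z`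
-- through `P` as an interior cut, so that this length is not a partial sum; conversely, by
-- `exists_split` and `split_unique`, such a composition determines the arcs of both cycles.
open Classical in
theorem card_merge (lam : PType Γ) (z : Wreath Γ n) (P Q : Pt Γ n)
    (hd : ¬ z.right.SameCycle P.pos Q.pos) (hm : mon z P * mon z Q = 1) (hne : mon z P ≠ 1) :
    (Finset.univ.filter fun y : Wreath Γ n => (mtype y = cyc r 1 ∧ mtype (z * y⁻¹) = lam) ∧
      Merge (z * y⁻¹) y z r P Q).card =
    (Finset.univ.filter fun c : Composition (len z P.pos + len z Q.pos) => c.blocks.length = r ∧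
      len z P.pos ∉ (Finset.Icc 1 r).image (fun i => (c.blocks.take i).sum) ∧
      lam + (mcycAt z P.pos + mcycAt z Q.pos) =
        mtype z + (c.blocks.map fun k => mcyc k 1).sum).card := by
  have hsumlist : ∀ a d u v, ((mergeList a d u v).map fun k => (mcyc k 1 : PType Γ)).sum =
      ∑ j ∈ Finset.range a, mcyc (u j) 1 + mcyc (u a + v d) 1 +
        ∑ j ∈ Finset.range d, mcyc (v j) 1 := fun a d u v => by
    rw [mergeList, List.map_append, List.map_cons, List.sum_append, List.sum_cons, List.map_map,
      List.map_map, sum_map_range, sum_map_range, ← add_assoc]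
    rfl
  have husum : ∀ a (u : ℕ → ℕ), ((List.range a).map u).sum + u a = psum u (a + 1) := fun a u => by
    rw [sum_map_range, psum_succ, psum]
  refine card_eq_of_rel (fun y c => ∃ a d u v, c.blocks = mergeList a d u v ∧
    MChain z y r P Q a d u v) ?_ ?_ ?_ ?_
  · intro y hy
    obtain ⟨-, ⟨-, hlam⟩, hs⟩ := Finset.mem_filter.1 hy
    have hz : z * y⁻¹ * y = z := inv_mul_cancel_right z y
    obtain ⟨a, d, u, v, h⟩ := hs.exists_mchain hz
    let c : Composition (len z P.pos + len z Q.pos) :=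
      { blocks := mergeList a d u v
        blocks_pos := by
          intro i hi
          rw [mergeList, List.mem_append, List.mem_cons] at hi
          rcases hi with hi | rfl | hi
          · obtain ⟨j, hj, rfl⟩ := List.mem_map.1 hi
            exact h.upos j (by rw [List.mem_range] at hj; omega)
          · have := h.upos a (by omega)
            omega
          · obtain ⟨j, hj, rfl⟩ := List.mem_map.1 hi
            exact h.vpos j (by rw [List.mem_range] at hj; omega)
        blocks_sum := by
          rw [← h.usum, ← h.vsum, ← husum, ← husum, mergeList, List.sum_append, List.sum_cons]
          omega }
    refine ⟨c, Finset.mem_filter.2 ⟨Finset.mem_univ _, ?_, ?_, ?_⟩, a, d, u, v, rfl, h⟩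
    · have := h.add
      simp only [c, mergeList, List.length_append, List.length_cons, List.length_map,
        List.length_range]
      omega
    · rw [Finset.mem_image]
      rintro ⟨i, -, hi⟩
      exact sum_take_ne (h.upos a (by omega)) (h.vpos d (by omega))
        (hi.trans (h.usum.symm.trans (husum a u).symm))
    · rw [← hlam, hsumlist]
      exact h.mtype_eq hz
  · intro c hc
    obtain ⟨-, hlen, hns, hlam⟩ := Finset.mem_filter.1 hc
    obtain ⟨la, k, l, lb, hk, hl, ht, hs⟩ := exists_split (t := c.blocks) (s := len z P.pos)
      (len_pos _ _) (by
        rw [c.blocks_sum]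
        have := len_pos z Q.pos
        omega) fun i hi he => hns (Finset.mem_image.2 ⟨i, hlen ▸ hi, he⟩)
    have hpos : ∀ i ∈ la ++ (k + l) :: lb, 0 < i := fun i hi => c.blocks_pos (ht ▸ hi)
    have hsum := c.blocks_sum
    rw [ht, List.sum_append, List.sum_cons] at hsum
    rw [ht, List.length_append, List.length_cons] at hlen
    have happ : ∀ (m : List ℕ) (k : ℕ), (List.range m.length).map (entry (m ++ [k])) = m ∧
        entry (m ++ [k]) m.length = k := fun m k => by
      constructor
      · refine List.ext_getElem (by simp) fun j h1 h2 => ?_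
        simp [entry, h2, List.getElem?_append]
      · simp [entry]
    have hml : mergeList la.length lb.length (entry (la ++ [k])) (entry (lb ++ [l])) =
        c.blocks := by
      rw [mergeList, (happ la k).1, (happ lb l).1, (happ la k).2, (happ lb l).2, ht]
    obtain ⟨y, hy⟩ := exists_mchain (r := r) (a := la.length) (d := lb.length)
      (u := entry (la ++ [k])) (v := entry (lb ++ [l])) z P Q (by omega)
      (fun j hj => entry_pos (fun i hi => by
        rw [List.mem_append, List.mem_singleton] at hi
        rcases hi with hi | rfl
        · exact hpos i (List.mem_append_left _ hi)
        · exact hk) (by simpa using hj))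
      (fun j hj => entry_pos (fun i hi => by
        rw [List.mem_append, List.mem_singleton] at hi
        rcases hi with hi | rfl
        · exact hpos i (List.mem_append_right _ (List.mem_cons_of_mem _ hi))
        · exact hl) (by simpa using hj))
      (by rw [← husum, (happ la k).1, (happ la k).2, hs])
      (by rw [← husum, (happ lb l).1, (happ lb l).2]; omega) hd hm hne
    have hz : z * y⁻¹ * y = z := inv_mul_cancel_right z y
    refine ⟨y, Finset.mem_filter.2 ⟨Finset.mem_univ _, ⟨hy.isCyc.mtype hy.one_le, ?_⟩, hy.merge hz⟩,
      _, _, _, _, hml.symm, hy⟩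
    have := hy.mtype_eq hz
    rw [← hsumlist, hml, ← hlam] at this
    exact add_right_cancel this
  · rintro y c c' ⟨a, d, u, v, hc, h⟩ ⟨a', d', u', v', hc', h'⟩
    obtain ⟨rfl, rfl, hu, hv⟩ := h.params h'
    ext1
    rw [hc, hc', mergeList, mergeList, hu a (by omega), hv d (by omega)]
    congr 1
    · exact List.map_congr_left fun j hj => hu j (by rw [List.mem_range] at hj; omega)
    · congr 1
      exact List.map_congr_left fun j hj => hv j (by rw [List.mem_range] at hj; omega)
  · rintro y y' c ⟨a, d, u, v, hc, h⟩ ⟨a', d', u', v', hc', h'⟩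
    rw [hc, mergeList, mergeList] at hc'
    obtain ⟨h1, h2, h3, h4⟩ := split_unique hc' (by rw [husum, husum, h.usum, h'.usum])
      (h.upos a (by omega)) (h.vpos d (by omega)) (h'.upos a' (by omega)) (h'.vpos d' (by omega))
    obtain rfl : a = a' := by simpa using congrArg List.length h1
    obtain rfl : d = d' := by simpa using congrArg List.length h4
    have hmap : ∀ {k : ℕ} {w w' : ℕ → ℕ}, (List.range k).map w = (List.range k).map w' →
        w k = w' k → ∀ j < k + 1, w j = w' j := fun {k w w'} he hk j hj => by
      rcases (Nat.lt_succ_iff.1 hj).lt_or_eq with hlt | rfl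
      · rw [← entry_map_range w hlt, he, entry_map_range w' hlt]
      · exact hk
    exact (h.congr (hmap h1 h2) (hmap h4 h3)).unique h'

end Count

/-! ### Rearrangements of multisets and of `μ̃` -/

section Rearrangements

variable {α : Type*} [DecidableEq α]

theorem mem_lists_toFinset {m : Multiset α} {l : List α} :
    l ∈ m.lists.toFinset ↔ (l : Multiset α) = m := by
  rw [Multiset.mem_toFinset, Multiset.mem_lists_iff, eq_comm]
  rfl

theorem prod_count_factorial {m : Multiset α} {s : Finset α} (h : m.toFinset ⊆ s) :
    ∏ a ∈ m.toFinset, (m.count a).factorial = ∏ a ∈ s, (m.count a).factorial :=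
  Finset.prod_subset h fun a _ ha => by
    rw [Multiset.mem_toFinset] at ha
    rw [Multiset.count_eq_zero_of_notMem ha, Nat.factorial_zero]

/-- Sort the arrangements by their first entry `a`: by induction, those beginning with `a`
contribute the multiplicity of `a` times `k!`, and the multiplicities add up to `k + 1`. -/
theorem prod_count_mul_card_lists (m : Multiset α) :
    (∏ a ∈ m.toFinset, (m.count a).factorial) * m.lists.toFinset.card =
      (Multiset.card m).factorial := by
  induction hk : Multiset.card m generalizing m with
  | zero =>
    obtain rfl := Multiset.card_eq_zero.1 hk
    have : (0 : Multiset α).lists.toFinset = {[]} := by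
      ext l
      rw [mem_lists_toFinset, Finset.mem_singleton, Multiset.coe_eq_zero]
    rw [this]
    simp
  | succ k ih =>
    have hun : m.lists.toFinset =
        m.toFinset.biUnion fun a => (m.erase a).lists.toFinset.image (List.cons a) := by
      ext l
      rw [mem_lists_toFinset, Finset.mem_biUnion]
      constructor
      · rintro rfl
        cases l with
        | nil => simp at hk
        | cons a l => exact ⟨a, by simp, Finset.mem_image_of_mem _ (by
            rw [mem_lists_toFinset, ← Multiset.cons_coe, Multiset.erase_cons_head])⟩
      · rintro ⟨a, ha, hl⟩
        obtain ⟨l', hl', rfl⟩ := Finset.mem_image.1 hl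
        rw [← Multiset.cons_coe, mem_lists_toFinset.1 hl',
          Multiset.cons_erase (Multiset.mem_toFinset.1 ha)]
    have hdisj : (m.toFinset : Set α).PairwiseDisjoint
        fun a => (m.erase a).lists.toFinset.image (List.cons a) := by
      intro a _ b _ hab
      refine Finset.disjoint_left.2 fun l hl hl' => hab ?_
      obtain ⟨l, -, rfl⟩ := Finset.mem_image.1 hl
      obtain ⟨l', -, he⟩ := Finset.mem_image.1 hl'
      exact (List.cons.inj he).1.symm
    rw [hun, Finset.card_biUnion hdisj, Finset.mul_sum]
    have key : ∀ a ∈ m.toFinset, (∏ a ∈ m.toFinset, (m.count a).factorial) *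
        ((m.erase a).lists.toFinset.image (List.cons a)).card = m.count a * k.factorial := by
      intro a ha
      have ha' := Multiset.mem_toFinset.1 ha
      have hc := Multiset.count_pos.2 ha'
      have hprod : ∏ b ∈ m.toFinset.erase a, ((m.erase a).count b).factorial =
          ∏ b ∈ m.toFinset.erase a, (m.count b).factorial :=
        Finset.prod_congr rfl fun b hb => by
          rw [Multiset.count_erase_of_ne (Finset.mem_erase.1 hb).1]
      rw [Finset.card_image_of_injective _ List.cons_injective,
        ← ih (m.erase a) (by rw [Multiset.card_erase_of_mem ha', hk]; rfl),
        prod_count_factorial (s := m.toFinset)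
          (Multiset.toFinset_subset.2 (Multiset.erase_subset a m)),
        ← Finset.mul_prod_erase _ _ ha, ← Finset.mul_prod_erase _ _ ha,
        Multiset.count_erase_self, ← Nat.mul_factorial_pred hc.ne', hprod]
      ring
    rw [Finset.sum_congr rfl key, ← Finset.sum_mul, Multiset.toFinset_sum_count_eq, hk,
      Nat.factorial_succ]

end Rearrangements

theorem mult_coe (μ : Multiset ℕ+) (i : ℕ+) : mult μ i = μ.count i :=
  Multiset.count_map_eq_count' _ _ PNat.coe_injective i

theorem mult_add (μ ν : Multiset ℕ+) (i : ℕ) : mult (μ + ν) i = mult μ i + mult ν i := by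
  simp [mult]

theorem le_size {μ : Multiset ℕ+} {k : ℕ+} (h : k ∈ μ) : (k : ℕ) ≤ size μ :=
  Multiset.single_le_sum (fun _ _ => Nat.zero_le _) _ (Multiset.mem_map_of_mem _ h)

theorem card_tildePart {μ : Multiset ℕ+} {r : ℕ} (h : Multiset.card μ ≤ r) :
    Multiset.card (tildePart μ r) = r := by
  rw [tildePart, Multiset.card_add, Multiset.card_map, Multiset.card_replicate]
  omega

theorem sum_tildePart {μ : Multiset ℕ+} {r : ℕ} (h : Multiset.card μ ≤ r) :
    (tildePart μ r).sum = size μ + r := by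
  have : (μ.map fun k : ℕ+ => (k : ℕ) + 1).sum = size μ + Multiset.card μ := by
    rw [Multiset.sum_map_add]
    simp [size]
  rw [tildePart, Multiset.sum_add, this, Multiset.sum_replicate, smul_eq_mul, mul_one]
  omega

theorem pos_of_mem_tildePart {μ : Multiset ℕ+} {r i : ℕ} (h : i ∈ tildePart μ r) : 0 < i := by
  rw [tildePart, Multiset.mem_add, Multiset.mem_map] at h
  rcases h with ⟨k, -, rfl⟩ | h
  · omega
  · rw [Multiset.eq_of_mem_replicate h]
    exact Nat.one_pos

/-- The number of distinct rearrangements of the parts of `μ̃`. -/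
def rearr (μ : Multiset ℕ+) (r : ℕ) : ℕ := (tildePart μ r).lists.toFinset.card

/-- Raising the parts of `μ` by `1` keeps them apart from the `r - ℓ(μ)` added ones, so the
multiplicities in `μ̃` are those of `μ` together with `r - ℓ(μ)`. -/
theorem factorial_mul_multFact_mul_rearr {μ : Multiset ℕ+} {r : ℕ} (h : Multiset.card μ ≤ r) :
    (r - Multiset.card μ).factorial * multFact μ * rearr μ r = r.factorial := by
  have h1 := prod_count_mul_card_lists (tildePart μ r)
  rw [card_tildePart h] at h1
  rw [← h1, rearr]
  congr 1
  have hsub : (tildePart μ r).toFinset ⊆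
      insert 1 (μ.toFinset.image fun k : ℕ+ => (k : ℕ) + 1) := by
    intro i hi
    rw [Multiset.mem_toFinset, tildePart, Multiset.mem_add, Multiset.mem_map] at hi
    rcases hi with ⟨k, hk, rfl⟩ | hi
    · exact Finset.mem_insert_of_mem (Finset.mem_image_of_mem _ (Multiset.mem_toFinset.2 hk))
    · rw [Multiset.eq_of_mem_replicate hi]
      exact Finset.mem_insert_self _ _
  have hinj : Function.Injective fun k : ℕ+ => (k : ℕ) + 1 := fun a b hab =>
    PNat.coe_injective (Nat.succ_injective hab)
  have hone : 1 ∉ μ.map fun k : ℕ+ => (k : ℕ) + 1 := by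
    rw [Multiset.mem_map]
    rintro ⟨k, -, hk⟩
    have := k.pos
    omega
  rw [prod_count_factorial hsub, Finset.prod_insert, Finset.prod_image hinj.injOn]
  · congr 1
    · rw [tildePart, Multiset.count_add, Multiset.count_eq_zero_of_notMem hone,
        Multiset.count_replicate_self, zero_add]
    · refine Finset.prod_congr rfl fun k _ => ?_
      rw [mult_coe, tildePart, Multiset.count_add, Multiset.count_replicate, if_neg, add_zero]
      · congr 1
        exact (Multiset.count_map_eq_count' _ μ hinj k).symm
      · have := k.pos
        omega
  · rw [Finset.mem_image]
    rintro ⟨k, -, hk⟩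
    have := k.pos
    omega

/-- Reversing a list replaces a partial sum by its complement in the total. Positivity of `s` and
`t` keeps the empty prefix, which is not among those tested, out of play. -/
theorem p_symm {μ : Multiset ℕ+} {r s t : ℕ} (h : Multiset.card μ ≤ r) (hs : 0 < s) (ht : 0 < t)
    (hst : s + t = size μ + r) : p μ r s = p μ r t := by
  have key : ∀ {s t : ℕ}, 0 < s → s + t = size μ + r → ∀ l : List ℕ,
      (l : Multiset ℕ) = tildePart μ r → s ∉ (Finset.Icc 1 r).image (fun a => (l.take a).sum) →
      t ∉ (Finset.Icc 1 r).image fun a => (l.reverse.take a).sum := by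
    intro s t hs hst l hl hn hmem
    obtain ⟨a, ha, hat⟩ := Finset.mem_image.1 hmem
    rw [Finset.mem_Icc] at ha
    have hsum : l.sum = size μ + r := by
      rw [← Multiset.sum_coe, hl, sum_tildePart h]
    have hlen : l.length = r := by
      rw [← Multiset.coe_card, hl, card_tildePart h]
    rw [List.take_reverse, List.sum_reverse] at hat
    have h2 := List.sum_take_add_sum_drop l (l.length - a)
    refine hn (Finset.mem_image.2 ⟨l.length - a, ?_, by omega⟩)
    rw [Finset.mem_Icc]
    refine ⟨Nat.pos_of_ne_zero fun h0 => ?_, by omega⟩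
    rw [h0, List.take_zero, List.sum_nil] at h2
    rw [h0] at hat
    omega
  rw [p, p]
  refine Finset.card_bij (fun l _ => l.reverse) ?_ ?_ ?_
  · intro l hl
    rw [Finset.mem_filter, mem_lists_toFinset] at hl ⊢
    exact ⟨by rw [Multiset.coe_reverse, hl.1], key hs hst l hl.1 hl.2⟩
  · intro l _ l' _ he
    exact List.reverse_injective he
  · intro l hl
    rw [Finset.mem_filter, mem_lists_toFinset] at hl
    refine ⟨l.reverse, ?_, List.reverse_reverse l⟩
    rw [Finset.mem_filter, mem_lists_toFinset]
    exact ⟨by rw [Multiset.coe_reverse, hl.1], key ht (by omega) l hl.1 hl.2⟩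

/-- The partition obtained from a multiset of numbers by decreasing them and dropping zeros. -/
def lower (m : Multiset ℕ) : Multiset ℕ+ :=
  m.filterMap fun k : ℕ => if h : 0 < k - 1 then some ((k - 1).toPNat h) else none

theorem lower_cons_one (m : Multiset ℕ) : lower (1 ::ₘ m) = lower m :=
  Multiset.filterMap_cons_none _ _ (by simp)

theorem lower_cons (k : ℕ+) (m : Multiset ℕ) : lower (((k : ℕ) + 1) ::ₘ m) = k ::ₘ lower m := by
  refine Multiset.filterMap_cons_some _ _ _ ?_
  rw [dif_pos (by have := k.pos; omega)]
  congr 1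

theorem lower_tildePart (μ : Multiset ℕ+) (r : ℕ) : lower (tildePart μ r) = μ := by
  rw [tildePart]
  generalize r - Multiset.card μ = j
  induction μ using Multiset.induction with
  | empty =>
    rw [Multiset.map_zero, zero_add]
    induction j with
    | zero => rfl
    | succ j ih => rw [Multiset.replicate_succ, lower_cons_one, ih]
  | cons k μ ih => rw [Multiset.map_cons, Multiset.cons_add, lower_cons, ih]

theorem card_lower_le (m : Multiset ℕ) : Multiset.card (lower m) ≤ Multiset.card m :=
  Quot.inductionOn m fun _ => List.length_filterMap_le _ _

/-- Lowering forgets only how many ones there were, and the number of parts restores this. -/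
theorem tildePart_lower {m : Multiset ℕ} (h : ∀ k ∈ m, 0 < k) :
    tildePart (lower m) (Multiset.card m) = m := by
  induction m using Multiset.induction with
  | empty => rfl
  | cons k m ih =>
    have ih := ih fun i hi => h i (Multiset.mem_cons_of_mem hi)
    have hk := h k (Multiset.mem_cons_self _ _)
    have hle := card_lower_le m
    rcases Nat.lt_or_ge 1 k with h1 | h1
    · obtain ⟨k, rfl⟩ : ∃ j : ℕ+, k = (j : ℕ) + 1 :=
        ⟨⟨k - 1, by omega⟩, by rw [PNat.mk_coe]; omega⟩
      conv_rhs => rw [← ih]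
      rw [lower_cons, tildePart, tildePart, Multiset.card_cons, Multiset.card_cons,
        Multiset.map_cons, Multiset.cons_add, Nat.add_sub_add_right]
    · obtain rfl : k = 1 := by omega
      conv_rhs => rw [← ih]
      rw [lower_cons_one, tildePart, tildePart, Multiset.card_cons, Nat.succ_sub hle,
        Multiset.replicate_succ, Multiset.add_cons]

theorem sum_mcyc_one {Γ : Type*} [Group Γ] {l : List ℕ} (h : ∀ k ∈ l, 0 < k) :
    (l.map fun k => (mcyc k 1 : PType Γ)).sum = singleAt 1 (lower l) := by
  induction l with
  | nil => exact (singleAt_zero 1).symm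
  | cons k l ih =>
    have hk := h k List.mem_cons_self
    rw [List.map_cons, List.sum_cons, ih fun i hi => h i (List.mem_cons_of_mem _ hi), mcyc_id,
      ← Multiset.cons_coe]
    rcases Nat.lt_or_ge 1 k with h1 | h1
    · obtain ⟨k, rfl⟩ : ∃ j : ℕ+, k = (j : ℕ) + 1 :=
        ⟨⟨k - 1, by omega⟩, by rw [PNat.mk_coe]; omega⟩
      rw [lower_cons, ← Multiset.singleton_add, singleAt_add, Nat.add_sub_cancel, cyc_pos k.pos]
      rfl
    · obtain rfl : k = 1 := by omega
      rw [lower_cons_one, Nat.sub_self, cyc_zero, zero_add]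

/-- Compositions with `k` parts, sorted by the partition obtained by lowering the parts. -/
theorem card_compositions (N k : ℕ) (G : List ℕ → Prop) (H : Multiset ℕ+ → Prop)
    [DecidablePred G] [DecidablePred H]
    (M : Finset (Multiset ℕ+)) (hM : ∀ μ ∈ M, Multiset.card μ ≤ k)
    (hH : ∀ μ, Multiset.card μ ≤ k → size μ + k = N → H μ → μ ∈ M) :
    (Finset.univ.filter fun c : Composition N => c.blocks.length = k ∧ G c.blocks ∧
      H (lower c.blocks)).card =
    ∑ μ ∈ M, if size μ + k = N ∧ H μ then
      ((tildePart μ k).lists.toFinset.filter G).card else 0 := by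
  have hdata : ∀ c : Composition N, c.blocks.length = k →
      tildePart (lower c.blocks) k = c.blocks ∧ Multiset.card (lower c.blocks) ≤ k ∧
        size (lower c.blocks) + k = N := fun c hc => by
    have h1 := tildePart_lower (m := (c.blocks : Multiset ℕ)) fun i hi => c.blocks_pos hi
    have h2 := card_lower_le (c.blocks : Multiset ℕ)
    rw [Multiset.coe_card, hc] at h1 h2
    refine ⟨h1, h2, ?_⟩
    rw [← sum_tildePart h2, h1, Multiset.sum_coe, c.blocks_sum]
  -- The fibre over `μ` consists of the rearrangements of `μ̃` that satisfy `G`, provided `μ` has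
  -- the right size and satisfies `H`; otherwise it is empty.
  rw [Finset.card_eq_sum_card_fiberwise (f := fun c : Composition N => lower c.blocks) (t := M)]
  · refine Finset.sum_congr rfl fun μ hμ => ?_
    split_ifs with hcond
    · refine card_eq_of_rel (fun c l => c.blocks = l) ?_ ?_ (fun c l l' h h' => h.symm.trans h')
        (fun c c' l h h' => Composition.ext (h.trans h'.symm))
      · intro c hc
        simp only [Finset.mem_filter, Finset.mem_univ, true_and] at hc
        refine ⟨c.blocks, ?_, rfl⟩
        rw [Finset.mem_filter, mem_lists_toFinset, ← hc.2]
        exact ⟨((hdata c hc.1.1).1).symm, hc.1.2.1⟩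
      · intro l hl
        rw [Finset.mem_filter, mem_lists_toFinset] at hl
        refine ⟨⟨l, fun {i} hi => ?_, ?_⟩, ?_, rfl⟩
        · exact pos_of_mem_tildePart (μ := μ) (r := k) (hl.1 ▸ hi)
        · rw [← Multiset.sum_coe, hl.1, sum_tildePart (hM μ hμ), hcond.1]
        · have hlow : lower (l : Multiset ℕ) = μ := by rw [hl.1, lower_tildePart]
          simp only [Finset.mem_filter, Finset.mem_univ, true_and]
          refine ⟨⟨?_, hl.2, by rw [hlow]; exact hcond.2⟩, hlow⟩
          rw [← Multiset.coe_card, hl.1, card_tildePart (hM μ hμ)]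
    · rw [Finset.card_eq_zero, Finset.filter_eq_empty_iff]
      intro c hc he
      obtain ⟨h1, -, h2⟩ := (Finset.mem_filter.1 hc).2
      obtain ⟨-, -, h3⟩ := hdata c h1
      rw [he] at h2 h3
      exact hcond ⟨h3, h2⟩
  · intro c hc
    obtain ⟨h1, -, h2⟩ := (Finset.mem_filter.1 (Finset.mem_coe.1 hc)).2
    obtain ⟨-, h3, h4⟩ := hdata c h1
    exact hH _ h3 h4 h2

/-! ### Opposite classes and centralizers -/

section Bar

variable {Γ : Type*} [Group Γ]

theorem bar_bar (c : ConjClasses Γ) : bar (bar c) = c := by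
  induction c using Quotient.inductionOn with
  | h g => exact (bar_mk g⁻¹).trans (congrArg ConjClasses.mk (inv_inv g))

theorem bar_one : bar (1 : ConjClasses Γ) = 1 := by
  rw [ConjClasses.one_eq_mk_one, bar_mk, inv_one]

theorem bar_eq_one {c : ConjClasses Γ} : bar c = 1 ↔ c = 1 :=
  ⟨fun h => by rw [← bar_bar c, h, bar_one], fun h => by rw [h, bar_one]⟩

theorem mk_out (c : ConjClasses Γ) : ConjClasses.mk (Quotient.out c) = c := Quotient.out_eq c

/-- The elements that conjugate `u` to `v` become the centralizer of `w` after composing with fixed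
conjugations from `w` to `u` and from `w` to `v`. -/
theorem card_conj_eq {u v w : Γ} (hu : IsConj w u) (hv : IsConj w v) :
    Nat.card {b : Γ // b⁻¹ * u * b = v} = Nat.card (Subgroup.centralizer ({w} : Set Γ)) := by
  obtain ⟨e, he⟩ := isConj_iff.1 hu
  obtain ⟨f, hf⟩ := isConj_iff.1 hv
  refine Nat.card_congr
    { toFun := fun b => ⟨e⁻¹ * b * f, Subgroup.mem_centralizer_singleton_iff.2 ?_⟩
      invFun := fun t => ⟨e * t * f⁻¹, ?_⟩
      left_inv := fun b => Subtype.ext (by simp [mul_assoc])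
      right_inv := fun t => Subtype.ext (by simp [mul_assoc]) }
  · have h := b.2
    have : (b : Γ)⁻¹ * (e * w * e⁻¹) * b * f = f * w := by rw [he, h, ← hf]; group
    calc e⁻¹ * b * f * w = e⁻¹ * b * (f * w) := by group
      _ = e⁻¹ * b * ((b : Γ)⁻¹ * (e * w * e⁻¹) * b * f) := by rw [this]
      _ = w * (e⁻¹ * b * f) := by group
  · have h := Subgroup.mem_centralizer_singleton_iff.1 t.2
    rw [← he, ← hf]
    calc (e * t * f⁻¹)⁻¹ * (e * w * e⁻¹) * (e * t * f⁻¹)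
        = f * (t : Γ)⁻¹ * (w * t) * f⁻¹ := by group
      _ = f * w * f⁻¹ := by rw [← h]; group

theorem zeta_eq {c : ConjClasses Γ} {w : Γ} (h : ConjClasses.mk w = c) :
    zeta c = Nat.card (Subgroup.centralizer ({w} : Set Γ)) := by
  have h1 : IsConj w (Quotient.out c) :=
    ConjClasses.mk_eq_mk_iff_isConj.1 (h.trans (mk_out c).symm)
  rw [zeta, ← card_conj_eq (IsConj.refl _) (IsConj.refl (Quotient.out c)), card_conj_eq h1 h1]

theorem zeta_bar (c : ConjClasses Γ) : zeta (bar c) = zeta c := by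
  have h : ConjClasses.mk (Quotient.out c)⁻¹ = bar c := by rw [← bar_mk, mk_out]
  rw [zeta_eq h, zeta]
  congr 2
  ext t
  rw [Subgroup.mem_centralizer_singleton_iff, Subgroup.mem_centralizer_singleton_iff,
    eq_comm, inv_mul_eq_iff_eq_mul, ← mul_assoc, eq_mul_inv_iff_mul_eq, eq_comm]

end Bar

/-! ### Counting positions and points by class and length -/

section ClassCounts

variable {Γ : Type*} [Group Γ] {n : ℕ}

open Classical in
theorem count_mcyc {L : ℕ} (hL : 0 < L) (C : ConjClasses Γ) {c : ConjClasses Γ} (hc : c ≠ 1)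
    (k : ℕ+) : (mcyc L C c).count k = if C = c ∧ L = k then 1 else 0 := by
  by_cases hC : C = c
  · subst hC
    rw [mcyc_of_ne hc, cyc_self hL, Multiset.count_singleton]
    refine if_congr ⟨fun h => ⟨rfl, (congrArg PNat.val h).symm⟩, fun h => ?_⟩ rfl rfl
    exact PNat.eq h.2.symm
  · rw [if_neg (fun h => hC h.1), mcyc]
    split_ifs
    · rw [cyc_of_ne hc, Multiset.count_zero]
    · rw [cyc_of_ne (Ne.symm hC), Multiset.count_zero]

open Classical in
theorem count_mcyc_one (L : ℕ) (C : ConjClasses Γ) (k : ℕ+) :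
    (mcyc L C 1).count k = if C = 1 ∧ L = k + 1 then 1 else 0 := by
  have hk := k.pos
  by_cases hC : C = 1
  · subst hC
    rw [mcyc_id]
    rcases Nat.eq_zero_or_pos (L - 1) with h0 | h0
    · rw [h0, cyc_zero, if_neg (by omega)]
      exact Multiset.count_zero _
    · rw [cyc_self h0, Multiset.count_singleton]
      refine if_congr ⟨fun h => ⟨rfl, ?_⟩, fun h => PNat.eq ?_⟩ rfl rfl
      · have h1 : (k : ℕ) = L - 1 := congrArg PNat.val h
        omega
      · change (k : ℕ) = L - 1
        omega
  · rw [if_neg (fun h => hC h.1), mcyc_of_ne hC, cyc_of_ne (Ne.symm hC), Multiset.count_zero]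

-- Take multiplicities in `map_mtype`: each position counted contributes `1/l`. The separate
-- parameters `k` and `l` allow for the shift by one at the identity class.
open Classical in
theorem card_filter_cls_len_aux (x : Wreath Γ n) (c : ConjClasses Γ) (k : ℕ+) (l : ℕ) (hl : 0 < l)
    (d : ConjClasses Γ)
    (h : ∀ i, (mcycAt x i c).count k = if cls x i = d ∧ len x i = l then 1 else 0) :
    (Finset.univ.filter fun i => cls x i = d ∧ len x i = l).card = l * (mtype x c).count k := by
  have h1 := map_mtype x (countHom c k)
  change (((mtype x c).count k : ℕ) : ℚ) = ∑ i, (((mcycAt x i c).count k : ℕ) : ℚ) / len x i at h1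
  have hl' : (l : ℚ) ≠ 0 := Nat.cast_ne_zero.2 hl.ne'
  have h2 : ∀ i, (((mcycAt x i c).count k : ℕ) : ℚ) / len x i =
      (if cls x i = d ∧ len x i = l then (1 : ℚ) else 0) / l := fun i => by
    rw [h]
    split_ifs with hi
    · rw [hi.2, Nat.cast_one]
    · simp
  rw [Finset.sum_congr rfl fun i _ => h2 i, ← Finset.sum_div, Finset.sum_boole,
    eq_div_iff hl'] at h1
  have h3 : (((Finset.univ.filter fun i => cls x i = d ∧ len x i = l).card : ℕ) : ℚ) =
      ((l * (mtype x c).count k : ℕ) : ℚ) := by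
    rw [← h1]
    push_cast
    ring
  exact_mod_cast h3

open Classical in
theorem card_filter_cls_len (x : Wreath Γ n) {c : ConjClasses Γ} (hc : c ≠ 1) {k : ℕ} (hk : 0 < k) :
    (Finset.univ.filter fun i => cls x i = c ∧ len x i = k).card = k * mult (mtype x c) k := by
  lift k to ℕ+ using hk
  rw [mult_coe]
  exact card_filter_cls_len_aux x c k k k.pos c fun i => count_mcyc (len_pos x i) _ hc k

open Classical in
theorem card_filter_cls_one_len (x : Wreath Γ n) {k : ℕ} (hk : 0 < k) :
    (Finset.univ.filter fun i => cls x i = 1 ∧ len x i = k + 1).card =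
      (k + 1) * mult (mtype x 1) k := by
  lift k to ℕ+ using hk
  rw [mult_coe]
  exact card_filter_cls_len_aux x 1 k _ (Nat.succ_pos _) 1 fun i => count_mcyc_one _ _ k

theorem sum_points {Γ : Type*} {n : ℕ} [Fintype Γ] (f : Pt Γ n → ℚ) :
    ∑ P, f P = ∑ i, ∑ a, f ⟨a, i⟩ := by
  rw [← (ptEquiv Γ n).symm.sum_comp f, Fintype.sum_prod_type_right]
  rfl

theorem sum_points_pos {Γ : Type*} [Finite Γ] {n : ℕ} (f : Fin n → ℚ) :
    ∑ P : Pt Γ n, f P.pos = Nat.card Γ * ∑ i, f i := by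
  have := Fintype.ofFinite Γ
  rw [sum_points, Finset.mul_sum]
  refine Finset.sum_congr rfl fun i _ => ?_
  simp [Nat.card_eq_fintype_card]

-- The origin of `ζ_c`: changing the `Γ`-coordinate over `j` to `b` conjugates the monodromy by `b`,
-- and the elements conjugating it to the inverse of `mon z P` are counted by a centralizer.
open Classical in
theorem sum_mon_inverse [Fintype Γ] (z : Wreath Γ n) (P : Pt Γ n) (j : Fin n) :
    ∑ b : Γ, (if mon z P * mon z ⟨b, j⟩ = 1 then (1 : ℚ) else 0) =
      if cls z j = bar (cls z P.pos) then (zeta (cls z P.pos) : ℚ) else 0 := by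
  have htr : ∀ b, mon z (⟨b, j⟩ : Pt Γ n) = b⁻¹ * mon z (⟨1, j⟩ : Pt Γ n) * b := fun b => by
    rw [← mon_tr]
    simp [Pt.tr]
  have hcj : ConjClasses.mk (mon z (⟨1, j⟩ : Pt Γ n)) = cls z j := mk_mon z _
  split_ifs with hc
  · rw [← mk_mon, bar_mk] at hc
    have hw : ConjClasses.mk (mon z P)⁻¹ = bar (cls z P.pos) := by rw [← bar_mk, mk_mon]
    rw [← zeta_bar, zeta_eq hw, Finset.sum_boole,
      ← card_conj_eq (u := mon z (⟨1, j⟩ : Pt Γ n)) (v := (mon z P)⁻¹)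
        (ConjClasses.mk_eq_mk_iff_isConj.1 (hc.symm.trans hcj.symm)) (IsConj.refl _),
      Nat.card_eq_fintype_card, Fintype.card_subtype]
    congr 2
    ext b
    rw [Finset.mem_filter, Finset.mem_filter, htr, mul_eq_one_iff_inv_eq, eq_comm]
  · refine Finset.sum_eq_zero fun b _ => if_neg fun h => hc ?_
    have h2 : cls z (⟨b, j⟩ : Pt Γ n).pos = bar (cls z P.pos) := by
      rw [← mk_mon, ← mk_mon, bar_mk, mul_eq_one_iff_inv_eq.1 h]
    exact h2

open Classical in
theorem sum_pairs_right [Finite Γ] (z : Wreath Γ n) (f : Fin n → Fin n → ℚ) (P : Pt Γ n) :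
    ∑ Q : Pt Γ n,
      (if ¬ z.right.SameCycle P.pos Q.pos ∧ mon z P * mon z Q = 1 ∧ mon z P ≠ 1 then
        f P.pos Q.pos else 0) = ∑ j, if ¬ z.right.SameCycle P.pos j ∧
          cls z j = bar (cls z P.pos) ∧ cls z P.pos ≠ 1 then
            zeta (cls z P.pos) * f P.pos j else 0 := by
  have := Fintype.ofFinite Γ
  rw [sum_points]
  refine Finset.sum_congr rfl fun j _ => ?_
  have h1 : (mon z P ≠ 1) = (cls z P.pos ≠ 1) := propext (not_congr mon_eq_one)
  by_cases hs : ¬ z.right.SameCycle P.pos j ∧ cls z P.pos ≠ 1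
  · have h2 : ∀ b : Γ, _ := fun b => if_congr (x := f P.pos j) (y := (0 : ℚ))
      (⟨fun h => h.2.1, fun h => ⟨hs.1, h, h1 ▸ hs.2⟩⟩ :
        (¬ z.right.SameCycle P.pos j ∧ mon z P * mon z ⟨b, j⟩ = 1 ∧ mon z P ≠ 1) ↔
          mon z P * mon z ⟨b, j⟩ = 1) rfl rfl
    refine (Finset.sum_congr rfl fun b _ => h2 b).trans ?_
    have h3 := congrArg (· * f P.pos j) (sum_mon_inverse z P j)
    simp only [Finset.sum_mul, ite_mul, one_mul, zero_mul] at h3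
    refine h3.trans ?_
    by_cases hc : cls z j = bar (cls z P.pos)
    · rw [if_pos hc, if_pos ⟨hs.1, hc, hs.2⟩]
    · rw [if_neg hc, if_neg fun h => hc h.2.1]
  · rw [if_neg fun h => hs ⟨h.1, h.2.2⟩]
    refine Finset.sum_eq_zero fun b _ => if_neg fun h => hs ⟨h.1, h1 ▸ h.2.2⟩

-- Of the two `Γ`-coordinates, that of `P` is free and contributes `|Γ|`, while that of `Q` is bound
-- by the monodromy condition and contributes `ζ_c`.
open Classical in
theorem sum_pairs [Finite Γ] (z : Wreath Γ n) (f : Fin n → Fin n → ℚ) :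
    ∑ P : Pt Γ n, ∑ Q : Pt Γ n,
      (if ¬ z.right.SameCycle P.pos Q.pos ∧ mon z P * mon z Q = 1 ∧ mon z P ≠ 1 then
        f P.pos Q.pos else 0) =
    Nat.card Γ * ∑ i, ∑ j, if ¬ z.right.SameCycle i j ∧ cls z j = bar (cls z i) ∧ cls z i ≠ 1 then
      zeta (cls z i) * f i j else 0 := by
  rw [Finset.sum_congr rfl fun P _ => sum_pairs_right z f P, ← sum_points_pos]

end ClassCounts

/-! ### Elements of prescribed modified type -/

section Existence

variable {Γ : Type*} [Group Γ] {n : ℕ}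

/-- An element of `Γ_n` with prescribed cycles. -/
theorem exists_of_cycles {ι : Type*} [Fintype ι] (k : ι → ℕ) (hk : ∀ q, 0 < k q) (h : ι → Γ)
    (e : (Σ q, Fin (k q)) ≃ Fin n) :
    ∃ z : Wreath Γ n, mtype z = ∑ q, mcyc (k q) (ConjClasses.mk (h q)) := by
  have : ∀ q, NeZero (k q) := fun q => ⟨(hk q).ne'⟩
  let s : Equiv.Perm (Σ q, Fin (k q)) := Equiv.sigmaCongrRight fun q => finRotate (k q)
  -- The whole cycle-product is placed at the index `0` of each block, so it is picked up exactly
  -- when the rotation returns there.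
  let g : (Σ q, Fin (k q)) → Γ := fun w => if (w.2 : ℕ) = 0 then h w.1 else 1
  let z : Wreath Γ n := ⟨fun i => g (e.symm i), (e.symm.trans s).trans e⟩
  have hz : ∀ a w, z • (⟨a, e w⟩ : Pt Γ n) = ⟨g (s w) * a, e (s w)⟩ := fun a w => by
    have h1 : z.right (e w) = e (s w) := by
      change e (s (e.symm (e w))) = e (s w)
      rw [e.symm_apply_apply]
    refine Pt.ext ?_ h1
    rw [smul_val, h1]
    change g (e.symm (e (s w))) * a = _
    rw [e.symm_apply_apply]
  have hrot : ∀ q (j : Fin (k q)), (finRotate (k q) j : ℕ) =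
      if (j : ℕ) + 1 = k q then 0 else (j : ℕ) + 1 := by
    intro q
    have hq := hk q
    generalize k q = N at hq
    obtain ⟨m, rfl⟩ : ∃ m, N = m + 1 := ⟨N - 1, by omega⟩
    intro j
    rw [coe_finRotate]
    refine if_congr ?_ rfl rfl
    rw [Fin.ext_iff, Fin.val_last]
    omega
  have hpow : ∀ q m, ∀ hm : m < k q,
      z ^ m • (⟨1, e ⟨q, ⟨0, hk q⟩⟩⟩ : Pt Γ n) = ⟨1, e ⟨q, ⟨m, hm⟩⟩⟩ := by
    intro q m hm
    induction m with
    | zero => simp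
    | succ m ih =>
      have hs : s ⟨q, ⟨m, by omega⟩⟩ = ⟨q, ⟨m + 1, hm⟩⟩ := by
        change (⟨q, finRotate (k q) ⟨m, by omega⟩⟩ : Σ q, Fin (k q)) = _
        congr 1
        apply Fin.ext
        rw [hrot, if_neg (by dsimp only; omega)]
      rw [pow_succ', mul_smul, ih (by omega), hz, hs]
      simp [g]
  have hret : ∀ q, z ^ k q • (⟨1, e ⟨q, ⟨0, hk q⟩⟩⟩ : Pt Γ n) =
      (⟨1, e ⟨q, ⟨0, hk q⟩⟩⟩ : Pt Γ n).tr (h q) := by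
    intro q
    have hq := hk q
    have hs : s ⟨q, ⟨k q - 1, by omega⟩⟩ = ⟨q, ⟨0, hq⟩⟩ := by
      change (⟨q, finRotate (k q) ⟨k q - 1, by omega⟩⟩ : Σ q, Fin (k q)) = _
      congr 1
      apply Fin.ext
      rw [hrot, if_pos (by dsimp only; omega)]
    obtain ⟨m, hm⟩ : ∃ m, k q = m + 1 := ⟨k q - 1, by omega⟩
    rw [show z ^ k q = z ^ (k q - 1 + 1) by rw [Nat.sub_add_cancel hq], pow_succ', mul_smul,
      hpow q (k q - 1) (by omega), hz, hs]
    simp [g, Pt.tr]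
  have hdata : ∀ w : Σ q, Fin (k q), len z (e w) = k w.1 ∧
      cls z (e w) = ConjClasses.mk (h w.1) := by
    rintro ⟨q, j⟩
    have hl : len z (e ⟨q, ⟨0, hk q⟩⟩) = k q := by
      refine len_eq_of_return (P := (⟨1, e ⟨q, ⟨0, hk q⟩⟩⟩ : Pt Γ n)) (hk q)
        (by rw [hret, Pt.tr_pos]) fun m h0 hm he => ?_
      rw [hpow q m hm] at he
      have := e.injective he
      simp only [Sigma.mk.injEq, heq_eq_eq, true_and, Fin.mk.injEq] at this
      omega
    have hm : mon z (⟨1, e ⟨q, ⟨0, hk q⟩⟩⟩ : Pt Γ n) = h q := mon_eq_of_return (by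
      change z ^ len z (e ⟨q, ⟨0, hk q⟩⟩) • _ = _
      rw [hl, hret])
    have h1 := len_pow_smul z (⟨1, e ⟨q, ⟨0, hk q⟩⟩⟩ : Pt Γ n) j
    have h2 := cls_pow_smul z (⟨1, e ⟨q, ⟨0, hk q⟩⟩⟩ : Pt Γ n) j
    rw [hpow q j j.2] at h1 h2
    refine ⟨h1.trans hl, h2.trans ?_⟩
    rw [← mk_mon, hm]
  refine ⟨z, ptype_ext fun φ => ?_⟩
  rw [map_mtype, map_sum, ← e.sum_comp, Fintype.sum_sigma]
  refine Finset.sum_congr rfl fun q _ => ?_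
  have : ∀ j : Fin (k q), φ (mcycAt z (e ⟨q, j⟩)) / (len z (e ⟨q, j⟩) : ℚ) =
      φ (mcyc (k q) (ConjClasses.mk (h q))) / (k q : ℚ) := fun j => by
    rw [mcycAt, (hdata ⟨q, j⟩).1, (hdata ⟨q, j⟩).2]
  rw [Finset.sum_congr rfl fun j _ => this j, Finset.sum_const, Finset.card_univ, Fintype.card_fin,
    nsmul_eq_mul, mul_div_cancel₀]
  exact Nat.cast_ne_zero.2 (hk q).ne'

theorem sum_cyc_toType (c : ConjClasses Γ) (μ : Multiset ℕ+) :
    ∑ q : μ.ToType, cyc (q.1 : ℕ) c = singleAt c μ := by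
  have h : ∀ μ : Multiset ℕ+, (μ.map fun k : ℕ+ => cyc (k : ℕ) c).sum = singleAt c μ := by
    intro μ
    induction μ using Multiset.induction with
    | empty => exact (singleAt_zero c).symm
    | cons k μ ih =>
      rw [Multiset.map_cons, Multiset.sum_cons, ih, ← Multiset.singleton_add, singleAt_add,
        cyc_pos k.pos]
      rfl
  rw [← h μ]
  conv_rhs => rw [← Multiset.map_univ μ (fun k : ℕ+ => cyc (k : ℕ) c)]
  rfl

/-- Parts at the identity class become cycles longer by one, all other parts keep their length, and
no trivial fixed positions are added. Hence `fhConst` is never read off from the default value of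
`structConst`. -/
theorem exists_mtype [Finite Γ] (ν : PType Γ) :
    ∃ z : Wreath Γ (deg ν + Multiset.card (ν 1)), mtype z = ν := by
  classical
  let ι := Σ c : ConjClasses Γ, (ν c).ToType
  let k : ι → ℕ := fun q => (q.2.1 : ℕ) + if q.1 = 1 then 1 else 0
  have hk : ∀ q, 0 < k q := fun q => Nat.add_pos_left q.2.1.pos _
  have hcard : Fintype.card (Σ q, Fin (k q)) = deg ν + Multiset.card (ν 1) := by
    rw [Fintype.card_sigma]
    simp only [Fintype.card_fin]
    rw [Fintype.sum_sigma]
    simp only [k, Finset.sum_add_distrib]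
    congr 1
    · refine Finset.sum_congr rfl fun c _ => ?_
      rw [size]
      conv_rhs => rw [← Multiset.map_univ (ν c) PNat.val]
      rfl
    · rw [Finset.sum_eq_single 1]
      · simp
      · intro c _ hc
        simp [hc]
      · simp
  obtain ⟨z, hz⟩ := exists_of_cycles (Γ := Γ) k hk (fun q => Quotient.out q.1)
    (Fintype.equivFinOfCardEq hcard)
  refine ⟨z, hz.trans ?_⟩
  rw [Fintype.sum_sigma]
  have h1 : ∀ c, ∑ q : (ν c).ToType, mcyc (k ⟨c, q⟩) (ConjClasses.mk (Quotient.out c)) =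
      singleAt c (ν c) := fun c => by
    rw [← sum_cyc_toType]
    refine Finset.sum_congr rfl fun q _ => ?_
    rw [mk_out]
    by_cases hc : c = 1
    · subst hc
      rw [mcyc_id]
      simp [k]
    · rw [mcyc_of_ne hc]
      simp [k, hc]
  rw [Finset.sum_congr rfl fun c _ => h1 c]
  exact Finset.univ_sum_single ν

end Existence

/-! ### The coefficient as a sum over the positions of `z` -/

section CoeffSum

variable {Γ : Type*} [Group Γ] [Finite Γ] {n : ℕ} {r : ℕ}

open Classical in
/-- The number of ways to split a cycle of length `L` with cycle-product in `C`. -/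
noncomputable def splitCount (lam ν : PType Γ) (r L : ℕ) (C : ConjClasses Γ) : ℕ :=
  (Finset.univ.filter fun c : Composition L => c.blocks.length = r + 1 ∧
    lam + mcyc L C = ν + (∑ j ∈ Finset.range r, mcyc (entry c.blocks j) 1 +
      mcyc (entry c.blocks r) C)).card

open Classical in
/-- The number of ways to merge two cycles of lengths `L`, `L'` with cycle-products in `C`, `C'`. -/
noncomputable def mergeCount (lam ν : PType Γ) (r L L' : ℕ) (C C' : ConjClasses Γ) : ℕ :=
  (Finset.univ.filter fun c : Composition (L + L') => c.blocks.length = r ∧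
    L ∉ (Finset.Icc 1 r).image (fun i => (c.blocks.take i).sum) ∧
    lam + (mcyc L C + mcyc L' C') = ν + (c.blocks.map fun k => mcyc k 1).sum).card

open Classical in
theorem sum_card_split (lam : PType Γ) (hr : 1 ≤ r) (z : Wreath Γ n) (A : Pt Γ n → Prop)
    [DecidablePred A] :
    ∑ y : Wreath Γ n with mtype y = cyc r 1 ∧ mtype (z * y⁻¹) = lam,
      (Finset.univ.filter fun P => Split (z * y⁻¹) y r P ∧ A P).card =
    ∑ P : Pt Γ n, if A P then splitCount lam (mtype z) r (len z P.pos) (cls z P.pos) else 0 := by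
  refine (Finset.sum_card_bipartiteAbove_eq_sum_card_bipartiteBelow
    (fun (y : Wreath Γ n) P => Split (z * y⁻¹) y r P ∧ A P)).trans
    (Finset.sum_congr rfl fun P _ => ?_)
  rw [Finset.bipartiteBelow, Finset.filter_filter]
  split_ifs with hA
  · refine Eq.trans ?_ (card_split lam hr z P)
    simp only [hA, and_true]
  · rw [Finset.card_eq_zero, Finset.filter_eq_empty_iff]
    exact fun y _ h => hA h.2.2

open Classical in
theorem sum_card_merge (lam : PType Γ) (z : Wreath Γ n) :
    ∑ y : Wreath Γ n with mtype y = cyc r 1 ∧ mtype (z * y⁻¹) = lam,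
      (mergeAt (z * y⁻¹) y z r).card =
    ∑ P : Pt Γ n, ∑ Q : Pt Γ n,
      if ¬ z.right.SameCycle P.pos Q.pos ∧ mon z P * mon z Q = 1 ∧ mon z P ≠ 1 then
        mergeCount lam (mtype z) r (len z P.pos) (len z Q.pos) (cls z P.pos) (cls z Q.pos)
      else 0 := by
  refine (Finset.sum_card_bipartiteAbove_eq_sum_card_bipartiteBelow
    (fun (y : Wreath Γ n) (p : Pt Γ n × Pt Γ n) => Merge (z * y⁻¹) y z r p.1 p.2)).trans ?_
  rw [Fintype.sum_prod_type]
  refine Finset.sum_congr rfl fun P _ => Finset.sum_congr rfl fun Q _ => ?_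
  rw [Finset.bipartiteBelow, Finset.filter_filter]
  split_ifs with h
  · exact card_merge lam z P Q h.1 h.2.1 h.2.2
  · rw [Finset.card_eq_zero, Finset.filter_eq_empty_iff]
    intro y _ hy
    obtain ⟨a, d, u, v, hc⟩ := hy.2.exists_mchain (inv_mul_cancel_right z y)
    exact h ⟨hc.disj, hc.mon, hc.mon_ne⟩

-- Each admissible `y` is counted as `1` through `label_count`; then the sums over `y` and over
-- points are interchanged. The factor `|Γ|` from the coordinate of `P` cancels.
open Classical in
theorem coeff_eq_sum (lam : PType Γ) (hr : 1 ≤ r) (z : Wreath Γ n)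
    (hdeg : deg (mtype z) = deg lam + r) :
    (((classSum n lam * classSum n (cyc r 1)).coeff z : ℤ) : ℚ) =
      (∑ i, if cls z i = 1 then
        (splitCount lam (mtype z) r (len z i) (cls z i) : ℚ) else 0) / (r + 1) +
      (∑ i, if cls z i ≠ 1 then
        (splitCount lam (mtype z) r (len z i) (cls z i) : ℚ) else 0) +
      (∑ i, ∑ j, if ¬ z.right.SameCycle i j ∧ cls z j = bar (cls z i) ∧ cls z i ≠ 1 then
        (zeta (cls z i) : ℚ) * mergeCount lam (mtype z) r (len z i) (len z j) (cls z i) (cls z j)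
        else 0) / 2 := by
  have hG : (Nat.card Γ : ℚ) ≠ 0 := Nat.cast_ne_zero.2 Nat.card_pos.ne'
  have hr' : (r + 1 : ℚ) ≠ 0 := by positivity
  have h1 := congrArg (Nat.cast (R := ℚ)) (sum_card_split lam hr z fun P => cls z P.pos = 1)
  have h2 := congrArg (Nat.cast (R := ℚ)) (sum_card_split lam hr z fun P => cls z P.pos ≠ 1)
  have h3 := congrArg (Nat.cast (R := ℚ)) (sum_card_merge (r := r) lam z)
  simp only [Nat.cast_sum, Nat.cast_ite, Nat.cast_zero] at h1 h2 h3
  rw [sum_points_pos (Γ := Γ) fun i => if cls z i = 1 then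
    (splitCount lam (mtype z) r (len z i) (cls z i) : ℚ) else 0] at h1
  rw [sum_points_pos (Γ := Γ) fun i => if cls z i ≠ 1 then
    (splitCount lam (mtype z) r (len z i) (cls z i) : ℚ) else 0] at h2
  rw [sum_pairs z fun i j =>
    (mergeCount lam (mtype z) r (len z i) (len z j) (cls z i) (cls z j) : ℚ)] at h3
  have h4 : ∀ y ∈ Finset.univ.filter fun y : Wreath Γ n =>
      mtype y = cyc r 1 ∧ mtype (z * y⁻¹) = lam, (1 : ℚ) =
      ((splitId (z * y⁻¹) y z r).card : ℚ) / ((r + 1) * Nat.card Γ) +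
      (splitNe (z * y⁻¹) y z r).card / Nat.card Γ +
      (mergeAt (z * y⁻¹) y z r).card / (2 * Nat.card Γ) := fun y hy => by
    obtain ⟨-, hy1, hy2⟩ := Finset.mem_filter.1 hy
    exact (label_count hr (inv_mul_cancel_right z y) hy1 (by rw [hy2, hdeg])).symm
  rw [coeff_classSum_mul, Int.cast_natCast, Finset.cast_card, Finset.sum_congr rfl h4,
    Finset.sum_add_distrib, Finset.sum_add_distrib, ← Finset.sum_div, ← Finset.sum_div,
    ← Finset.sum_div]
  simp only [splitId, splitNe]
  rw [h1, h2, h3]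
  field_simp

end CoeffSum

/-! ### Order and subtraction of partitions -/

section PartitionOrder

theorem mem_subParts {α μ : Multiset ℕ+} {r : ℕ} :
    μ ∈ subParts α r ↔ μ ≤ α ∧ Multiset.card μ ≤ r := by
  rw [subParts, Finset.mem_filter, Finset.mem_Iic]

/-- The added part `k` does not occur in `μ`, so all parts of `μ` are already in `α`. This yields
the conditions of inclusion in `λ`. -/
theorem le_of_add_singleton_eq {α β μ : Multiset ℕ+} {k : ℕ+} (h : α + {k} = β + μ) (hk : k ∉ μ) :
    μ ≤ α := by
  rw [Multiset.le_iff_count]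
  intro i
  have h1 := congrArg (Multiset.count i) h
  rw [Multiset.count_add, Multiset.count_add, Multiset.count_singleton] at h1
  split_ifs at h1 with hi
  · rw [hi, Multiset.count_eq_zero_of_notMem hk]
    exact Nat.zero_le _
  · omega

variable {Γ : Type*} [Group Γ]

theorem eq_tsub_iff {ν X Y : PType Γ} (h : Y ≤ X) : ν = X - Y ↔ X = ν + Y := by
  constructor
  · rintro rfl
    funext c
    exact (tsub_add_cancel_of_le (h c)).symm
  · rintro rfl
    funext c
    exact (add_tsub_cancel_right (ν c) (Y c)).symm

theorem singleAt_le {lam : PType Γ} {c : ConjClasses Γ} {μ : Multiset ℕ+} (h : μ ≤ lam c) :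
    singleAt c μ ≤ lam := by
  intro d
  by_cases hd : d = c
  · subst hd
    rwa [singleAt_self]
  · rw [singleAt_of_ne hd]
    exact Multiset.zero_le _

theorem singleAt_add_cyc_le {lam : PType Γ} {c : ConjClasses Γ} (hc : c ≠ 1) {μ : Multiset ℕ+}
    {k : ℕ+} (h : μ ≤ lam 1) (hk : k ∈ lam c) : singleAt 1 μ + cyc k c ≤ lam := by
  intro d
  rw [Pi.add_apply]
  by_cases hd : d = c
  · subst hd
    rw [singleAt_of_ne hc, cyc_self k.pos, zero_add, Multiset.singleton_le]
    exact hk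
  · rw [cyc_of_ne hd, add_zero]
    exact singleAt_le h d

end PartitionOrder

/-! ### Compositions sorted by the partition `μ` -/

section Evaluation

variable {Γ : Type*} [Group Γ] [Finite Γ] {r : ℕ}

theorem sum_map_entry {M : Type*} [AddCommMonoid M] (f : ℕ → M) {l : List ℕ}
    (h : l.length = r + 1) :
    ∑ j ∈ Finset.range r, f (entry l j) + f (entry l r) = (l.map f).sum := by
  rw [← Finset.sum_range_succ fun j => f (entry l j)]
  conv_rhs => rw [← map_range_entry l, h, List.map_map, sum_map_range]
  rfl

open Classical in
theorem splitCount_one (lam ν : PType Γ) (hr : 1 ≤ r) (L : ℕ) :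
    splitCount lam ν r L 1 = ∑ μ ∈ subParts (lam 1) (r + 1),
      if size μ + (r + 1) = L ∧ lam + cyc (L - 1) 1 = ν + singleAt 1 μ then
        rearr μ (r + 1) else 0 := by
  have h := card_compositions L (r + 1) (fun _ => True)
    (fun μ => lam + cyc (L - 1) 1 = ν + singleAt 1 μ) (subParts (lam 1) (r + 1))
    (fun μ hμ => (mem_subParts.1 hμ).2) (fun μ h1 h2 h3 => mem_subParts.2 ⟨?_, h1⟩)
  · rw [splitCount, mcyc_id]
    refine Eq.trans (congrArg Finset.card (Finset.filter_congr fun c _ => ?_))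
      (h.trans (Finset.sum_congr rfl fun μ _ => ?_))
    · refine and_congr_right fun hc => ?_
      rw [sum_map_entry (fun k => (mcyc k 1 : PType Γ)) hc, true_and,
        sum_mcyc_one fun i hi => c.blocks_pos hi]
    · simp only [Finset.filter_true, rearr]
  · have h4 := congrFun h3 1
    rw [Pi.add_apply, Pi.add_apply, singleAt_self, cyc_self (by omega)] at h4
    -- The part `L - 1 = ‖μ‖ + r` exceeds every part of `μ` because `r ≥ 1`.
    refine le_of_add_singleton_eq h4 fun hmem => ?_
    have h5 := le_size hmem
    change L - 1 ≤ size μ at h5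
    omega

open Classical in
theorem mergeCount_eq (lam ν : PType Γ) (r L L' : ℕ) {C C' : ConjClasses Γ} (hC : C ≠ 1)
    (hC' : C' ≠ 1) :
    mergeCount lam ν r L L' C C' = ∑ μ ∈ subParts (lam 1) r,
      if size μ + r = L + L' ∧ lam + (cyc L C + cyc L' C') = ν + singleAt 1 μ then
        p μ r L else 0 := by
  have h := card_compositions (L + L') r
    (fun l => L ∉ (Finset.Icc 1 r).image (fun i => (l.take i).sum))
    (fun μ => lam + (cyc L C + cyc L' C') = ν + singleAt 1 μ) (subParts (lam 1) r)
    (fun μ hμ => (mem_subParts.1 hμ).2) (fun μ h1 h2 h3 => mem_subParts.2 ⟨?_, h1⟩)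
  · rw [mergeCount, mcyc_of_ne hC, mcyc_of_ne hC']
    refine Eq.trans (congrArg Finset.card (Finset.filter_congr fun c _ => ?_))
      (h.trans (Finset.sum_congr rfl fun μ _ => ?_))
    · rw [sum_mcyc_one fun i hi => c.blocks_pos hi]
    · rw [p]
  · have h4 := congrFun h3 1
    rw [Pi.add_apply, Pi.add_apply, Pi.add_apply, singleAt_self, cyc_of_ne hC.symm,
      cyc_of_ne hC'.symm, add_zero, add_zero] at h4
    rw [h4]
    exact Multiset.le_add_left _ _

-- The last arc carries the nontrivial product and stays an unlowered part `k` of `λ(C)`; only the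
-- first `r` arcs are lowered to `μ`.
open Classical in
theorem splitCount_of_ne (lam ν : PType Γ) (hr : 1 ≤ r) (L : ℕ) {C : ConjClasses Γ} (hC : C ≠ 1) :
    splitCount lam ν r L C = ∑ μ ∈ subParts (lam 1) r, ∑ k ∈ (lam C).toFinset,
      if size μ + r + k = L ∧ lam + cyc L C = ν + (singleAt 1 μ + cyc k C) then
        rearr μ r else 0 := by
  set f : Composition L → Multiset ℕ+ × ℕ+ := fun c =>
    (lower (c.blocks.dropLast : Multiset ℕ), (entry c.blocks r).toPNat') with hf
  have hdata : ∀ c : Composition L, c.blocks.length = r + 1 → ∃ (l : List ℕ) (k : ℕ+),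
      c.blocks = l ++ [(k : ℕ)] ∧ f c = (lower l, k) ∧ tildePart (lower l) r = l ∧
      Multiset.card (lower l) ≤ r ∧ size (lower l) + r + k = L ∧
      ∑ j ∈ Finset.range r, (mcyc (entry c.blocks j) 1 : PType Γ) + mcyc (entry c.blocks r) C =
        singleAt 1 (lower l) + cyc k C := fun c hc => by
    obtain ⟨l, k, h, hl, hpos⟩ : ∃ (l : List ℕ) (k : ℕ+), c.blocks = l ++ [(k : ℕ)] ∧
        l.length = r ∧ (∀ i ∈ l, 0 < i) := by
      rcases List.eq_nil_or_concat c.blocks with h | ⟨l, k, h⟩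
      · rw [h, List.length_nil] at hc
        omega
      · rw [List.concat_eq_append] at h
        refine ⟨l, ⟨k, c.blocks_pos (by rw [h]; simp)⟩, h, ?_,
          fun i hi => c.blocks_pos (by rw [h]; simp [hi])⟩
        rw [h] at hc
        simpa using hc
    have h1 : ∀ j ∈ Finset.range r, (mcyc (entry (l ++ [(k : ℕ)]) j) 1 : PType Γ) =
        mcyc (entry l j) 1 := fun j hj => by
      rw [entry, entry, List.getD_append _ _ _ _ (by rw [hl]; exact Finset.mem_range.1 hj)]
    have h2 : entry (l ++ [(k : ℕ)]) r = k := by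
      rw [entry, List.getD_append_right _ _ _ _ hl.le, hl, Nat.sub_self]
      rfl
    have h3 := tildePart_lower (m := (l : Multiset ℕ)) hpos
    have h4 := card_lower_le (l : Multiset ℕ)
    rw [Multiset.coe_card, hl] at h3 h4
    refine ⟨l, k, h, ?_, h3, h4, ?_, ?_⟩
    · rw [hf]
      dsimp only
      rw [h, List.dropLast_concat, h2, PNat.coe_toPNat']
    · rw [← sum_tildePart h4, h3, Multiset.sum_coe, ← c.blocks_sum, h, List.sum_append,
        List.sum_singleton]
    · rw [h, Finset.sum_congr rfl h1, h2, mcyc_of_ne hC, ← sum_mcyc_one hpos]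
      conv_rhs => rw [← map_range_entry l, hl, List.map_map, sum_map_range]
      rfl
  rw [splitCount, ← Finset.sum_product', Finset.card_eq_sum_card_fiberwise
    (f := f) (t := subParts (lam 1) r ×ˢ (lam C).toFinset)]
  · refine Finset.sum_congr rfl ?_
    rintro ⟨μ, k⟩ hμk
    have hcard := (mem_subParts.1 (Finset.mem_product.1 hμk).1).2
    dsimp only at hcard ⊢
    split_ifs with hcond
    · refine card_eq_of_rel (fun c l => c.blocks = l ++ [(k : ℕ)]) ?_ ?_
        (fun c l l' h h' => List.append_cancel_right (h.symm.trans h'))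
        (fun c c' l h h' => Composition.ext (h.trans h'.symm))
      · intro c hc
        obtain ⟨hc, hfc⟩ := Finset.mem_filter.1 hc
        obtain ⟨l, k', h1, h2, h3, -⟩ := hdata c (Finset.mem_filter.1 hc).2.1
        obtain ⟨rfl, rfl⟩ := Prod.mk.inj (h2.symm.trans hfc)
        exact ⟨l, mem_lists_toFinset.2 h3.symm, h1⟩
      · intro l hl
        rw [mem_lists_toFinset] at hl
        let c : Composition L :=
          { blocks := l ++ [(k : ℕ)]
            blocks_pos := fun {i} hi => by
              rw [List.mem_append, List.mem_singleton] at hi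
              rcases hi with hi | rfl
              · exact pos_of_mem_tildePart (μ := μ) (r := r) (hl ▸ hi)
              · exact k.pos
            blocks_sum := by
              rw [List.sum_append, List.sum_singleton, ← Multiset.sum_coe, hl, sum_tildePart hcard,
                hcond.1] }
        have hlen : c.blocks.length = r + 1 := by
          rw [List.length_append, ← Multiset.coe_card, hl, card_tildePart hcard,
            List.length_singleton]
        obtain ⟨l', k', h1, h2, h3, -, -, h4⟩ := hdata c hlen
        obtain ⟨rfl, h5⟩ := List.append_inj' h1 rfl
        obtain rfl : k = k' := PNat.eq (List.singleton_injective h5)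
        have hlow : lower (l : Multiset ℕ) = μ := by rw [hl, lower_tildePart]
        refine ⟨c, Finset.mem_filter.2 ⟨Finset.mem_filter.2 ⟨Finset.mem_univ _, hlen, ?_⟩, ?_⟩, rfl⟩
        · rw [h4, hlow, mcyc_of_ne hC]
          exact hcond.2
        · rw [h2, hlow]
    · rw [Finset.card_eq_zero, Finset.filter_eq_empty_iff]
      intro c hc hfc
      obtain ⟨-, hlen, hc⟩ := Finset.mem_filter.1 hc
      obtain ⟨l, k', -, h2, -, -, h3, h4⟩ := hdata c hlen
      obtain ⟨rfl, rfl⟩ := Prod.mk.inj (h2.symm.trans hfc)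
      rw [h4, mcyc_of_ne hC] at hc
      exact hcond ⟨h3, hc⟩
  · intro c hc
    obtain ⟨-, hlen, hc⟩ := Finset.mem_filter.1 (Finset.mem_coe.1 hc)
    obtain ⟨l, k, -, h2, -, h3, h4, h5⟩ := hdata c hlen
    rw [h5, mcyc_of_ne hC] at hc
    have h6 := congrFun hc 1
    have h7 := congrFun hc C
    rw [Pi.add_apply, Pi.add_apply, Pi.add_apply, singleAt_self, cyc_of_ne hC.symm,
      cyc_of_ne hC.symm, add_zero, add_zero] at h6
    rw [Pi.add_apply, Pi.add_apply, Pi.add_apply, singleAt_of_ne hC, zero_add,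
      cyc_self (by omega), cyc_self k.pos] at h7
    rw [Finset.mem_coe, h2, Finset.mem_product, mem_subParts, Multiset.mem_toFinset]
    refine ⟨⟨by rw [h6]; exact Multiset.le_add_left _ _, h3⟩, ?_⟩
    -- The new part `L = ‖μ‖ + r + k` is larger than `k` since `r ≥ 1`, so `k` must already be a
    -- part of `λ(C)`.
    refine Multiset.singleton_le.1 (le_of_add_singleton_eq h7 ?_)
    rw [Multiset.mem_singleton]
    intro he
    have h8 : L = (k : ℕ) := congrArg PNat.val he
    omega

end Evaluation

/-! ### Multiplicities and index sets -/

section Multiplicities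

theorem mult_eq_zero {μ : Multiset ℕ+} {s : ℕ} (h : size μ < s) : mult μ s = 0 := by
  rw [mult, Multiset.count_eq_zero, Multiset.mem_map]
  rintro ⟨k, hk, rfl⟩
  exact absurd (le_size hk) (by rw [not_le]; exact h)

theorem rearr_eq_div {μ : Multiset ℕ+} {r : ℕ} (h : Multiset.card μ ≤ r) :
    (rearr μ r : ℚ) = r.factorial / ((r - Multiset.card μ).factorial * multFact μ : ℕ) := by
  have h1 := factorial_mul_multFact_mul_rearr h
  have h2 : (((r - Multiset.card μ).factorial * multFact μ : ℕ) : ℚ) ≠ 0 := by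
    intro h0
    rw [Nat.cast_eq_zero.1 h0, zero_mul] at h1
    exact r.factorial_ne_zero h1.symm
  rw [eq_div_iff h2, ← h1]
  push_cast
  ring

variable {Γ : Type*} [Group Γ]

open Classical in
theorem mult_cyc {k : ℕ} (hk : 0 < k) (c d : ConjClasses Γ) (j : ℕ) :
    mult (cyc k c d) j = if d = c ∧ j = k then 1 else 0 := by
  by_cases hd : d = c
  · subst hd
    rw [cyc_self hk, mult, Multiset.map_singleton, Multiset.count_singleton,
      show ((k.toPNat hk : ℕ+) : ℕ) = k from rfl]
    simp only [true_and]
  · rw [cyc_of_ne hd, if_neg fun h => hd h.1]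
    rfl

variable [Finite Γ]

theorem mem_nonIdClasses {c : ConjClasses Γ} : c ∈ nonIdClasses Γ ↔ c ≠ 1 := by
  rw [nonIdClasses, Set.Finite.mem_toFinset]
  rfl

theorem mem_realClasses {c : ConjClasses Γ} : c ∈ realClasses Γ ↔ bar c = c ∧ c ≠ 1 := by
  rw [realClasses, Set.Finite.mem_toFinset]
  rfl

theorem mem_complexPairs {e : Sym2 (ConjClasses Γ)} :
    e ∈ complexPairs Γ ↔ ∃ c, c ≠ bar c ∧ e = s(c, bar c) := by
  rw [complexPairs, Set.Finite.mem_toFinset]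
  rfl

end Multiplicities

/-! ### The sums over splittings, `I₁` and `I₂` -/

section SplitTerms

variable {Γ : Type*} [Group Γ] {n : ℕ} {r : ℕ}

open Classical in
theorem sum_ite_cls_len (z : Wreath Γ n) (c : ConjClasses Γ) (s : ℕ) (q : ℚ) :
    ∑ i, (if cls z i = c ∧ len z i = s then q else 0) =
      (Finset.univ.filter fun i => cls z i = c ∧ len z i = s).card * q := by
  rw [← Finset.sum_filter, Finset.sum_const, nsmul_eq_mul]

variable [Finite Γ]

open Classical in
theorem sum_by_cls (z : Wreath Γ n) (F : Fin n → ConjClasses Γ → ℚ) :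
    ∑ i, (if cls z i ≠ 1 then F i (cls z i) else 0) =
      ∑ c ∈ nonIdClasses Γ, ∑ i, if cls z i = c then F i c else 0 := by
  rw [Finset.sum_comm]
  refine Finset.sum_congr rfl fun i _ => ?_
  rw [Finset.sum_ite_eq]
  simp only [mem_nonIdClasses]

open Classical in
/-- The contribution of the splittings of cycles with cycle-product `1`. -/
noncomputable def splitIdTerm (lam : PType Γ) (r : ℕ) : PType Γ → ℚ :=
  ∑ μ ∈ subParts (lam 1) (r + 1), Pi.single (lam + cyc (size μ + r) 1 - singleAt 1 μ)
    ((((mult (lam 1) (size μ + r) + 1) * (size μ + r + 1) * r.factorial : ℕ) : ℚ) /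
      (((r + 1 - Multiset.card μ).factorial * multFact μ : ℕ) : ℚ))

open Classical in
/-- The contribution of the splittings of cycles with cycle-product different from `1`. -/
noncomputable def splitNeTerm (lam : PType Γ) (r : ℕ) : PType Γ → ℚ :=
  ∑ c ∈ nonIdClasses Γ, ∑ μ ∈ subParts (lam 1) r, ∑ k ∈ (lam c).toFinset,
    Pi.single (lam + cyc (size μ + r + k) c - (singleAt 1 μ + cyc k c))
      ((((mult (lam c) (size μ + r + k) + 1) * (size μ + r + k) * r.factorial : ℕ) : ℚ) /
        (((r - Multiset.card μ).factorial * multFact μ : ℕ) : ℚ))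

-- The factor `‖μ‖ + r + 1` counts the positions in one cycle, the multiplicity counts the cycles,
-- and the division by `r + 1` reduces the `(r + 1)!` of the rearrangements to `r!`.
open Classical in
theorem sum_split_one (lam : PType Γ) (hr : 1 ≤ r) (z : Wreath Γ n) :
    (∑ i, if cls z i = 1 then
      (splitCount lam (mtype z) r (len z i) (cls z i) : ℚ) else 0) / (r + 1) =
    splitIdTerm lam r (mtype z) := by
  have h1 : ∀ i, (if cls z i = 1 then
      (splitCount lam (mtype z) r (len z i) (cls z i) : ℚ) else 0) =
      ∑ μ ∈ subParts (lam 1) (r + 1), if cls z i = 1 ∧ len z i = size μ + r + 1 then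
        (if lam + cyc (size μ + r) 1 = mtype z + singleAt 1 μ then (rearr μ (r + 1) : ℚ) else 0)
        else 0 := fun i => by
    by_cases hi : cls z i = 1
    · rw [if_pos hi, hi, splitCount_one lam _ hr, Nat.cast_sum]
      refine Finset.sum_congr rfl fun μ _ => ?_
      by_cases hl : len z i = size μ + r + 1
      · rw [hl]
        simp [add_assoc]
      · rw [if_neg fun h => hl h.1.symm, if_neg fun h => hl h.2, Nat.cast_zero]
    · rw [if_neg hi]
      exact (Finset.sum_eq_zero fun μ _ => if_neg fun h => hi h.1).symm
  have hr' : (r + 1 : ℚ) ≠ 0 := by positivity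
  rw [Finset.sum_congr rfl fun i _ => h1 i, Finset.sum_comm, Finset.sum_div, splitIdTerm,
    Finset.sum_apply]
  refine Finset.sum_congr rfl fun μ hμ => ?_
  obtain ⟨hle, hcard⟩ := mem_subParts.1 hμ
  have hle' : singleAt 1 μ ≤ lam + cyc (size μ + r) 1 :=
    (singleAt_le hle).trans fun c => Multiset.le_add_right _ _
  rw [sum_ite_cls_len, Pi.single_apply]
  by_cases hH : lam + cyc (size μ + r) 1 = mtype z + singleAt 1 μ
  · have hm := congrArg (fun ρ : PType Γ => mult (ρ 1) (size μ + r)) hH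
    simp only [Pi.add_apply, mult_add] at hm
    rw [mult_cyc (by omega), if_pos ⟨rfl, rfl⟩, singleAt_self,
      mult_eq_zero (μ := μ) (by omega)] at hm
    rw [if_pos hH, if_pos ((eq_tsub_iff hle').2 hH), card_filter_cls_one_len z (by omega),
      rearr_eq_div hcard, ← Nat.add_zero (mult (mtype z 1) _), ← hm, Nat.factorial_succ]
    push_cast
    field_simp
  · rw [if_neg hH, if_neg fun h => hH ((eq_tsub_iff hle').1 h), mul_zero, zero_div]

open Classical in
theorem sum_split_ne (lam : PType Γ) (hr : 1 ≤ r) (z : Wreath Γ n) :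
    (∑ i, if cls z i ≠ 1 then
      (splitCount lam (mtype z) r (len z i) (cls z i) : ℚ) else 0) =
    splitNeTerm lam r (mtype z) := by
  rw [sum_by_cls z fun i c => (splitCount lam (mtype z) r (len z i) c : ℚ), splitNeTerm,
    Finset.sum_apply]
  refine Finset.sum_congr rfl fun c hc => ?_
  have hc := mem_nonIdClasses.1 hc
  have h1 : ∀ i, (if cls z i = c then (splitCount lam (mtype z) r (len z i) c : ℚ) else 0) =
      ∑ μ ∈ subParts (lam 1) r, ∑ k ∈ (lam c).toFinset,
        if cls z i = c ∧ len z i = size μ + r + k then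
          (if lam + cyc (size μ + r + k) c = mtype z + (singleAt 1 μ + cyc k c) then
            (rearr μ r : ℚ) else 0) else 0 := fun i => by
    by_cases hi : cls z i = c
    · rw [if_pos hi, splitCount_of_ne lam _ hr _ hc, Nat.cast_sum]
      refine Finset.sum_congr rfl fun μ _ => ?_
      rw [Nat.cast_sum]
      refine Finset.sum_congr rfl fun k _ => ?_
      by_cases hl : len z i = size μ + r + k
      · rw [hl]
        simp [hi]
      · rw [if_neg fun h => hl h.1.symm, if_neg fun h => hl h.2, Nat.cast_zero]
    · rw [if_neg hi]
      exact (Finset.sum_eq_zero fun μ _ => Finset.sum_eq_zero fun k _ =>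
        if_neg fun h => hi h.1).symm
  rw [Finset.sum_congr rfl fun i _ => h1 i, Finset.sum_comm, Finset.sum_apply]
  refine Finset.sum_congr rfl fun μ hμ => ?_
  rw [Finset.sum_comm, Finset.sum_apply]
  refine Finset.sum_congr rfl fun k hk => ?_
  obtain ⟨hle, hcard⟩ := mem_subParts.1 hμ
  have hk0 := k.pos
  have hle' : singleAt 1 μ + cyc k c ≤ lam + cyc (size μ + r + k) c :=
    (singleAt_add_cyc_le hc hle (Multiset.mem_toFinset.1 hk)).trans
      fun c => Multiset.le_add_right _ _
  rw [sum_ite_cls_len, Pi.single_apply]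
  by_cases hH : lam + cyc (size μ + r + k) c = mtype z + (singleAt 1 μ + cyc k c)
  · have hm := congrArg (fun ρ : PType Γ => mult (ρ c) (size μ + r + k)) hH
    simp only [Pi.add_apply, mult_add] at hm
    rw [mult_cyc (by omega), if_pos ⟨rfl, rfl⟩, singleAt_of_ne hc, mult_cyc hk0,
      if_neg (by omega), show mult 0 (size μ + r + k) = 0 from rfl] at hm
    rw [if_pos hH, if_pos ((eq_tsub_iff hle').2 hH), card_filter_cls_len z hc (by omega),
      rearr_eq_div hcard, ← Nat.add_zero (mult (mtype z c) _), ← hm]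
    push_cast
    ring
  · rw [if_neg hH, if_neg fun h => hH ((eq_tsub_iff hle').1 h), mul_zero]

end SplitTerms

/-! ### Pairs of positions in different cycles -/

section Pairs

variable {Γ : Type*} [Group Γ] {n : ℕ}

open Classical in
/-- The number of pairs of positions in different cycles of `z`, of the lengths `s` and with
cycle-products in `c` and `c̄`. -/
noncomputable def pairCount (z : Wreath Γ n) (c : ConjClasses Γ) (s : ℕ × ℕ) : ℚ :=
  ∑ i, ∑ j, if ¬ z.right.SameCycle i j ∧ (cls z i = c ∧ len z i = s.1) ∧
    (cls z j = bar c ∧ len z j = s.2) then 1 else 0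

theorem pairCount_bar (z : Wreath Γ n) (c : ConjClasses Γ) (s : ℕ × ℕ) :
    pairCount z (bar c) s = pairCount z c s.swap := by
  classical
  rw [pairCount, pairCount, Finset.sum_comm]
  refine Finset.sum_congr rfl fun j _ => Finset.sum_congr rfl fun i _ => ?_
  refine if_congr ?_ rfl rfl
  rw [bar_bar, Equiv.Perm.sameCycle_comm, and_comm (a := cls z i = bar c ∧ _)]
  rfl

theorem pairCount_eq_zero (z : Wreath Γ n) (c : ConjClasses Γ) {s : ℕ × ℕ}
    (h : s.1 = 0 ∨ s.2 = 0) : pairCount z c s = 0 := by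
  rw [pairCount]
  refine Finset.sum_eq_zero fun i _ => Finset.sum_eq_zero fun j _ => if_neg fun hij => ?_
  have h1 := len_pos z i
  have h2 := len_pos z j
  omega

/-- A difference in class or in length already places the two positions in different cycles, so the
count is a product. -/
theorem pairCount_of_ne (z : Wreath Γ n) {c : ConjClasses Γ} (hc : c ≠ 1) {s t : ℕ} (hs : 0 < s)
    (ht : 0 < t) (h : c ≠ bar c ∨ s ≠ t) :
    pairCount z c (s, t) = (s * mult (mtype z c) s : ℕ) * (t * mult (mtype z (bar c)) t : ℕ) := by
  classical
  rw [← card_filter_cls_len z hc hs, ← card_filter_cls_len z (fun h => hc (bar_eq_one.1 h)) ht,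
    Finset.card_filter, Finset.card_filter, Nat.cast_sum, Nat.cast_sum, Finset.sum_mul_sum]
  refine Finset.sum_congr rfl fun i _ => Finset.sum_congr rfl fun j _ => ?_
  rw [← Nat.cast_mul, ite_zero_mul_ite_zero, one_mul, Nat.cast_ite, Nat.cast_one, Nat.cast_zero]
  refine if_congr ⟨fun hij => hij.2, fun hij => ⟨fun hsame => ?_, hij⟩⟩ rfl rfl
  rcases h with h | h
  · exact h ((hij.1.1.symm.trans (cls_eq_of_sameCycle hsame).symm).trans hij.2.1)
  · exact h (by rw [← hij.1.2, ← hij.2.2, len_eq_of_sameCycle hsame])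

/-- For each first position, the `s` positions of its own cycle have to be left out. -/
theorem pairCount_of_eq (z : Wreath Γ n) {c : ConjClasses Γ} (hc : c ≠ 1) (hbar : bar c = c)
    {s : ℕ} (hs : 0 < s) :
    pairCount z c (s, s) = (s * mult (mtype z c) s : ℕ) * ((s * mult (mtype z c) s : ℕ) - s) := by
  classical
  have key : ∀ i, cls z i = c ∧ len z i = s →
      ∑ j, (if ¬ z.right.SameCycle i j ∧ (cls z i = c ∧ len z i = s) ∧
        (cls z j = c ∧ len z j = s) then (1 : ℚ) else 0) =
      ((Finset.univ.filter fun i => cls z i = c ∧ len z i = s).card : ℚ) - s := by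
    intro i hi
    have h1 : ∀ j, (if ¬ z.right.SameCycle i j ∧ (cls z i = c ∧ len z i = s) ∧
        (cls z j = c ∧ len z j = s) then (1 : ℚ) else 0) =
        (if cls z j = c ∧ len z j = s then 1 else 0) - if z.right.SameCycle i j then 1 else 0 := by
      intro j
      by_cases hs : z.right.SameCycle i j
      · have h2 : cls z j = c ∧ len z j = s :=
          ⟨(cls_eq_of_sameCycle hs).trans hi.1, (len_eq_of_sameCycle hs).trans hi.2⟩
        simp [hs, h2]
      · simp [hs, hi]
    rw [Finset.sum_congr rfl fun j _ => h1 j, Finset.sum_sub_distrib, Finset.sum_boole,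
      Finset.sum_boole, card_sameCycle, hi.2]
  rw [← card_filter_cls_len z hc hs, pairCount]
  simp only [hbar]
  have h2 : ∀ i, _ = (if cls z i = c ∧ len z i = s then
      ((Finset.univ.filter fun i => cls z i = c ∧ len z i = s).card : ℚ) - s else 0) := fun i => by
    split_ifs with hi
    · exact key i hi
    · exact Finset.sum_eq_zero fun j _ => if_neg fun h => hi h.2.1
  rw [Finset.sum_congr rfl fun i _ => h2 i, sum_ite_cls_len]

end Pairs

/-! ### The merge sum by class, partition and lengths -/

section MergeTerms

variable {Γ : Type*} [Group Γ] [Finite Γ] {n : ℕ} {r : ℕ}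

open Classical in
/-- The contribution of the pairs of cycles of the lengths `s` with cycle-products in `c`, `c̄`
whose merging involves the partition `μ`. -/
noncomputable def mergeWeight (lam : PType Γ) (r : ℕ) (z : Wreath Γ n) (c : ConjClasses Γ)
    (μ : Multiset ℕ+) (s : ℕ × ℕ) : ℚ :=
  zeta c * (if lam + (cyc s.1 c + cyc s.2 (bar c)) = mtype z + singleAt 1 μ then
    (p μ r s.1 : ℚ) else 0) * pairCount z c s

/-- This is the exchange of the two cycles; `p` is invariant by `p_symm`. The latter needs positive
lengths, but at length `0` both sides vanish. -/
theorem mergeWeight_bar (lam : PType Γ) (z : Wreath Γ n) (c : ConjClasses Γ) {μ : Multiset ℕ+}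
    (h : Multiset.card μ ≤ r) {s : ℕ × ℕ} (hs : s.1 + s.2 = size μ + r) :
    mergeWeight lam r z (bar c) μ s = mergeWeight lam r z c μ s.swap := by
  rw [mergeWeight, mergeWeight, pairCount_bar, zeta_bar, bar_bar]
  by_cases h0 : s.2 = 0 ∨ s.1 = 0
  · rw [pairCount_eq_zero z c (s := s.swap) h0, mul_zero, mul_zero]
  · rw [p_symm h (t := s.2) (by omega) (by omega) hs, add_comm (cyc s.1 (bar c))]
    rfl

open Classical in
theorem sum_merge (lam : PType Γ) (z : Wreath Γ n) :
    (∑ i, ∑ j, if ¬ z.right.SameCycle i j ∧ cls z j = bar (cls z i) ∧ cls z i ≠ 1 then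
      (zeta (cls z i) : ℚ) * mergeCount lam (mtype z) r (len z i) (len z j) (cls z i) (cls z j)
      else 0) =
    ∑ c ∈ nonIdClasses Γ, ∑ μ ∈ subParts (lam 1) r,
      ∑ s ∈ Finset.HasAntidiagonal.antidiagonal (size μ + r), mergeWeight lam r z c μ s := by
  have h0 : ∀ i, (∑ j, if ¬ z.right.SameCycle i j ∧ cls z j = bar (cls z i) ∧ cls z i ≠ 1 then
      (zeta (cls z i) : ℚ) * mergeCount lam (mtype z) r (len z i) (len z j) (cls z i) (cls z j)
      else 0) = if cls z i ≠ 1 then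
        (fun i c => ∑ j, if ¬ z.right.SameCycle i j ∧ cls z j = bar c then
        (zeta c : ℚ) * mergeCount lam (mtype z) r (len z i) (len z j) c (bar c)
        else 0) i (cls z i) else 0 := fun i => by
    split_ifs with hi
    · refine Finset.sum_congr rfl fun j _ => ?_
      by_cases hj : ¬ z.right.SameCycle i j ∧ cls z j = bar (cls z i)
      · rw [if_pos ⟨hj.1, hj.2, hi⟩, if_pos hj, hj.2]
      · rw [if_neg fun h => hj ⟨h.1, h.2.1⟩, if_neg hj]
    · exact Finset.sum_eq_zero fun j _ => if_neg fun h => hi h.2.2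
  refine ((Finset.sum_congr rfl fun i _ => h0 i).trans (sum_by_cls z fun i c => ∑ j,
    if ¬ z.right.SameCycle i j ∧ cls z j = bar c then
      (zeta c : ℚ) * mergeCount lam (mtype z) r (len z i) (len z j) c (bar c) else 0)).trans ?_
  refine Finset.sum_congr rfl fun c hc => ?_
  have hc := mem_nonIdClasses.1 hc
  have hc' : bar c ≠ 1 := fun h => hc (bar_eq_one.1 h)
  have h1 : ∀ i j, (if cls z i = c then if ¬ z.right.SameCycle i j ∧ cls z j = bar c then
      (zeta c : ℚ) * mergeCount lam (mtype z) r (len z i) (len z j) c (bar c) else 0 else 0) =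
      ∑ μ ∈ subParts (lam 1) r, ∑ s ∈ Finset.HasAntidiagonal.antidiagonal (size μ + r),
        zeta c * (if lam + (cyc s.1 c + cyc s.2 (bar c)) = mtype z + singleAt 1 μ then
          (p μ r s.1 : ℚ) else 0) * (if ¬ z.right.SameCycle i j ∧ (cls z i = c ∧ len z i = s.1) ∧
            (cls z j = bar c ∧ len z j = s.2) then 1 else 0) := by
    intro i j
    by_cases hij : cls z i = c ∧ ¬ z.right.SameCycle i j ∧ cls z j = bar c
    · rw [if_pos hij.1, if_pos hij.2, mergeCount_eq lam _ r _ _ hc hc', Nat.cast_sum,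
        Finset.mul_sum]
      refine Finset.sum_congr rfl fun μ _ => ?_
      have h2 : ∀ s : ℕ × ℕ, s ≠ (len z i, len z j) → ¬ (¬ z.right.SameCycle i j ∧
          (cls z i = c ∧ len z i = s.1) ∧ (cls z j = bar c ∧ len z j = s.2)) :=
        fun s hs h => hs (Prod.ext h.2.1.2.symm h.2.2.2.symm)
      by_cases hl : size μ + r = len z i + len z j
      · rw [Finset.sum_eq_single (len z i, len z j)]
        · simp only [hl, hij, true_and, not_false_eq_true, if_true, mul_one]
          rw [Nat.cast_ite, Nat.cast_zero]
        · intro s _ hs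
          rw [if_neg (h2 s hs), mul_zero]
        · intro h
          exact absurd (Finset.HasAntidiagonal.mem_antidiagonal.2 hl.symm) h
      · rw [if_neg fun h => hl h.1, Nat.cast_zero, mul_zero]
        refine (Finset.sum_eq_zero fun s hs => ?_).symm
        rw [if_neg (h2 s _), mul_zero]
        rintro rfl
        exact hl (Finset.HasAntidiagonal.mem_antidiagonal.1 hs).symm
    · refine Eq.trans ?_ (Finset.sum_eq_zero fun μ _ => Finset.sum_eq_zero fun s _ => ?_).symm
      · split_ifs with h3 h4
        · exact absurd ⟨h3, h4⟩ hij
        · rfl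
        · rfl
      · refine mul_eq_zero_of_right _ (if_neg fun h => ?_)
        exact hij ⟨h.2.1.1, h.1, h.2.2.1⟩
  have h2 : ∀ i, (if cls z i = c then ∑ j, (if ¬ z.right.SameCycle i j ∧ cls z j = bar c then
      (zeta c : ℚ) * mergeCount lam (mtype z) r (len z i) (len z j) c (bar c) else 0) else 0) =
      ∑ j, ∑ μ ∈ subParts (lam 1) r, ∑ s ∈ Finset.HasAntidiagonal.antidiagonal (size μ + r),
        zeta c * (if lam + (cyc s.1 c + cyc s.2 (bar c)) = mtype z + singleAt 1 μ then
          (p μ r s.1 : ℚ) else 0) * (if ¬ z.right.SameCycle i j ∧ (cls z i = c ∧ len z i = s.1) ∧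
            (cls z j = bar c ∧ len z j = s.2) then 1 else 0) := fun i => by
    rw [← Finset.sum_congr rfl fun j _ => h1 i j]
    split_ifs
    · rfl
    · exact Finset.sum_const_zero.symm
  refine (Finset.sum_congr rfl fun i _ => h2 i).trans ?_
  simp only [mergeWeight, pairCount, Finset.mul_sum]
  rw [Finset.sum_congr rfl fun i _ => Finset.sum_comm, Finset.sum_comm]
  refine Finset.sum_congr rfl fun μ _ => ?_
  rw [Finset.sum_congr rfl fun i _ => Finset.sum_comm, Finset.sum_comm]

end MergeTerms

/-! ### The involution `c ↦ c̄` on classes -/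

section Involution

variable {Γ : Type*} [Group Γ] [Finite Γ]

theorem sum_nonIdClasses_bar (g : ConjClasses Γ → ℚ) :
    ∑ c ∈ nonIdClasses Γ, g (bar c) = ∑ c ∈ nonIdClasses Γ, g c := by
  refine Finset.sum_nbij' bar bar ?_ ?_ (fun c _ => bar_bar c) (fun c _ => bar_bar c)
    fun _ _ => rfl
  all_goals
    intro c hc
    exact mem_nonIdClasses.2 fun h => mem_nonIdClasses.1 hc (bar_eq_one.1 h)

theorem out_complexPairs {e : Sym2 (ConjClasses Γ)} (he : e ∈ complexPairs Γ) :
    e.out.1 ≠ bar e.out.1 ∧ e = s(e.out.1, bar e.out.1) := by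
  obtain ⟨c, hc, h⟩ := mem_complexPairs.1 he
  have h1 : s(e.out.1, e.out.2) = s(c, bar c) := (Quot.out_eq e).trans h
  rcases Sym2.eq_iff.1 h1 with ⟨h2, -⟩ | ⟨h2, -⟩
  · rw [h2]
    exact ⟨hc, h⟩
  · rw [h2, bar_bar]
    exact ⟨hc.symm, h.trans Sym2.eq_swap⟩

/-- The map `c ↦ {c, c̄}` has two-element fibres over the complex pairs; by invariance of `g`, any
representative of a pair may be used. -/
theorem sum_nonIdClasses (g : ConjClasses Γ → ℚ) (hg : ∀ c, g (bar c) = g c) :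
    ∑ c ∈ nonIdClasses Γ, g c =
      ∑ c ∈ realClasses Γ, g c + 2 * ∑ e ∈ complexPairs Γ, g e.out.1 := by
  classical
  rw [← Finset.sum_filter_add_sum_filter_not (nonIdClasses Γ) fun c => bar c = c]
  congr 1
  · refine Finset.sum_congr ?_ fun _ _ => rfl
    ext c
    rw [Finset.mem_filter, mem_nonIdClasses, mem_realClasses, and_comm]
  · rw [← Finset.sum_fiberwise_of_maps_to (t := complexPairs Γ) (g := fun c => s(c, bar c)),
      Finset.mul_sum]
    · refine Finset.sum_congr rfl fun e he => ?_
      obtain ⟨hne, h⟩ := out_complexPairs he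
      have hfib : (((nonIdClasses Γ).filter fun c => ¬ bar c = c).filter
          fun c => s(c, bar c) = e) = {e.out.1, bar e.out.1} := by
        ext c
        rw [Finset.mem_filter, Finset.mem_filter, mem_nonIdClasses, Finset.mem_insert,
          Finset.mem_singleton]
        constructor
        · rintro ⟨-, hc⟩
          rcases Sym2.eq_iff.1 (hc.trans h) with ⟨h2, -⟩ | ⟨h2, -⟩
          · exact Or.inl h2
          · exact Or.inr h2
        · rintro (rfl | rfl)
          · refine ⟨⟨fun h1 => hne ?_, hne.symm⟩, h.symm⟩
            rw [h1, bar_one]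
          · refine ⟨⟨fun h1 => hne ?_, by rw [bar_bar]; exact hne⟩, ?_⟩
            · rw [bar_eq_one.1 h1, bar_one]
            · rw [bar_bar, Sym2.eq_swap]
              exact h.symm
      rw [hfib, Finset.sum_pair hne, hg, two_mul]
    · intro c hc
      exact mem_complexPairs.2 ⟨c, Ne.symm (Finset.mem_filter.1 hc).2, rfl⟩

end Involution

/-! ### The sums over mergings, `I₃`, `I₄` and `I₅` -/

section MergeTerms

variable {Γ : Type*} [Group Γ] [Finite Γ] {n : ℕ} {r : ℕ}

/-- The parts `s` at `c` and `t` at `c̄` are distinguishable, so each raises its own multiplicity by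
one, and `μ` at the identity class affects neither. -/
theorem mergeWeight_of_ne (lam : PType Γ) (z : Wreath Γ n) {c : ConjClasses Γ} (hc : c ≠ 1)
    {μ : Multiset ℕ+} (hμ : μ ≤ lam 1) {s t : ℕ} (hs : 0 < s) (ht : 0 < t)
    (h : c ≠ bar c ∨ s ≠ t) [Decidable (mtype z = lam + cyc s c + cyc t (bar c) - singleAt 1 μ)] :
    mergeWeight lam r z c μ (s, t) =
      if mtype z = lam + cyc s c + cyc t (bar c) - singleAt 1 μ then
        ((s * t * zeta c * p μ r s *
          ((mult (lam c) s + 1) * (mult (lam (bar c)) t + 1)) : ℕ) : ℚ) else 0 := by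
  classical
  have hc' : bar c ≠ 1 := fun h => hc (bar_eq_one.1 h)
  have hle : singleAt 1 μ ≤ lam + cyc s c + cyc t (bar c) := by
    rw [add_assoc]
    exact (singleAt_le hμ).trans fun c => Multiset.le_add_right _ _
  rw [mergeWeight, pairCount_of_ne z hc hs ht h]
  by_cases hH : lam + (cyc s c + cyc t (bar c)) = mtype z + singleAt 1 μ
  · have h1 := congrArg (fun ρ : PType Γ => mult (ρ c) s) hH
    have h2 := congrArg (fun ρ : PType Γ => mult (ρ (bar c)) t) hH
    simp only [Pi.add_apply, mult_add] at h1 h2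
    rw [mult_cyc hs, if_pos ⟨rfl, rfl⟩, mult_cyc ht, if_neg (by tauto), singleAt_of_ne hc,
      show mult 0 s = 0 from rfl] at h1
    rw [mult_cyc hs, if_neg (fun h' => h.elim (fun h => h h'.1.symm) fun h => h h'.2.symm),
      mult_cyc ht, if_pos ⟨rfl, rfl⟩, singleAt_of_ne hc', show mult 0 t = 0 from rfl] at h2
    rw [if_pos hH, if_pos ((eq_tsub_iff hle).2 (by rw [add_assoc, hH])),
      ← Nat.add_zero (mult (mtype z c) s), ← Nat.add_zero (mult (mtype z (bar c)) t), ← h1, ← h2]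
    push_cast
    ring
  · rw [if_neg hH, if_neg fun h => hH (by rw [← (eq_tsub_iff hle).1 h, add_assoc]), mul_zero,
      zero_mul]

/-- Two equal parts are added at the same class. With `m` parts before, the ordered pairs of
different cycles number `(m + 2)(m + 1)`, twice the binomial coefficient. -/
theorem mergeWeight_of_eq (lam : PType Γ) (z : Wreath Γ n) {c : ConjClasses Γ} (hc : c ≠ 1)
    (hbar : bar c = c) {μ : Multiset ℕ+} (hμ : μ ≤ lam 1) {s : ℕ} (hs : 0 < s)
    [Decidable (mtype z = lam + cyc s c + cyc s c - singleAt 1 μ)] :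
    mergeWeight lam r z c μ (s, s) =
      2 * if mtype z = lam + cyc s c + cyc s c - singleAt 1 μ then
        ((s ^ 2 * zeta c * p μ r s * (mult (lam c) s + 2).choose 2 : ℕ) : ℚ) else 0 := by
  classical
  have hle : singleAt 1 μ ≤ lam + cyc s c + cyc s c := by
    rw [add_assoc]
    exact (singleAt_le hμ).trans fun c => Multiset.le_add_right _ _
  rw [mergeWeight, pairCount_of_eq z hc hbar hs, hbar]
  by_cases hH : lam + (cyc s c + cyc s c) = mtype z + singleAt 1 μ
  · have h1 := congrArg (fun ρ : PType Γ => mult (ρ c) s) hH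
    simp only [Pi.add_apply, mult_add] at h1
    rw [mult_cyc hs, if_pos ⟨rfl, rfl⟩, singleAt_of_ne hc, show mult 0 s = 0 from rfl] at h1
    rw [if_pos hH, if_pos ((eq_tsub_iff hle).2 (by rw [add_assoc, hH])),
      ← Nat.add_zero (mult (mtype z c) s), ← h1]
    push_cast
    rw [Nat.cast_choose_two]
    push_cast
    ring
  · rw [if_neg hH, if_neg fun h => hH (by rw [← (eq_tsub_iff hle).1 h, add_assoc]), mul_zero,
      zero_mul, mul_zero]

open Classical in
/-- The contribution of the mergings of cycles of different lengths. -/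
noncomputable def mergeLtTerm (lam : PType Γ) (r : ℕ) : PType Γ → ℚ :=
  ∑ c ∈ nonIdClasses Γ, ∑ μ ∈ subParts (lam 1) r,
    ∑ s ∈ (Finset.HasAntidiagonal.antidiagonal (size μ + r)).filter
      (fun s : ℕ × ℕ => 0 < s.1 ∧ s.1 < s.2),
    Pi.single (lam + cyc s.1 c + cyc s.2 (bar c) - singleAt 1 μ)
      ((s.1 * s.2 * zeta c * p μ r s.1 *
        ((mult (lam c) s.1 + 1) * (mult (lam (bar c)) s.2 + 1)) : ℕ) : ℚ)

open Classical in
/-- The contribution of the mergings of cycles of equal lengths with cycle-products in different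
classes. -/
noncomputable def mergeComplexTerm (lam : PType Γ) (r : ℕ) : PType Γ → ℚ :=
  ∑ e ∈ complexPairs Γ, ∑ μ ∈ subParts (lam 1) r,
    ∑ s ∈ (Finset.range (size μ + r + 1)).filter (fun s => 2 * s = size μ + r),
    Pi.single (lam + cyc s e.out.1 + cyc s (bar e.out.1) - singleAt 1 μ)
      ((s ^ 2 * zeta e.out.1 * p μ r s *
        ((mult (lam e.out.1) s + 1) * (mult (lam (bar e.out.1)) s + 1)) : ℕ) : ℚ)

open Classical in
/-- The contribution of the mergings of cycles of equal lengths with cycle-products in the same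
class. -/
noncomputable def mergeRealTerm (lam : PType Γ) (r : ℕ) : PType Γ → ℚ :=
  ∑ c ∈ realClasses Γ, ∑ μ ∈ subParts (lam 1) r,
    ∑ s ∈ (Finset.range (size μ + r + 1)).filter (fun s => 2 * s = size μ + r),
    Pi.single (lam + cyc s c + cyc s c - singleAt 1 μ)
      ((s ^ 2 * zeta c * p μ r s * (mult (lam c) s + 2).choose 2 : ℕ) : ℚ)

/-- The contribution of the mergings of cycles of equal lengths with cycle-products in `c`, `c̄`. -/
noncomputable def diagWeight (lam : PType Γ) (r : ℕ) (z : Wreath Γ n) (c : ConjClasses Γ) : ℚ :=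
  ∑ μ ∈ subParts (lam 1) r,
    ∑ s ∈ (Finset.range (size μ + r + 1)).filter (fun s => 2 * s = size μ + r),
      mergeWeight lam r z c μ (s, s)

theorem diagWeight_bar (lam : PType Γ) (z : Wreath Γ n) (c : ConjClasses Γ) :
    diagWeight lam r z (bar c) = diagWeight lam r z c := by
  refine Finset.sum_congr rfl fun μ hμ => Finset.sum_congr rfl fun s hs => ?_
  have hs := (Finset.mem_filter.1 hs).2
  exact mergeWeight_bar lam z c (mem_subParts.1 hμ).2 (by dsimp only; omega)

/-- Terms with a zero length vanish, so what remains is the part with `s₁ < s₂`, its mirror image,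
and the diagonal. -/
theorem sum_antidiagonal_eq (N : ℕ) (f : ℕ × ℕ → ℚ) (h : ∀ s, s.1 = 0 ∨ s.2 = 0 → f s = 0) :
    ∑ s ∈ Finset.HasAntidiagonal.antidiagonal N, f s =
      ∑ s ∈ (Finset.HasAntidiagonal.antidiagonal N).filter
        (fun s : ℕ × ℕ => 0 < s.1 ∧ s.1 < s.2), (f s + f s.swap) +
      ∑ s ∈ (Finset.range (N + 1)).filter (fun s => 2 * s = N), f (s, s) := by
  have h1 : ∀ s, f s = (if 0 < s.1 ∧ s.1 < s.2 then f s else 0) +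
      (if 0 < s.2 ∧ s.2 < s.1 then f s else 0) + if s.1 = s.2 then f s else 0 := fun s => by
    rcases lt_trichotomy s.1 s.2 with hs | hs | hs
    · rcases Nat.eq_zero_or_pos s.1 with h0 | h0
      · rw [h s (Or.inl h0)]
        simp
      · rw [if_pos ⟨h0, hs⟩, if_neg (by omega), if_neg (by omega), add_zero, add_zero]
    · rw [if_neg (by omega), if_neg (by omega), if_pos hs, zero_add, zero_add]
    · rcases Nat.eq_zero_or_pos s.2 with h0 | h0
      · rw [h s (Or.inr h0)]
        simp
      · rw [if_neg (by omega), if_pos ⟨h0, hs⟩, if_neg (by omega), add_zero, zero_add]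
  rw [Finset.sum_congr rfl fun s _ => h1 s, Finset.sum_add_distrib, Finset.sum_add_distrib,
    Finset.sum_add_distrib, Finset.sum_filter]
  congr 1
  · congr 1
    rw [Finset.sum_filter, ← Finset.Nat.sum_antidiagonal_swap]
    rfl
  · rw [← Finset.sum_filter]
    refine Finset.sum_nbij' (fun s => s.1) (fun s => (s, s)) ?_ ?_ ?_ ?_ ?_
    · intro s hs
      obtain ⟨h2, h3⟩ := Finset.mem_filter.1 hs
      have h2 := Finset.HasAntidiagonal.mem_antidiagonal.1 h2
      rw [Finset.mem_filter, Finset.mem_range]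
      omega
    · intro s hs
      rw [Finset.mem_filter, Finset.mem_range] at hs
      rw [Finset.mem_filter, Finset.HasAntidiagonal.mem_antidiagonal]
      exact ⟨by dsimp only; omega, rfl⟩
    · intro s hs
      exact Prod.ext rfl (Finset.mem_filter.1 hs).2
    · exact fun _ _ => rfl
    · intro s hs
      exact congrArg f (Prod.ext rfl (Finset.mem_filter.1 hs).2.symm)

/-- The factor `1/2` accounts for the order of the two cycles. Unequal lengths occur twice, for `(c,
s₁, s₂)` and `(c̄, s₂, s₁)`; equal lengths in a complex pair occur twice, for `c` and `c̄`; for a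
real class the factor `2` is in `mergeWeight_of_eq`. -/
theorem sum_merge_eq (lam : PType Γ) (hr : 1 ≤ r) (z : Wreath Γ n) :
    (∑ c ∈ nonIdClasses Γ, ∑ μ ∈ subParts (lam 1) r,
      ∑ s ∈ Finset.HasAntidiagonal.antidiagonal (size μ + r), mergeWeight lam r z c μ s) / 2 =
    mergeLtTerm lam r (mtype z) + mergeComplexTerm lam r (mtype z) +
      mergeRealTerm lam r (mtype z) := by
  classical
  set g : ConjClasses Γ → ℚ := fun c => ∑ μ ∈ subParts (lam 1) r,
    ∑ s ∈ (Finset.HasAntidiagonal.antidiagonal (size μ + r)).filter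
      (fun s : ℕ × ℕ => 0 < s.1 ∧ s.1 < s.2), mergeWeight lam r z c μ s with hg
  have h1 : ∀ c, ∑ μ ∈ subParts (lam 1) r,
      ∑ s ∈ Finset.HasAntidiagonal.antidiagonal (size μ + r), mergeWeight lam r z c μ s =
      g c + g (bar c) + diagWeight lam r z c := fun c => by
    rw [hg, diagWeight, ← Finset.sum_add_distrib, ← Finset.sum_add_distrib]
    refine Finset.sum_congr rfl fun μ hμ => ?_
    rw [sum_antidiagonal_eq _ _ fun s hs => by
      rw [mergeWeight, pairCount_eq_zero z c hs, mul_zero], ← Finset.sum_add_distrib]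
    congr 1
    refine Finset.sum_congr rfl fun s hs => ?_
    rw [mergeWeight_bar lam z c (mem_subParts.1 hμ).2
      (Finset.HasAntidiagonal.mem_antidiagonal.1 (Finset.mem_filter.1 hs).1)]
  have h2 : mergeLtTerm lam r (mtype z) = ∑ c ∈ nonIdClasses Γ, g c := by
    rw [mergeLtTerm, Finset.sum_apply]
    refine Finset.sum_congr rfl fun c hc => ?_
    rw [Finset.sum_apply]
    refine Finset.sum_congr rfl fun μ hμ => ?_
    rw [Finset.sum_apply]
    refine Finset.sum_congr rfl fun s hs => ?_
    have hs := (Finset.mem_filter.1 hs).2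
    rw [Pi.single_apply]
    exact (mergeWeight_of_ne lam z (mem_nonIdClasses.1 hc) (mem_subParts.1 hμ).1 hs.1
      (hs.1.trans hs.2) (Or.inr hs.2.ne)).symm
  have h3 : mergeComplexTerm lam r (mtype z) =
      ∑ e ∈ complexPairs Γ, diagWeight lam r z e.out.1 := by
    rw [mergeComplexTerm, Finset.sum_apply]
    refine Finset.sum_congr rfl fun e he => ?_
    have hne := (out_complexPairs he).1
    rw [Finset.sum_apply]
    refine Finset.sum_congr rfl fun μ hμ => ?_
    rw [Finset.sum_apply]
    refine Finset.sum_congr rfl fun s hs => ?_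
    have hs := (Finset.mem_filter.1 hs).2
    rw [Pi.single_apply, mergeWeight_of_ne lam z (fun h => hne (by rw [h, bar_one]))
      (mem_subParts.1 hμ).1 (by omega) (by omega) (Or.inl hne), sq]
  have h4 : 2 * mergeRealTerm lam r (mtype z) =
      ∑ c ∈ realClasses Γ, diagWeight lam r z c := by
    rw [mergeRealTerm, Finset.sum_apply, Finset.mul_sum]
    refine Finset.sum_congr rfl fun c hc => ?_
    have hc := mem_realClasses.1 hc
    rw [Finset.sum_apply, Finset.mul_sum]
    refine Finset.sum_congr rfl fun μ hμ => ?_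
    rw [Finset.sum_apply, Finset.mul_sum]
    refine Finset.sum_congr rfl fun s hs => ?_
    have hs := (Finset.mem_filter.1 hs).2
    rw [Pi.single_apply]
    exact (mergeWeight_of_eq lam z hc.2 hc.1 (mem_subParts.1 hμ).1 (by omega)).symm
  rw [Finset.sum_congr rfl fun c _ => h1 c, Finset.sum_add_distrib, Finset.sum_add_distrib,
    sum_nonIdClasses_bar, sum_nonIdClasses (diagWeight lam r z) (diagWeight_bar lam z), ← h2,
    ← h3, ← h4]
  ring

/-- The coefficient of an element of `Γ_n` in `K_λ(n) K_(r)(n)`, in the top degree. -/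
theorem coeff_formula (lam : PType Γ) (hr : 1 ≤ r) (z : Wreath Γ n)
    (hdeg : deg (mtype z) = deg lam + r) :
    (((classSum n lam * classSum n (cyc r 1)).coeff z : ℤ) : ℚ) =
      (splitIdTerm lam r + splitNeTerm lam r + mergeLtTerm lam r + mergeComplexTerm lam r +
        mergeRealTerm lam r) (mtype z) := by
  rw [coeff_eq_sum lam hr z hdeg, sum_split_one lam hr, sum_split_ne lam hr, sum_merge,
    sum_merge_eq lam hr]
  simp only [Pi.add_apply]
  ring

end MergeTerms

/-! ### The case `r = 0` -/

section Identity

variable {Γ : Type*} [Group Γ] {n : ℕ}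

theorem mtype_one : mtype (1 : Wreath Γ n) = 0 := by
  refine ptype_ext fun φ => ?_
  rw [map_mtype, map_zero]
  refine Finset.sum_eq_zero fun i _ => ?_
  have h1 : len (1 : Wreath Γ n) (⟨1, i⟩ : Pt Γ n).pos = 1 :=
    len_eq_of_return Nat.one_pos (by rw [one_pow, one_smul]) fun m h0 h1 => by omega
  have h2 : mon (1 : Wreath Γ n) (⟨1, i⟩ : Pt Γ n) = 1 :=
    mon_eq_of_return (by rw [one_pow, one_smul]; simp [Pt.tr])
  rw [mcycAt, h1, mon_eq_one.1 h2, mcyc_id, Nat.sub_self, cyc_zero, map_zero, zero_div]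

/-- A cycle with nontrivial product or of length greater than `1` would leave a part in the modified
type. -/
theorem mtype_eq_zero {y : Wreath Γ n} : mtype y = 0 ↔ y = 1 := by
  classical
  refine ⟨fun h => ?_, fun h => h ▸ mtype_one⟩
  have hm : ∀ c k, mult (mtype y c) k = 0 := fun c k => by rw [h]; rfl
  have hcls : ∀ i, cls y i = 1 := fun i => by
    by_contra hi
    have h1 := card_filter_cls_len y hi (len_pos y i)
    rw [hm, mul_zero, Finset.card_eq_zero, Finset.filter_eq_empty_iff] at h1
    exact h1 (Finset.mem_univ i) ⟨rfl, rfl⟩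
  have hlen : ∀ i, len y i = 1 := fun i => by
    by_contra hi
    have h0 := len_pos y i
    have h1 := card_filter_cls_one_len y (k := len y i - 1) (by omega)
    rw [hm, mul_zero, Finset.card_eq_zero, Finset.filter_eq_empty_iff] at h1
    exact h1 (Finset.mem_univ i) ⟨hcls i, by omega⟩
  refine wreath_ext fun P => ?_
  have h2 := pow_len_smul y P
  rw [hlen, pow_one, mon_eq_one.2 (hcls P.pos)] at h2
  rw [h2, one_smul]
  simp [Pt.tr]

open Classical in
theorem coeff_classSum_mul_zero [Finite Γ] (lam : PType Γ) (z : Wreath Γ n) :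
    (classSum n lam * classSum n 0).coeff z = if mtype z = lam then 1 else 0 := by
  rw [coeff_classSum_mul]
  have h : (Finset.univ.filter fun y : Wreath Γ n => mtype y = 0 ∧ mtype (z * y⁻¹) = lam) =
      if mtype z = lam then {1} else ∅ := by
    ext y
    rw [Finset.mem_filter, mtype_eq_zero]
    split_ifs with hz
    · rw [Finset.mem_singleton]
      refine ⟨fun h => h.2.1, ?_⟩
      rintro rfl
      exact ⟨Finset.mem_univ _, rfl, by rwa [inv_one, mul_one]⟩
    · refine ⟨?_, fun h => absurd h (Finset.notMem_empty _)⟩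
      rintro ⟨-, rfl, h⟩
      rw [inv_one, mul_one] at h
      exact absurd h hz
  rw [h]
  split_ifs <;> simp

end Identity

/-! ### From coefficients to structure constants and to `ℚ ⊗ 𝒢_Γ` -/

section Constants

variable {Γ : Type*} [Group Γ] [Finite Γ]

/-- If the coefficients depend on the modified type only, then `fhConst` is their common value. -/
theorem fhConst_eq {lam μ : PType Γ} {d : ℕ} {F : PType Γ → ℚ}
    (h : ∀ (n : ℕ) (z : Wreath Γ n), deg (mtype z) = d →
      (((classSum n lam * classSum n μ).coeff z : ℤ) : ℚ) = F (mtype z))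
    {ν : PType Γ} (hν : deg ν = d) : (fhConst lam μ ν : ℚ) = F ν := by
  have hex := exists_mtype ν
  have h1 := hex.choose_spec
  rw [fhConst, structConst, dif_pos hex, h _ _ (by rw [h1, hν]), h1]

theorem mem_ofDeg {d : ℕ} {ν : PType Γ} : ν ∈ ofDeg Γ d ↔ deg ν = d := by
  rw [ofDeg, Set.Finite.mem_toFinset]
  rfl

theorem deg_add_tsub {lam X Y : PType Γ} {d : ℕ} (h : Y ≤ lam) (hd : deg X = deg Y + d) :
    deg (lam + X - Y) = deg lam + d := by
  have hle : Y ≤ lam + X := h.trans fun c => Multiset.le_add_right (lam c) (X c)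
  have h1 := congrArg deg ((eq_tsub_iff hle).1 rfl)
  rw [deg_add, deg_add] at h1
  omega

/-- The element of `ℚ ⊗ 𝒢_Γ` of degree `d` with given coefficients. -/
noncomputable def tensorSum (d : ℕ) : (PType Γ → ℚ) →+ ℚ ⊗[ℤ] FHRing Γ where
  toFun f := ∑ ν ∈ ofDeg Γ d, f ν ⊗ₜ[ℤ] K ν
  map_zero' := by simp
  map_add' f g := by simp [TensorProduct.add_tmul, Finset.sum_add_distrib]

-- The degree condition guarantees that the basis element occurs in the sum; without it the term
-- would be lost.
open Classical in
theorem tensorSum_single {d : ℕ} {ν : PType Γ} (h : deg ν = d) (q : ℚ) :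
    tensorSum d (Pi.single ν q) = q ⊗ₜ[ℤ] K ν := by
  change ∑ ν' ∈ ofDeg Γ d, (Pi.single ν q : PType Γ → ℚ) ν' ⊗ₜ[ℤ] K ν' = _
  rw [Finset.sum_eq_single ν]
  · rw [Pi.single_eq_same]
  · intro ν' _ hne
    rw [Pi.single_eq_of_ne hne, TensorProduct.zero_tmul]
  · exact fun hn => absurd (mem_ofDeg.2 h) hn

theorem one_tmul_K_mul_K {lam μ : PType Γ} {F : PType Γ → ℚ}
    (h : ∀ ν, deg ν = deg lam + deg μ → (fhConst lam μ ν : ℚ) = F ν) :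
    (1 : ℚ) ⊗ₜ[ℤ] (K lam * K μ) = tensorSum (deg lam + deg μ) F := by
  rw [K_mul_K, TensorProduct.tmul_sum]
  refine Finset.sum_congr rfl fun ν hν => ?_
  rw [← h ν (mem_ofDeg.1 hν), TensorProduct.tmul_smul, TensorProduct.smul_tmul', zsmul_one]

theorem tensorSum_splitIdTerm (lam : PType Γ) (r : ℕ) :
    tensorSum (deg lam + r) (splitIdTerm lam r) =
      ∑ μ ∈ subParts (lam 1) (r + 1),
        ((((mult (lam 1) (size μ + r) + 1) * (size μ + r + 1) * r.factorial : ℕ) : ℚ) /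
            (((r + 1 - Multiset.card μ).factorial * multFact μ : ℕ) : ℚ)) ⊗ₜ[ℤ]
          K (lam + cyc (size μ + r) 1 - singleAt 1 μ) := by
  rw [splitIdTerm, map_sum]
  refine Finset.sum_congr rfl fun μ hμ => tensorSum_single ?_ _
  refine deg_add_tsub (singleAt_le (mem_subParts.1 hμ).1) ?_
  rw [deg_cyc, deg_singleAt]

theorem tensorSum_splitNeTerm (lam : PType Γ) (r : ℕ) :
    tensorSum (deg lam + r) (splitNeTerm lam r) =
      ∑ c ∈ nonIdClasses Γ, ∑ μ ∈ subParts (lam 1) r, ∑ k ∈ (lam c).toFinset,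
        ((((mult (lam c) (size μ + r + k) + 1) * (size μ + r + k) * r.factorial : ℕ) : ℚ) /
            (((r - Multiset.card μ).factorial * multFact μ : ℕ) : ℚ)) ⊗ₜ[ℤ]
          K (lam + cyc (size μ + r + k) c - (singleAt 1 μ + cyc k c)) := by
  rw [splitNeTerm, map_sum]
  refine Finset.sum_congr rfl fun c hc => ?_
  rw [map_sum]
  refine Finset.sum_congr rfl fun μ hμ => ?_
  rw [map_sum]
  refine Finset.sum_congr rfl fun k hk => tensorSum_single ?_ _
  refine deg_add_tsub (singleAt_add_cyc_le (mem_nonIdClasses.1 hc) (mem_subParts.1 hμ).1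
    (Multiset.mem_toFinset.1 hk)) ?_
  rw [deg_cyc, deg_add, deg_singleAt, deg_cyc]
  ring

theorem deg_merge {lam : PType Γ} {μ : Multiset ℕ+} {r s t : ℕ} (hμ : μ ∈ subParts (lam 1) r)
    (h : s + t = size μ + r) (c d : ConjClasses Γ) :
    deg (lam + cyc s c + cyc t d - singleAt 1 μ) = deg lam + r := by
  rw [add_assoc]
  refine deg_add_tsub (singleAt_le (mem_subParts.1 hμ).1) ?_
  rw [deg_add, deg_cyc, deg_cyc, deg_singleAt, h]

theorem tensorSum_mergeLtTerm (lam : PType Γ) (r : ℕ) :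
    tensorSum (deg lam + r) (mergeLtTerm lam r) =
      ∑ c ∈ nonIdClasses Γ, ∑ μ ∈ subParts (lam 1) r,
        ∑ s ∈ (Finset.HasAntidiagonal.antidiagonal (size μ + r)).filter
          (fun s : ℕ × ℕ => 0 < s.1 ∧ s.1 < s.2),
        ((s.1 * s.2 * zeta c * p μ r s.1 *
            ((mult (lam c) s.1 + 1) * (mult (lam (bar c)) s.2 + 1)) : ℕ) : ℚ) ⊗ₜ[ℤ]
          K (lam + cyc s.1 c + cyc s.2 (bar c) - singleAt 1 μ) := by
  rw [mergeLtTerm, map_sum]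
  refine Finset.sum_congr rfl fun c _ => ?_
  rw [map_sum]
  refine Finset.sum_congr rfl fun μ hμ => ?_
  rw [map_sum]
  refine Finset.sum_congr rfl fun s hs => tensorSum_single (deg_merge hμ ?_ _ _) _
  exact Finset.HasAntidiagonal.mem_antidiagonal.1 (Finset.mem_filter.1 hs).1

theorem tensorSum_mergeComplexTerm (lam : PType Γ) (r : ℕ) :
    tensorSum (deg lam + r) (mergeComplexTerm lam r) =
      ∑ e ∈ complexPairs Γ, ∑ μ ∈ subParts (lam 1) r,
        ∑ s ∈ (Finset.range (size μ + r + 1)).filter (fun s => 2 * s = size μ + r),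
        ((s ^ 2 * zeta e.out.1 * p μ r s *
            ((mult (lam e.out.1) s + 1) * (mult (lam (bar e.out.1)) s + 1)) : ℕ) : ℚ) ⊗ₜ[ℤ]
          K (lam + cyc s e.out.1 + cyc s (bar e.out.1) - singleAt 1 μ) := by
  rw [mergeComplexTerm, map_sum]
  refine Finset.sum_congr rfl fun e _ => ?_
  rw [map_sum]
  refine Finset.sum_congr rfl fun μ hμ => ?_
  rw [map_sum]
  refine Finset.sum_congr rfl fun s hs => tensorSum_single (deg_merge hμ ?_ _ _) _
  rw [← two_mul, (Finset.mem_filter.1 hs).2]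

theorem tensorSum_mergeRealTerm (lam : PType Γ) (r : ℕ) :
    tensorSum (deg lam + r) (mergeRealTerm lam r) =
      ∑ c ∈ realClasses Γ, ∑ μ ∈ subParts (lam 1) r,
        ∑ s ∈ (Finset.range (size μ + r + 1)).filter (fun s => 2 * s = size μ + r),
        ((s ^ 2 * zeta c * p μ r s * (mult (lam c) s + 2).choose 2 : ℕ) : ℚ) ⊗ₜ[ℤ]
          K (lam + cyc s c + cyc s c - singleAt 1 μ) := by
  rw [mergeRealTerm, map_sum]
  refine Finset.sum_congr rfl fun c _ => ?_
  rw [map_sum]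
  refine Finset.sum_congr rfl fun μ hμ => ?_
  rw [map_sum]
  refine Finset.sum_congr rfl fun s hs => tensorSum_single (deg_merge hμ ?_ _ _) _
  rw [← two_mul, (Finset.mem_filter.1 hs).2]

end Constants

end FarahatHigman

/-! ### The multiplication formula -/

theorem mainTheorem4 {Γ : Type*} [Group Γ] [Finite Γ] (lam : PType Γ) (r : ℕ) :
    -- the structure constants in question are independent of `n`
    (∀ (n : ℕ) (z : Wreath Γ n), deg (mtype z) = deg lam + r →
      (classSum n lam * classSum n (cyc r 1)).coeff z = fhConst lam (cyc r 1) (mtype z)) ∧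
    -- `r = 0`: multiplication by `K_∅`
    (r = 0 → K lam * K (cyc r 1) = K lam) ∧
    -- `r ≥ 1`: the formula, in `ℚ ⊗ 𝒢_Γ`, because its coefficients are written as fractions
    (1 ≤ r →
      (1 : ℚ) ⊗ₜ[ℤ] (K lam * K (cyc r 1)) =
        (∑ μ ∈ subParts (lam 1) (r + 1),
          ((((mult (lam 1) (size μ + r) + 1) * (size μ + r + 1) * r.factorial : ℕ) : ℚ) /
              (((r + 1 - Multiset.card μ).factorial * multFact μ : ℕ) : ℚ)) ⊗ₜ[ℤ]
            K (lam + cyc (size μ + r) 1 - singleAt 1 μ)) +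
        (∑ c ∈ nonIdClasses Γ, ∑ μ ∈ subParts (lam 1) r, ∑ k ∈ (lam c).toFinset,
          ((((mult (lam c) (size μ + r + k) + 1) * (size μ + r + k) * r.factorial : ℕ) : ℚ) /
              (((r - Multiset.card μ).factorial * multFact μ : ℕ) : ℚ)) ⊗ₜ[ℤ]
            K (lam + cyc (size μ + r + k) c - (singleAt 1 μ + cyc k c))) +
        (∑ c ∈ nonIdClasses Γ, ∑ μ ∈ subParts (lam 1) r,
          ∑ s ∈ (Finset.HasAntidiagonal.antidiagonal (size μ + r)).filter (fun s : ℕ × ℕ => 0 < s.1 ∧ s.1 < s.2),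
          ((s.1 * s.2 * zeta c * p μ r s.1 *
              ((mult (lam c) s.1 + 1) * (mult (lam (bar c)) s.2 + 1)) : ℕ) : ℚ) ⊗ₜ[ℤ]
            K (lam + cyc s.1 c + cyc s.2 (bar c) - singleAt 1 μ)) +
        (∑ e ∈ complexPairs Γ, ∑ μ ∈ subParts (lam 1) r,
          ∑ s ∈ (Finset.range (size μ + r + 1)).filter (fun s => 2 * s = size μ + r),
          ((s ^ 2 * zeta e.out.1 * p μ r s *
              ((mult (lam e.out.1) s + 1) * (mult (lam (bar e.out.1)) s + 1)) : ℕ) : ℚ) ⊗ₜ[ℤ]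
            K (lam + cyc s e.out.1 + cyc s (bar e.out.1) - singleAt 1 μ)) +
        (∑ c ∈ realClasses Γ, ∑ μ ∈ subParts (lam 1) r,
          ∑ s ∈ (Finset.range (size μ + r + 1)).filter (fun s => 2 * s = size μ + r),
          ((s ^ 2 * zeta c * p μ r s * (mult (lam c) s + 2).choose 2 : ℕ) : ℚ) ⊗ₜ[ℤ]
            K (lam + cyc s c + cyc s c - singleAt 1 μ))) := by
  classical
  have h0 : ∀ (n : ℕ) (z : Wreath Γ n), (classSum n lam * classSum n (cyc 0 1)).coeff z =
      (Pi.single lam 1 : PType Γ → ℤ) (mtype z) := fun n z => by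
    rw [cyc_zero, coeff_classSum_mul_zero, Pi.single_apply]
  -- For `r = 0` the coefficient is known in every degree, so the degree in `fhConst_eq` is taken to
  -- be that of `ν` itself.
  have h0' : ∀ ν, (fhConst lam (cyc 0 1) ν : ℚ) = ((Pi.single lam 1 : PType Γ → ℤ) ν : ℚ) :=
    fun ν => fhConst_eq (F := fun ν => ((Pi.single lam 1 : PType Γ → ℤ) ν : ℚ))
      (fun n z _ => by rw [h0]) rfl
  have h1 := fun (hr : 1 ≤ r) (n : ℕ) (z : Wreath Γ n) (hz : deg (mtype z) = deg lam + r) =>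
    coeff_formula lam hr z hz
  refine ⟨?_, ?_, ?_⟩
  · intro n z hz
    rcases Nat.eq_zero_or_pos r with rfl | hr
    · rw [h0]
      exact_mod_cast (h0' (mtype z)).symm
    -- The same explicit function of the modified type gives the coefficient at this `n` and at the
    -- `n` used by `fhConst`; this is the independence of `n`.
    · have h2 := fhConst_eq (h1 hr) hz
      rw [← h1 hr n z hz] at h2
      exact_mod_cast h2.symm
  · rintro rfl
    have h2 : ∀ ν, fhConst lam (cyc 0 1) ν = (Pi.single lam 1 : PType Γ → ℤ) ν := fun ν => by
      exact_mod_cast h0' ν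
    rw [K_mul_K, Finset.sum_eq_single lam]
    · rw [h2, Pi.single_eq_same, one_smul]
    · intro ν _ hν
      rw [h2, Pi.single_eq_of_ne hν, zero_smul]
    · intro h
      exact absurd (mem_ofDeg.2 (by rw [deg_cyc, add_zero])) h
  · intro hr
    rw [one_tmul_K_mul_K fun ν hν => fhConst_eq (h1 hr) (by rw [hν, deg_cyc]), deg_cyc, map_add,
      map_add, map_add, map_add, tensorSum_splitIdTerm, tensorSum_splitNeTerm,
      tensorSum_mergeLtTerm, tensorSum_mergeComplexTerm, tensorSum_mergeRealTerm]
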